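/- **Theorem.** Let $d\ge 2$ be an integer, let $\varepsilon>0$ be real, and put $k=\lceil d^2/\varepsilon\rceil$. If the Max-Weight Rectangle problem on $N$ weighted points in $d$ dimensions can be solved in time $O(N^{d-\varepsilon})$, then the Max-Weight $k$-Clique problem on weighted graphs with $n$ vertices can be solved in time $O(n^{k-\varepsilon})$. *Max-Weight Rectangle in $d$ dimensions*: given $N\ge 1$ points in $\mathbb{R}^d$ (not necessarily distinct) with real weights of arbitrary sign, output an axis-parallel closed box $\prod_{i=1}^d[a_i,b_i]$, $a_i\le b_i$, that maximizes the total weight of the points it contains. *Max-Weight $k$-Clique*: given a complete graph on $n\ge k$ vertices with real edge weights, output the maximum total edge weight of a $k$-clique. *Model of computation*: deterministic algorithms on the real RAM. One program serves all input sizes $m$ ($m=N$, resp. $m=n$). It works with reals ($+,-,\times,\div$, comparison, unit cost) and with words of $O(\log m)$ bits, used for counting and addressing ($+$, truncated $-$, $\times$, $\div$ with rounding down, comparison, conversion of a word to a real, unit cost), and with arrays of both that are addressed by words. There is no conversion of reals to words. Solvable in time $O(T(m))$ means that some program and some constant $C$ satisfy: on every instance of size $m$ the program halts after at most $C\cdot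 T(m)$ steps with a correct answer. -/

import Mathlib

/-! ### The real RAM

A random access machine with two kinds of data: words (natural numbers of `O(log n)` bits, used
for counting and addressing) and real numbers.  A program can name word registers, real registers,
word arrays and real arrays; it mentions only finitely many of them, and everything that does not
hold input is `0` at the start.  Every operation and every test costs one step. There is no
conversion from reals to words (no floor function). -/

namespace RealRAM

/-- A memory configuration. -/
structure State where
  /-- word registers -/
  w : ℕ → ℕ
  /-- real registers -/
  r : ℕ → ℝ
  /-- word arrays: `wa a i` is entry `i` of array `a` -/
  wa : ℕ → ℕ → ℕ
  /-- real arrays: `ra a i` is entry `i` of array `a` -/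
  ra : ℕ → ℕ → ℝ

/-- The elementary operations. In each of them the first argument `x` of an arithmetic operation is
the target register. -/
inductive Op where
  | skip
  | wconst (x c : ℕ)
  | wmov (x y : ℕ)
  | wadd (x y z : ℕ)
  | wsub (x y z : ℕ)
  | wmul (x y z : ℕ)
  | wdiv (x y z : ℕ)
  | wload (x a y : ℕ)
  | wstore (a y x : ℕ)
  | rcast (x y : ℕ)
  | rmov (x y : ℕ)
  | radd (x y z : ℕ)
  | rsub (x y z : ℕ)
  | rmul (x y z : ℕ)
  | rdiv (x y z : ℕ)
  | rload (x a y : ℕ)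
  | rstore (a y x : ℕ)

/-- Write `v` to word register `x`, provided that `v` is a word, i.e. less than `M`; on overflow
the machine is stuck. -/
def State.setW (M : ℕ) (s : State) (x v : ℕ) : Option State :=
  if v < M then some { s with w := Function.update s.w x v } else none

/-- Write `v` to real register `x`. -/
noncomputable def State.setR (s : State) (x : ℕ) (v : ℝ) : State :=
  { s with r := Function.update s.r x v }

open Classical in
/-- The effect of an operation, where words are the natural numbers less than `M`. The result is
`none` (the machine is stuck) on overflow and on division by zero. Word subtraction is truncated
at `0`, and word division rounds down. -/
noncomputable def Op.run (M : ℕ) (s : State) : Op → Option State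
  | .skip => some s
  | .wconst x c => s.setW M x c
  | .wmov x y => s.setW M x (s.w y)
  | .wadd x y z => s.setW M x (s.w y + s.w z)
  | .wsub x y z => s.setW M x (s.w y - s.w z)
  | .wmul x y z => s.setW M x (s.w y * s.w z)
  | .wdiv x y z => if s.w z = 0 then none else s.setW M x (s.w y / s.w z)
  | .wload x a y => s.setW M x (s.wa a (s.w y))
  | .wstore a y x =>
      some { s with wa := Function.update s.wa a (Function.update (s.wa a) (s.w y) (s.w x)) }
  | .rcast x y => some (s.setR x (s.w y : ℝ))
  | .rmov x y => some (s.setR x (s.r y))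
  | .radd x y z => some (s.setR x (s.r y + s.r z))
  | .rsub x y z => some (s.setR x (s.r y - s.r z))
  | .rmul x y z => some (s.setR x (s.r y * s.r z))
  | .rdiv x y z => if s.r z = 0 then none else some (s.setR x (s.r y / s.r z))
  | .rload x a y => some (s.setR x (s.ra a (s.w y)))
  | .rstore a y x =>
      some { s with ra := Function.update s.ra a (Function.update (s.ra a) (s.w y) (s.r x)) }

/-- The tests: comparison of two word registers or of two real registers. -/
inductive Test where
  | wlt (x y : ℕ)
  | weq (x y : ℕ)
  | rlt (x y : ℕ)
  | req (x y : ℕ)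

/-- The condition expressed by a test. -/
def Test.Holds (s : State) : Test → Prop
  | .wlt x y => s.w x < s.w y
  | .weq x y => s.w x = s.w y
  | .rlt x y => s.r x < s.r y
  | .req x y => s.r x = s.r y

/-- Programs: sequences, branchings and while loops of elementary operations. -/
inductive Prog where
  | op (o : Op)
  | seq (p q : Prog)
  | branch (b : Test) (p q : Prog)
  | loop (b : Test) (p : Prog)

/-- `Exec M p s t s'`: on a machine whose words are the natural numbers less than `M`, program `p`
started in `s` halts in `s'` after exactly `t` steps. -/
inductive Exec (M : ℕ) : Prog → State → ℕ → State → Prop where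
  | op {o : Op} {s s' : State} (h : o.run M s = some s') : Exec M (.op o) s 1 s'
  | seq {p q : Prog} {s s' s'' : State} {t u : ℕ}
      (hp : Exec M p s t s') (hq : Exec M q s' u s'') : Exec M (.seq p q) s (t + u) s''
  | branchTrue {b : Test} {p q : Prog} {s s' : State} {t : ℕ}
      (hb : b.Holds s) (hp : Exec M p s t s') : Exec M (.branch b p q) s (t + 1) s'
  | branchFalse {b : Test} {p q : Prog} {s s' : State} {t : ℕ}
      (hb : ¬ b.Holds s) (hq : Exec M q s t s') : Exec M (.branch b p q) s (t + 1) s'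
  | loopFalse {b : Test} {p : Prog} {s : State}
      (hb : ¬ b.Holds s) : Exec M (.loop b p) s 1 s
  | loopTrue {b : Test} {p : Prog} {s s' s'' : State} {t u : ℕ}
      (hb : b.Holds s) (hp : Exec M p s t s') (hl : Exec M (.loop b p) s' u s'') :
      Exec M (.loop b p) s (t + u + 1) s''

/-- A computational problem: its instances, their size parameter, the initial memory that presents
an instance to the machine, and which final memories hold a correct answer. -/
structure Problem where
  Instance : Type
  size : Instance → ℕ
  input : Instance → State
  Correct : Instance → State → Prop

/-- `P` has an `O(T(n))`-time algorithm: one program and constants `c`, `C` such that on every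
instance of size `n`, with words of at most `c log (n + 2)` bits, the program halts after at most
`C * T n` steps with a correct answer. -/
def SolvableInTime (P : Problem) (T : ℕ → ℝ) : Prop :=
  ∃ (p : Prog) (c : ℕ) (C : ℝ), ∀ I : P.Instance, ∃ (t : ℕ) (s : State),
    Exec ((P.size I + 2) ^ c) p (P.input I) t s ∧ (t : ℝ) ≤ C * T (P.size I) ∧ P.Correct I s

end RealRAM

/-! ### Max-Weight Rectangle -/

/-- `N ≥ 1` points in `ℝ^d` (not necessarily distinct) with real weights. -/
structure WeightedPoints (d : ℕ) where
  N : ℕ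
  pos : 0 < N
  pt : Fin N → Fin d → ℝ
  wt : Fin N → ℝ

open Classical in
/-- The total weight of the points in the closed box `∏ i, [lo i, hi i]`. -/
noncomputable def WeightedPoints.boxWeight {d : ℕ} (I : WeightedPoints d) (lo hi : Fin d → ℝ) : ℝ :=
  ∑ p : Fin I.N with I.pt p ∈ Set.Icc lo hi, I.wt p

/-- Max-Weight Rectangle in `d` dimensions. Input: `N` in word register `0`, the `i`-th coordinates
of the points in real array `i` for `i < d`, the weights in real array `d`. Output: an axis-parallel
box of maximum weight, its lower corner in real registers `0, …, d - 1` and its upper corner in real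
registers `d, …, 2 d - 1`. -/
noncomputable def maxWeightRectangle (d : ℕ) : RealRAM.Problem where
  Instance := WeightedPoints d
  size I := I.N
  input I :=
    { w := fun x => if x = 0 then I.N else 0
      r := fun _ => 0
      wa := fun _ _ => 0
      ra := fun a p =>
        if hp : p < I.N then
          if ha : a < d then I.pt ⟨p, hp⟩ ⟨a, ha⟩ else if a = d then I.wt ⟨p, hp⟩ else 0
        else 0 }
  Correct I s :=
    let lo : Fin d → ℝ := fun i => s.r i
    let hi : Fin d → ℝ := fun i => s.r (d + i)
    lo ≤ hi ∧ ∀ lo' hi' : Fin d → ℝ, lo' ≤ hi' → I.boxWeight lo' hi' ≤ I.boxWeight lo hi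

/-! ### Max-Weight k-Clique -/

/-- A complete graph on `n ≥ k` vertices with real edge weights (diagonal entries of `wt` are not
edges and carry no meaning). -/
structure WeightedGraph (k : ℕ) where
  n : ℕ
  le : k ≤ n
  wt : Fin n → Fin n → ℝ
  symm : ∀ u v, wt u v = wt v u

/-- The total weight of the edges with both ends in `S`, each edge counted once. -/
noncomputable def WeightedGraph.cliqueWeight {k : ℕ} (G : WeightedGraph k) (S : Finset (Fin G.n)) :
    ℝ :=
  ∑ u ∈ S, ∑ v ∈ S with u < v, G.wt u v

/-- Max-Weight `k`-Clique. Input: `n` in word register `0`, the weight matrix row by row in real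
array `0` (the weight of `{u, v}` is in entries `u * n + v` and `v * n + u`). Output: the maximum
weight of a `k`-clique in real register `0`. -/
noncomputable def maxWeightClique (k : ℕ) : RealRAM.Problem where
  Instance := WeightedGraph k
  size G := G.n
  input G :=
    { w := fun x => if x = 0 then G.n else 0
      r := fun _ => 0
      wa := fun _ _ => 0
      ra := fun a i =>
        if a = 0 then
          if h : i < G.n * G.n then
            G.wt (finProdFinEquiv.symm ⟨i, h⟩).1 (finProdFinEquiv.symm ⟨i, h⟩).2
          else 0
        else 0 }
  Correct G s :=
    IsGreatest {x : ℝ | ∃ S : Finset (Fin G.n), S.card = k ∧ G.cliqueWeight S = x} (s.r 0)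

/-!
In base `b ≈ n ^ (1 / D)` a vertex is a string of `D` digits, and `k` vertices are written, with
repetitions, into the expansions of the `2 d` real numbers that the sides of a box encode. A table
selects one side in each dimension and a prefix of its digits; for each value of the prefixes, the
boxes whose sides start with them form a cell, and by inclusion–exclusion `2 ^ d` signed points
contribute a prescribed weight to the boxes of that cell and nothing to the others. The table of a
pair of vertices contributes the weight of their edge plus a large bonus, and further tables check
that digits written twice agree. So an optimal box encodes a `k`-clique of maximum weight.

If no table reads more than `U` different digits, there are `O(b ^ U)` points, and
`U = (k / d + 1) D` can be achieved. As `d ^ 2 ≤ k ε`, time `N ^ (d - ε)` for rectangles becomes at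
most `n ^ (k - ε)`. Since rectangles need linear time, `1 ≤ d - ε`; this leaves time for the
overhead of the reduction and yields `d + 2 ≤ k`. The digits are arranged in one way if `2 d ≤ k`
(block design) and in another if `d + 2 ≤ k < 2 d` (head design).
-/

namespace RealRAM

/-! ### Executions -/

section Executions

variable {M M' x v t t₁ t₂ : ℕ} {o : Op} {b : Test} {p : Prog} {s s' s₁ s₂ : State}

theorem State.setW_mono (hM : M ≤ M') (h : s.setW M x v = some s') : s.setW M' x v = some s' := by
  unfold State.setW at h ⊢
  split_ifs at h with hv
  rwa [if_pos (hv.trans_le hM)]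

theorem Op.run_mono (hM : M ≤ M') (h : o.run M s = some s') : o.run M' s = some s' := by
  cases o <;> simp only [Op.run] at h ⊢ <;> try first | exact State.setW_mono hM h | exact h
  split_ifs at h ⊢
  exact State.setW_mono hM h

theorem Exec.mono (hM : M ≤ M') (h : Exec M p s t s') : Exec M' p s t s' := by
  induction h with
  | op h => exact .op (Op.run_mono hM h)
  | seq _ _ ihp ihq => exact .seq ihp ihq
  | branchTrue hb _ ih => exact .branchTrue hb ih
  | branchFalse hb _ ih => exact .branchFalse hb ih
  | loopFalse hb => exact .loopFalse hb
  | loopTrue hb _ _ ihp ihl => exact .loopTrue hb ihp ihl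

theorem Exec.deterministic (h₁ : Exec M p s t₁ s₁) (h₂ : Exec M p s t₂ s₂) :
    t₁ = t₂ ∧ s₁ = s₂ := by
  induction h₁ generalizing t₂ s₂ with
  | op h =>
    cases h₂ with
    | op h' => exact ⟨rfl, Option.some.inj (h.symm.trans h')⟩
  | seq _ _ ihp ihq =>
    cases h₂ with
    | seq hp hq =>
      obtain ⟨rfl, rfl⟩ := ihp hp
      obtain ⟨rfl, rfl⟩ := ihq hq
      exact ⟨rfl, rfl⟩
  | branchTrue hb _ ih =>
    cases h₂ with
    | branchTrue _ hp => obtain ⟨rfl, rfl⟩ := ih hp; exact ⟨rfl, rfl⟩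
    | branchFalse hb' _ => exact absurd hb hb'
  | branchFalse hb _ ih =>
    cases h₂ with
    | branchTrue hb' _ => exact absurd hb' hb
    | branchFalse _ hp => obtain ⟨rfl, rfl⟩ := ih hp; exact ⟨rfl, rfl⟩
  | loopFalse hb =>
    cases h₂ with
    | loopFalse _ => exact ⟨rfl, rfl⟩
    | loopTrue hb' _ _ => exact absurd hb' hb
  | loopTrue hb _ _ ihp ihl =>
    cases h₂ with
    | loopFalse hb' => exact absurd hb hb'
    | loopTrue _ hp hl =>
      obtain ⟨rfl, rfl⟩ := ihp hp
      obtain ⟨rfl, rfl⟩ := ihl hl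
      exact ⟨rfl, rfl⟩

end Executions

/-! ### Running a program in a shifted part of the memory -/

/-- The operation with all register and array names shifted by `B`. -/
def Op.shift (B : ℕ) : Op → Op
  | .skip => .skip
  | .wconst x c => .wconst (x + B) c
  | .wmov x y => .wmov (x + B) (y + B)
  | .wadd x y z => .wadd (x + B) (y + B) (z + B)
  | .wsub x y z => .wsub (x + B) (y + B) (z + B)
  | .wmul x y z => .wmul (x + B) (y + B) (z + B)
  | .wdiv x y z => .wdiv (x + B) (y + B) (z + B)
  | .wload x a y => .wload (x + B) (a + B) (y + B)
  | .wstore a y x => .wstore (a + B) (y + B) (x + B)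
  | .rcast x y => .rcast (x + B) (y + B)
  | .rmov x y => .rmov (x + B) (y + B)
  | .radd x y z => .radd (x + B) (y + B) (z + B)
  | .rsub x y z => .rsub (x + B) (y + B) (z + B)
  | .rmul x y z => .rmul (x + B) (y + B) (z + B)
  | .rdiv x y z => .rdiv (x + B) (y + B) (z + B)
  | .rload x a y => .rload (x + B) (a + B) (y + B)
  | .rstore a y x => .rstore (a + B) (y + B) (x + B)

/-- The test with all register names shifted by `B`. -/
def Test.shift (B : ℕ) : Test → Test
  | .wlt x y => .wlt (x + B) (y + B)
  | .weq x y => .weq (x + B) (y + B)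
  | .rlt x y => .rlt (x + B) (y + B)
  | .req x y => .req (x + B) (y + B)

/-- The program with all register and array names shifted by `B`: it runs a subroutine without
touching the memory of its caller, which uses the names below `B`. -/
def Prog.shift (B : ℕ) : Prog → Prog
  | .op o => .op (o.shift B)
  | .seq p q => .seq (p.shift B) (q.shift B)
  | .branch b p q => .branch (b.shift B) (p.shift B) (q.shift B)
  | .loop b p => .loop (b.shift B) (p.shift B)

/-- The sequence that agrees with `f` below `B` and continues with all of `g`. -/
def splice {α : Type*} (B : ℕ) (f g : ℕ → α) : ℕ → α := fun x => if x < B then f x else g (x - B)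

section Splice

variable {α : Type*} {B : ℕ}

theorem splice_add (f g : ℕ → α) (x : ℕ) : splice B f g (x + B) = g x := by
  simp [splice]

theorem splice_of_lt (f g : ℕ → α) {x : ℕ} (h : x < B) : splice B f g x = f x :=
  if_pos h

theorem splice_eq_self {f g : ℕ → α} (h : ∀ x, f (x + B) = g x) :
    splice B f g = f := by
  funext x
  by_cases hx : x < B
  · exact splice_of_lt f g hx
  · obtain ⟨y, rfl⟩ := Nat.exists_eq_add_of_le' (not_lt.1 hx)
    rw [splice_add, h]

theorem update_splice (f g : ℕ → α) (x : ℕ) (v : α) :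
    Function.update (splice B f g) (x + B) v = splice B f (Function.update g x v) := by
  funext y
  obtain hy | ⟨z, rfl⟩ : y < B ∨ ∃ z, y = z + B :=
    (lt_or_ge y B).imp_right Nat.exists_eq_add_of_le'
  · rw [Function.update_of_ne (by omega), splice_of_lt _ _ hy, splice_of_lt _ _ hy]
  · simp only [splice_add, Function.update_apply, add_left_inj]

end Splice

/-- The memory that agrees with `S` on the names below `B` and holds a shifted copy of `s` in the
remaining part. -/
def State.splice (B : ℕ) (S s : State) : State where
  w := RealRAM.splice B S.w s.w
  r := RealRAM.splice B S.r s.r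
  wa := RealRAM.splice B S.wa s.wa
  ra := RealRAM.splice B S.ra s.ra

section Shift

variable {M B x v t : ℕ} {o : Op} {p : Prog} {s s' : State}

theorem State.splice_eq_self {S s : State} (hw : ∀ x, S.w (x + B) = s.w x)
    (hr : ∀ x, S.r (x + B) = s.r x) (hwa : ∀ x, S.wa (x + B) = s.wa x)
    (hra : ∀ x, S.ra (x + B) = s.ra x) : S.splice B s = S := by
  rw [State.splice, RealRAM.splice_eq_self hw, RealRAM.splice_eq_self hr,
    RealRAM.splice_eq_self hwa, RealRAM.splice_eq_self hra]

theorem State.setW_splice (S : State) (h : s.setW M x v = some s') :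
    (S.splice B s).setW M (x + B) v = some (S.splice B s') := by
  unfold State.setW at h ⊢
  split_ifs at h with hv
  rw [if_pos hv, ← Option.some.inj h]
  simp only [State.splice, update_splice]

theorem Op.run_shift (S : State) (h : o.run M s = some s') :
    (o.shift B).run M (S.splice B s) = some (S.splice B s') := by
  have setW : ∀ x v, s.setW M x v = some s' → _ := fun x v => State.setW_splice (B := B) S
  cases o <;> simp only [Op.run, Op.shift] at h ⊢ <;>
    simp only [State.splice, splice_add] at setW ⊢
  all_goals try exact setW _ _ h
  all_goals try simp only [← Option.some.inj h, State.setR, update_splice]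
  all_goals split_ifs at h ⊢
  · exact setW _ _ h
  · simp only [← Option.some.inj h, State.setR, update_splice]

theorem Test.holds_shift (b : Test) (S s : State) :
    (b.shift B).Holds (S.splice B s) ↔ b.Holds s := by
  cases b <;> simp only [Test.shift, Test.Holds, State.splice, splice_add]

theorem Exec.shift (h : Exec M p s t s') (B : ℕ) (S : State) :
    Exec M (p.shift B) (S.splice B s) t (S.splice B s') := by
  induction h with
  | op h => exact .op (Op.run_shift S h)
  | seq _ _ ihp ihq => exact .seq ihp ihq
  | branchTrue hb _ ih => exact .branchTrue ((Test.holds_shift ..).2 hb) ih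
  | branchFalse hb _ ih => exact .branchFalse (mt (Test.holds_shift ..).1 hb) ih
  | loopFalse hb => exact .loopFalse (mt (Test.holds_shift ..).1 hb)
  | loopTrue hb _ _ ihp ihl => exact .loopTrue ((Test.holds_shift ..).2 hb) ihp ihl

end Shift

/-! ### A program reads at most one array entry per step -/

/-- The states `s` and `s'` differ at most in entry `c.2` of real array `c.1`. -/
structure AgreeOff (c : ℕ × ℕ) (s s' : State) : Prop where
  w : s'.w = s.w
  r : s'.r = s.r
  wa : s'.wa = s.wa
  ra : ∀ a i, (a, i) ≠ c → s'.ra a i = s.ra a i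

section ReadSet

variable {M t : ℕ} {o : Op} {p : Prog} {c : ℕ × ℕ} {s s' s₂ : State}

theorem AgreeOff.holds_iff (h : AgreeOff c s s₂) (b : Test) : b.Holds s₂ ↔ b.Holds s := by
  cases b <;> simp only [Test.Holds, h.w, h.r]

/-- The entry of a real array that an operation reads; an arbitrary one if it reads none. -/
def Op.entryRead (s : State) : Op → ℕ × ℕ
  | .rload _ a y => (a, s.w y)
  | _ => (0, 0)

theorem Op.run_agreeOff (h : o.run M s = some s') (hc : c ≠ o.entryRead s)
    (hs : AgreeOff c s s₂) : ∃ s₂', o.run M s₂ = some s₂' ∧ AgreeOff c s' s₂' := by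
  obtain ⟨w, r, wa, ra⟩ := s
  obtain ⟨w₂, r₂, wa₂, ra₂⟩ := s₂
  obtain ⟨rfl, rfl, rfl, hra⟩ := hs
  dsimp only at hra
  cases o <;> simp only [Op.run, State.setW, State.setR] at h ⊢
  all_goals try split_ifs at h ⊢
  all_goals obtain rfl := Option.some.inj h
  case rload x a y =>
    exact ⟨_, rfl, rfl, congrArg (Function.update _ x) (hra _ _ hc.symm), rfl, hra⟩
  case rstore b y x =>
    refine ⟨_, rfl, rfl, rfl, rfl, fun a i hne => ?_⟩
    obtain rfl | ha := eq_or_ne a b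
    · simp only [Function.update_self, Function.update_apply, hra _ _ hne]
    · simp only [Function.update_of_ne ha, hra _ _ hne]
  all_goals exact ⟨_, rfl, rfl, rfl, rfl, hra⟩

theorem Exec.exists_read_set (h : Exec M p s t s') :
    ∃ R : Finset (ℕ × ℕ), R.card ≤ t ∧ ∀ c ∉ R, ∀ s₂, AgreeOff c s s₂ →
      ∃ s₂', Exec M p s₂ t s₂' ∧ AgreeOff c s' s₂' := by
  induction h with
  | @op o s s' h =>
    refine ⟨{o.entryRead s}, by simp, fun c hc s₂ hs => ?_⟩
    obtain ⟨s₂', h₂, hs'⟩ := Op.run_agreeOff h (by simpa using hc) hs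
    exact ⟨s₂', .op h₂, hs'⟩
  | seq _ _ ihp ihq =>
    obtain ⟨R, hR, hp⟩ := ihp
    obtain ⟨R', hR', hq⟩ := ihq
    refine ⟨R ∪ R', (Finset.card_union_le ..).trans (by omega), fun c hc s₂ hs => ?_⟩
    rw [Finset.mem_union, not_or] at hc
    obtain ⟨s₃, hp, hs₃⟩ := hp c hc.1 s₂ hs
    obtain ⟨s₄, hq, hs₄⟩ := hq c hc.2 s₃ hs₃
    exact ⟨s₄, .seq hp hq, hs₄⟩
  | branchTrue hb _ ih =>
    obtain ⟨R, hR, hp⟩ := ih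
    refine ⟨R, by omega, fun c hc s₂ hs => ?_⟩
    obtain ⟨s₃, hp, hs₃⟩ := hp c hc s₂ hs
    exact ⟨s₃, .branchTrue ((hs.holds_iff _).2 hb) hp, hs₃⟩
  | branchFalse hb _ ih =>
    obtain ⟨R, hR, hq⟩ := ih
    refine ⟨R, by omega, fun c hc s₂ hs => ?_⟩
    obtain ⟨s₃, hq, hs₃⟩ := hq c hc s₂ hs
    exact ⟨s₃, .branchFalse (mt (hs.holds_iff _).1 hb) hq, hs₃⟩
  | loopFalse hb =>
    exact ⟨∅, by simp, fun c _ s₂ hs => ⟨s₂, .loopFalse (mt (hs.holds_iff _).1 hb), hs⟩⟩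
  | loopTrue hb _ _ ihp ihl =>
    obtain ⟨R, hR, hp⟩ := ihp
    obtain ⟨R', hR', hl⟩ := ihl
    refine ⟨R ∪ R', (Finset.card_union_le ..).trans (by omega), fun c hc s₂ hs => ?_⟩
    rw [Finset.mem_union, not_or] at hc
    obtain ⟨s₃, hp, hs₃⟩ := hp c hc.1 s₂ hs
    obtain ⟨s₄, hl, hs₄⟩ := hl c hc.2 s₃ hs₃
    exact ⟨s₄, .loopTrue ((hs.holds_iff _).2 hb) hp hl, hs₄⟩

end ReadSet

end RealRAM

namespace CliqueToRectangle

open RealRAM Filter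

/-! ### Max-Weight Rectangle takes linear time -/

/-- The instance with `N` points at the origin whose weights are given by `f`. -/
def originPoints (d : ℕ) {N : ℕ} (hN : 0 < N) (f : Fin N → ℝ) : WeightedPoints d where
  N := N
  pos := hN
  pt _ _ := 0
  wt := f

section OriginPoints

variable {d N : ℕ} {hN : 0 < N} {f g : Fin N → ℝ}

open Classical in
theorem boxWeight_originPoints (lo hi : Fin d → ℝ) :
    (originPoints d hN f).boxWeight lo hi = if 0 ∈ Set.Icc lo hi then ∑ p, f p else 0 := by
  change (∑ p : Fin N with (0 : Fin d → ℝ) ∈ Set.Icc lo hi, f p) = _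
  split_ifs with h <;> simp only [h, Finset.filter_true, Finset.filter_false, Finset.sum_empty]

theorem origin_mem_box_iff (hd : 0 < d) {s : State}
    (hs : (maxWeightRectangle d).Correct (originPoints d hN f) s) (hf : ∑ p, f p ≠ 0) :
    (0 : Fin d → ℝ) ∈ Set.Icc (fun i : Fin d => s.r i) (fun i : Fin d => s.r (d + i)) ↔
      0 < ∑ p, f p := by
  have h_in := hs.2 0 0 le_rfl
  have h_out := hs.2 1 1 le_rfl
  have one_not_le : ¬ (1 : Fin d → ℝ) ≤ 0 := fun h => absurd (h ⟨0, hd⟩) (by norm_num)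
  rw [boxWeight_originPoints, boxWeight_originPoints] at h_in h_out
  rw [if_pos (by simp)] at h_in
  rw [if_neg fun h => one_not_le h.1] at h_out
  split_ifs at h_in h_out with hmem
  · exact iff_of_true hmem (h_out.lt_of_ne' hf)
  · exact iff_of_false hmem h_in.not_gt

theorem agreeOff_input_originPoints {q : Fin N} (h : ∀ p ≠ q, g p = f p) :
    AgreeOff (d, q) ((maxWeightRectangle d).input (originPoints d hN f))
      ((maxWeightRectangle d).input (originPoints d hN g)) where
  w := rfl
  r := rfl
  wa := rfl
  ra a i hne := by
    simp only [maxWeightRectangle, originPoints]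
    split_ifs with hi ha had
    · rfl
    · exact h _ fun hq => hne (by rw [had, ← hq])
    · rfl
    · rfl

/-- A program that skips the weight of some point cannot tell whether the total is positive. -/
theorem le_steps_of_forall_correct (hd : 0 < d) (hN : 0 < N) {M t : ℕ} {p : Prog} {s : State}
    (hp : ∀ f, ∃ t s, Exec M p ((maxWeightRectangle d).input (originPoints d hN f)) t s ∧
      (maxWeightRectangle d).Correct (originPoints d hN f) s)
    (he : Exec M p ((maxWeightRectangle d).input (originPoints d hN fun _ => -1)) t s)
    (hs : (maxWeightRectangle d).Correct (originPoints d hN fun _ => -1) s) : N ≤ t := by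
  classical
  by_contra! ht
  obtain ⟨R, hR, hagree⟩ := he.exists_read_set
  obtain ⟨q, hq⟩ : ∃ q : Fin N, (d, (q : ℕ)) ∉ R := by
    by_contra! hall
    have hcard : (Finset.univ : Finset (Fin N)).card ≤ R.card :=
      Finset.card_le_card_of_injOn (fun q : Fin N => (d, (q : ℕ))) (fun q _ => hall q)
        fun _ _ _ _ h => Fin.ext (Prod.ext_iff.1 h).2
    rw [Finset.card_univ, Fintype.card_fin] at hcard
    omega
  let f : Fin N → ℝ := Function.update (fun _ => -1) q N
  have hsum : ∑ p, f p = 1 := by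
    rw [Finset.sum_update_of_mem (Finset.mem_univ q)]
    simp [Finset.card_sdiff, Nat.cast_sub hN]
  obtain ⟨t', s', he', hs'⟩ := hp f
  obtain ⟨s₂, he₂, hs₂⟩ := hagree _ hq _
    (agreeOff_input_originPoints (g := f) fun p hp => Function.update_of_ne hp _ _)
  obtain ⟨-, rfl⟩ := he'.deterministic he₂
  have hpos := origin_mem_box_iff hd hs' (by simp [hsum])
  have hneg := origin_mem_box_iff hd hs (by simp [hN.ne'])
  rw [hs₂.r, hneg, hsum] at hpos
  simp at hpos
  linarith

end OriginPoints

theorem one_le_of_forall_natCast_le_mul_rpow {α C : ℝ}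
    (h : ∀ N : ℕ, 0 < N → (N : ℝ) ≤ C * (N : ℝ) ^ α) : 1 ≤ α := by
  by_contra! hα
  have hlim : Tendsto (fun N : ℕ => (N : ℝ) ^ (1 - α)) atTop atTop :=
    (tendsto_rpow_atTop (sub_pos.2 hα)).comp tendsto_natCast_atTop_atTop
  obtain ⟨N, hCN, hN⟩ := ((hlim.eventually_gt_atTop C).and (eventually_gt_atTop 0)).exists
  have hN' : (0 : ℝ) < N := Nat.cast_pos.2 hN
  refine (h N hN).not_gt ?_
  calc C * (N : ℝ) ^ α < (N : ℝ) ^ (1 - α) * (N : ℝ) ^ α := by gcongr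
    _ = N := by rw [← Real.rpow_add hN', sub_add_cancel, Real.rpow_one]

theorem one_le_of_solvable_maxWeightRectangle {d : ℕ} (hd : 0 < d) {α : ℝ}
    (h : SolvableInTime (maxWeightRectangle d) fun N => (N : ℝ) ^ α) : 1 ≤ α := by
  obtain ⟨p, c, C, h⟩ := h
  refine one_le_of_forall_natCast_le_mul_rpow (C := C) fun N hN => ?_
  obtain ⟨t, s, he, ht, hs⟩ := h (originPoints d hN fun _ => -1)
  have hNt : N ≤ t := le_steps_of_forall_correct hd hN
    (fun f => (h (originPoints d hN f)).imp fun t => Exists.imp fun s hts => ⟨hts.1, hts.2.2⟩) he hs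
  exact (Nat.cast_le.2 hNt).trans ht

end CliqueToRectangle

namespace CliqueToRectangle

/-! ### Digits of real and natural numbers -/

/-- The real number `0.a₀a₁…a_{p-1}` in base `b`, plus `e` units in the last place. -/
noncomputable def fraction (b : ℕ) : (ℕ → ℕ) → ℕ → ℝ → ℝ
  | _, 0, e => e
  | a, p + 1, e => (a 0 + fraction b (fun i => a (i + 1)) p e) / b

/-- The base-`b` digits of `x` after the point, for `0 ≤ x < 1`. -/
noncomputable def fracDigit (b : ℕ) : ℝ → ℕ → ℕ
  | x, 0 => ⌊b * x⌋₊
  | x, i + 1 => fracDigit b (b * x - ⌊b * x⌋₊) i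

/-- The base-`b` expansion of `x` starts with `0.a₀a₁…a_{p-1}`. -/
def StartsWith (b : ℕ) (x : ℝ) (a : ℕ → ℕ) (p : ℕ) : Prop :=
  fraction b a p 0 ≤ x ∧ x < fraction b a p 1

section Fraction

variable {b p q : ℕ} {x : ℝ} {a : ℕ → ℕ}

theorem fraction_nonneg (b : ℕ) (a : ℕ → ℕ) (p : ℕ) {e : ℝ} (he : 0 ≤ e) :
    0 ≤ fraction b a p e := by
  induction p generalizing a with
  | zero => exact he
  | succ p ih =>
    have := ih fun i => a (i + 1)
    rw [fraction]
    positivity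

theorem fraction_zero_lt_one (hb : 0 < b) (a : ℕ → ℕ) (p : ℕ) :
    fraction b a p 0 < fraction b a p 1 := by
  induction p generalizing a with
  | zero => exact zero_lt_one
  | succ p ih =>
    have := ih fun i => a (i + 1)
    simp only [fraction]
    gcongr

theorem startsWith_succ (hb : 0 < b) :
    StartsWith b x a (p + 1) ↔ StartsWith b (b * x - a 0) (fun i => a (i + 1)) p := by
  have hb' : (0 : ℝ) < b := Nat.cast_pos.2 hb
  simp only [StartsWith, fraction, div_le_iff₀ hb', lt_div_iff₀ hb', le_sub_iff_add_le',
    sub_lt_iff_lt_add', mul_comm x]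

theorem startsWith_iff (hb : 0 < b) (ha : ∀ i < p, a i < b) :
    StartsWith b x a p ↔ 0 ≤ x ∧ x < 1 ∧ ∀ i < p, a i = fracDigit b x i := by
  have hb' : (0 : ℝ) < b := Nat.cast_pos.2 hb
  induction p generalizing a x with
  | zero => simp [StartsWith, fraction]
  | succ p ih =>
    refine ((startsWith_succ hb).trans (ih fun i hi => ha (i + 1) (by omega))).trans ?_
    have ha_le : (a 0 : ℝ) + 1 ≤ b := by exact_mod_cast ha 0 (by omega)
    have ha_nonneg : (0 : ℝ) ≤ a 0 := Nat.cast_nonneg _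
    constructor
    · rintro ⟨h_nonneg, h_lt, h_digits⟩
      have hbx : 0 ≤ b * x := by linarith [ha_nonneg]
      have hfloor : ⌊b * x⌋₊ = a 0 :=
        (Nat.floor_eq_iff hbx).2 ⟨by linarith, by linarith⟩
      refine ⟨(mul_nonneg_iff_of_pos_left hb').1 hbx,
        (mul_lt_iff_lt_one_right hb').1 (by linarith), fun i hi => ?_⟩
      cases i with
      | zero => exact hfloor.symm
      | succ i => rw [h_digits i (by omega), fracDigit, hfloor]
    · rintro ⟨h_nonneg, -, h_digits⟩
      have hfloor : a 0 = ⌊b * x⌋₊ := h_digits 0 (by omega)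
      have := (Nat.floor_eq_iff (mul_nonneg hb'.le h_nonneg)).1 hfloor.symm
      refine ⟨by linarith, by linarith, fun i hi => ?_⟩
      rw [h_digits (i + 1) (by omega), fracDigit, ← hfloor]

theorem startsWith_fraction (hb : 0 < b) (ha : ∀ i, a i < b) (hpq : p ≤ q) :
    StartsWith b (fraction b a q 0) a p := by
  have h : StartsWith b (fraction b a q 0) a q := ⟨le_rfl, fraction_zero_lt_one hb _ _⟩
  rw [startsWith_iff hb fun i _ => ha i] at h ⊢
  exact ⟨h.1, h.2.1, fun i hi => h.2.2 i (hi.trans_le hpq)⟩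

end Fraction

/-- The assignment of the base-`b` digits of `c`, least significant first, to the names in `l`. -/
def assignDigits (b : ℕ) : List ℕ → ℕ → ℕ → ℕ
  | [], _ => fun _ => 0
  | δ :: l, c => Function.update (assignDigits b l (c / b)) δ (c % b)

section AssignDigits

variable {b : ℕ} {l : List ℕ}

theorem assignDigits_lt (hb : 0 < b) (l : List ℕ) (c δ : ℕ) : assignDigits b l c δ < b := by
  induction l generalizing c with
  | nil => exact hb
  | cons γ l ih =>
    simp only [assignDigits, Function.update_apply]
    split_ifs
    · exact Nat.mod_lt _ hb
    · exact ih _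

theorem assignDigits_injOn (hl : l.Nodup) {c c' : ℕ} (hc : c < b ^ l.length)
    (hc' : c' < b ^ l.length) (h : ∀ δ ∈ l, assignDigits b l c δ = assignDigits b l c' δ) :
    c = c' := by
  induction l generalizing c c' with
  | nil => simp at hc hc'; omega
  | cons γ l ih =>
    rw [List.nodup_cons] at hl
    rw [List.length_cons, pow_succ'] at hc hc'
    have hmod : c % b = c' % b := by simpa [assignDigits] using h γ (by simp)
    have hdiv : c / b = c' / b := by
      refine ih hl.2 (Nat.div_lt_of_lt_mul hc) (Nat.div_lt_of_lt_mul hc') fun δ hδ => ?_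
      have hne : δ ≠ γ := fun e => hl.1 (e ▸ hδ)
      simpa [assignDigits, Function.update_of_ne hne] using h δ (by simp [hδ])
    rw [← Nat.div_add_mod c b, ← Nat.div_add_mod c' b, hmod, hdiv]

theorem exists_assignDigits_eq (hl : l.Nodup) {A : ℕ → ℕ} (hA : ∀ δ, A δ < b) :
    ∃ c < b ^ l.length, ∀ δ ∈ l, assignDigits b l c δ = A δ := by
  induction l with
  | nil => exact ⟨0, by simp, by simp⟩
  | cons γ l ih =>
    rw [List.nodup_cons] at hl
    obtain ⟨c, hc, h⟩ := ih hl.2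
    have hb : 0 < b := (Nat.zero_le _).trans_lt (hA 0)
    refine ⟨b * c + A γ, ?_, fun δ hδ => ?_⟩
    · calc b * c + A γ < b * (c + 1) := by have := hA γ; rw [mul_add_one]; omega
        _ ≤ b * b ^ l.length := Nat.mul_le_mul_left _ hc
        _ = b ^ (γ :: l).length := (pow_succ' _ _).symm
    · have hdiv : (b * c + A γ) / b = c := by
        rw [Nat.mul_add_div hb, Nat.div_eq_of_lt (hA γ), add_zero]
      have hmod : (b * c + A γ) % b = A γ := by
        rw [Nat.mul_add_mod, Nat.mod_eq_of_lt (hA γ)]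
      simp only [assignDigits, Function.update_apply, hdiv, hmod]
      split_ifs with hδγ
      · rw [hδγ]
      · exact h δ (by simpa [hδγ] using hδ)

end AssignDigits

/-- The number with base-`b` digits `A off, …, A (off + D - 1)`, least significant first. -/
def digitsValue (b : ℕ) (A : ℕ → ℕ) : ℕ → ℕ → ℕ
  | 0, _ => 0
  | D + 1, off => digitsValue b A D (off + 1) * b + A off

section DigitsValue

variable {b D off : ℕ} {A A' : ℕ → ℕ}

theorem forall_lt_succ_add {P : ℕ → Prop} :
    (∀ i < D + 1, P (off + i)) ↔ P off ∧ ∀ i < D, P (off + 1 + i) := by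
  simp only [Nat.forall_lt_succ_left, add_zero, add_assoc, add_comm 1]

theorem digitsValue_congr (h : ∀ i < D, A (off + i) = A' (off + i)) :
    digitsValue b A D off = digitsValue b A' D off := by
  induction D generalizing off with
  | zero => rfl
  | succ D ih =>
    rw [forall_lt_succ_add (P := fun δ => A δ = A' δ)] at h
    rw [digitsValue, digitsValue, h.1, ih h.2]

theorem digitsValue_lt (D off : ℕ) (hA : ∀ i < D, A (off + i) < b) :
    digitsValue b A D off < b ^ D := by
  induction D generalizing off with
  | zero => exact zero_lt_one
  | succ D ih =>
    rw [forall_lt_succ_add (P := fun δ => A δ < b)] at hA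
    calc digitsValue b A D (off + 1) * b + A off
        < (digitsValue b A D (off + 1) + 1) * b := by rw [add_one_mul]; omega
      _ ≤ b ^ D * b := Nat.mul_le_mul_right _ (ih _ hA.2)
      _ = b ^ (D + 1) := (pow_succ _ _).symm

theorem digitsValue_eq {x : ℕ} (h : ∀ i < D, A (off + i) = x / b ^ i % b) (hx : x < b ^ D) :
    digitsValue b A D off = x := by
  induction D generalizing off x with
  | zero => simp at hx; simp [digitsValue, hx]
  | succ D ih =>
    rw [Nat.forall_lt_succ_left] at h
    have hdiv : digitsValue b A D (off + 1) = x / b := by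
      refine ih (fun i hi => ?_) (Nat.div_lt_of_lt_mul (by rwa [← pow_succ']))
      rw [add_assoc, add_comm 1, h.2 i hi, Nat.div_div_eq_div_mul, pow_succ']
    rw [digitsValue, hdiv, ← add_zero off, h.1, pow_zero, Nat.div_one, mul_comm, Nat.div_add_mod]

end DigitsValue

/-- The base-`b` digits of the vertices `f 0, f 1, …`, with `D` digits each: the name of digit `i`
of `f u` is `u * D + i`. -/
def vertexDigits (b D : ℕ) (f : ℕ → ℕ) (δ : ℕ) : ℕ :=
  f (δ / D) / b ^ (δ % D) % b

theorem digitsValue_vertexDigits {b D : ℕ} {f : ℕ → ℕ} {u : ℕ} (hu : f u < b ^ D) :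
    digitsValue b (vertexDigits b D f) D (u * D) = f u := by
  refine digitsValue_eq (fun i hi => ?_) hu
  have hD : 0 < D := (Nat.zero_le _).trans_lt hi
  rw [vertexDigits, mul_comm u D, Nat.mul_add_div hD, Nat.div_eq_of_lt hi, Nat.mul_add_mod,
    Nat.mod_eq_of_lt hi, add_zero]

end CliqueToRectangle

namespace CliqueToRectangle

/-! ### Designs -/

/-- A table chooses one side of the box in each dimension, and the length of the prefix that it
reads of the digit sequence of that side. In the reduction it becomes a set of points, one for each
choice of the digits that it reads. -/
structure Table (d : ℕ) where
  side : Fin d → Bool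
  pre : Fin d → ℕ

section Table

variable {d : ℕ} {seq : Fin d → Bool → ℕ → ℕ} {τ : Table d}

/-- The names of the digits that a table reads if the `j`-th digit on side `s` of dimension `i` has
the name `seq i s j`. -/
def Table.reads (seq : Fin d → Bool → ℕ → ℕ) (τ : Table d) : Finset ℕ :=
  Finset.univ.biUnion fun i => (Finset.range (τ.pre i)).image (seq i (τ.side i))

theorem Table.mem_reads {δ : ℕ} :
    δ ∈ τ.reads seq ↔ ∃ i, ∃ j < τ.pre i, seq i (τ.side i) j = δ := by
  simp [Table.reads]

/-- The digits `A`, assigned to names, are the ones that the table reads if the digits on the sides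
are `x`. -/
def Table.Matches (seq : Fin d → Bool → ℕ → ℕ) (τ : Table d) (x : Fin d → Bool → ℕ → ℕ)
    (A : ℕ → ℕ) : Prop :=
  ∀ i, ∀ j < τ.pre i, A (seq i (τ.side i) j) = x i (τ.side i) j

theorem Table.Matches.eq_of_mem_reads {x : Fin d → Bool → ℕ → ℕ} {A A' : ℕ → ℕ}
    (h : τ.Matches seq x A) (h' : τ.Matches seq x A') {δ : ℕ} (hδ : δ ∈ τ.reads seq) :
    A δ = A' δ := by
  obtain ⟨i, j, hj, rfl⟩ := Table.mem_reads.1 hδ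
  exact (h i j hj).trans (h' i j hj).symm

end Table

/-- An encoding of `k` vertices, given by `D` digits each, in the `2 d` sides of a box: digit `i` of
vertex `v` has the name `v * D + i`, and `seq` lists the digits that a side encodes. A digit may be
encoded more than once. Each table reads at most `U` different digits; the table of a pair reads all
digits of both vertices, and if no table reads different values for one digit, then the tables of
pairs agree on the vertices. -/
structure Design (d k D U : ℕ) where
  seq : Fin d → Bool → ℕ → ℕ
  pairTable : ℕ → ℕ → Table d
  checks : List (Table d)
  card_pair : ∀ u v, u < v → v < k → ((pairTable u v).reads seq).card ≤ U
  card_check : ∀ τ ∈ checks, (τ.reads seq).card ≤ U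
  covers_left : ∀ u v, u < v → v < k → ∀ i < D, u * D + i ∈ (pairTable u v).reads seq
  covers_right : ∀ u v, u < v → v < k → ∀ i < D, v * D + i ∈ (pairTable u v).reads seq
  sound : ∀ (x : Fin d → Bool → ℕ → ℕ) (A : Table d → ℕ → ℕ),
    (∀ τ ∈ checks, τ.Matches seq x (A τ)) →
    (∀ u v, u < v → v < k → (pairTable u v).Matches seq x (A (pairTable u v))) →
    ∃ A₀ : ℕ → ℕ, ∀ u v, u < v → v < k → ∀ i < D,
      A (pairTable u v) (u * D + i) = A₀ (u * D + i) ∧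
      A (pairTable u v) (v * D + i) = A₀ (v * D + i)

/-- A table together with the pair of vertices whose edge weight it contributes, if any. -/
abbrev Item (d : ℕ) := Table d × Option (ℕ × ℕ)

/-- The pairs `u < v < k`. -/
def pairs (k : ℕ) : Finset (ℕ × ℕ) :=
  (Finset.range k ×ˢ Finset.range k).filter fun q => q.1 < q.2

theorem mem_pairs {k : ℕ} {q : ℕ × ℕ} : q ∈ pairs k ↔ q.1 < q.2 ∧ q.2 < k := by
  simp only [pairs, Finset.mem_filter, Finset.mem_product, Finset.mem_range]
  omega

/-- The digits that a table reads, as a list. -/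
noncomputable def Table.digits {d : ℕ} (seq : Fin d → Bool → ℕ → ℕ) (τ : Table d) : List ℕ :=
  (τ.reads seq).toList

section Items

variable {d k D U : ℕ} {Δ : Design d k D U} {x : Item d}

/-- The tables of a design, where the table of a pair of vertices is labelled with the pair. -/
noncomputable def Design.items (Δ : Design d k D U) : List (Item d) :=
  Δ.checks.map (fun τ => (τ, none)) ++
    (pairs k).toList.map (fun q => (Δ.pairTable q.1 q.2, some q))

theorem Design.mem_items :
    x ∈ Δ.items ↔ (x.1 ∈ Δ.checks ∧ x.2 = none) ∨
      ∃ u v, u < v ∧ v < k ∧ x = (Δ.pairTable u v, some (u, v)) := by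
  obtain ⟨τ, o⟩ := x
  simp only [Design.items, List.mem_append, List.mem_map, Finset.mem_toList, mem_pairs,
    Prod.exists, Prod.mk.injEq]
  constructor
  · rintro (⟨τ', hτ, rfl, rfl⟩ | ⟨u, v, ⟨huv, hv⟩, rfl, rfl⟩)
    · exact .inl ⟨hτ, rfl⟩
    · exact .inr ⟨u, v, huv, hv, rfl, rfl⟩
  · rintro (⟨hτ, rfl⟩ | ⟨u, v, huv, hv, rfl, rfl⟩)
    · exact .inl ⟨τ, hτ, rfl, rfl⟩
    · exact .inr ⟨u, v, ⟨huv, hv⟩, rfl, rfl⟩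

theorem Design.check_mem_items {τ : Table d} (hτ : τ ∈ Δ.checks) : (τ, none) ∈ Δ.items :=
  Design.mem_items.2 (.inl ⟨hτ, rfl⟩)

theorem Design.pair_mem_items {u v : ℕ} (huv : u < v) (hv : v < k) :
    (Δ.pairTable u v, some (u, v)) ∈ Δ.items :=
  Design.mem_items.2 (.inr ⟨u, v, huv, hv, rfl⟩)

theorem Design.card_reads_le (hx : x ∈ Δ.items) : (x.1.reads Δ.seq).card ≤ U := by
  obtain ⟨h, -⟩ | ⟨u, v, huv, hv, rfl⟩ := Design.mem_items.1 hx
  · exact Δ.card_check _ h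
  · exact Δ.card_pair u v huv hv

theorem Design.length_digits_le (hx : x ∈ Δ.items) : (x.1.digits Δ.seq).length ≤ U :=
  (Finset.length_toList _).trans_le (Design.card_reads_le hx)

theorem Design.sum_items {Q : ℝ} {g : ℕ × ℕ → ℝ} {F : Item d → ℝ}
    (h_check : ∀ τ ∈ Δ.checks, F (τ, none) = Q)
    (h_pair : ∀ q ∈ pairs k, F (Δ.pairTable q.1 q.2, some q) = Q + g q) :
    (Δ.items.map F).sum = Δ.items.length * Q + ∑ q ∈ pairs k, g q := by
  have hc : Δ.checks.map (fun τ => F (τ, none)) = Δ.checks.map fun _ => Q :=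
    List.map_congr_left h_check
  have hp : ∑ q ∈ pairs k, F (Δ.pairTable q.1 q.2, some q) = ∑ q ∈ pairs k, (Q + g q) :=
    Finset.sum_congr rfl h_pair
  simp only [Design.items, List.map_append, List.sum_append, List.map_map, Function.comp_def,
    List.length_append, List.length_map, Finset.length_toList, Finset.sum_map_toList, hc, hp,
    List.map_const', List.sum_replicate, Finset.sum_add_distrib, Finset.sum_const, nsmul_eq_mul]
  push_cast
  ring

end Items

/-! ### The value of a box position -/

/-- The weight that an item contributes if it reads the digits `A`; it is `none` if `A` does not
describe a pair of vertices in increasing order. -/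
noncomputable def itemValue (D b n : ℕ) (w : ℕ → ℕ → ℝ) (Q : ℝ) (A : ℕ → ℕ) :
    Option (ℕ × ℕ) → Option ℝ
  | none => some Q
  | some (u, v) =>
    if digitsValue b A D (u * D) < digitsValue b A D (v * D) then
      if digitsValue b A D (v * D) < n then
        some (Q + w (digitsValue b A D (u * D)) (digitsValue b A D (v * D)))
      else none
    else none

section ItemValue

variable {D b n u v : ℕ} {w : ℕ → ℕ → ℝ} {Q S : ℝ} {A A' : ℕ → ℕ}

theorem itemValue_congr (hu : ∀ i < D, A (u * D + i) = A' (u * D + i))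
    (hv : ∀ i < D, A (v * D + i) = A' (v * D + i)) :
    itemValue D b n w Q A (some (u, v)) = itemValue D b n w Q A' (some (u, v)) := by
  simp only [itemValue, digitsValue_congr hu, digitsValue_congr hv]

theorem abs_itemValue_le {o : Option (ℕ × ℕ)} {y : ℝ} (hS : 0 ≤ S)
    (hw : ∀ x y, x < n → y < n → |w x y| ≤ S) (hQ : 0 ≤ Q)
    (h : itemValue D b n w Q A o = some y) : |y| ≤ Q + S := by
  match o with
  | none =>
    obtain rfl : Q = y := Option.some.inj h
    rw [abs_of_nonneg hQ]
    exact le_add_of_nonneg_right hS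
  | some (u, v) =>
    simp only [itemValue] at h
    split_ifs at h with huv hv
    rw [← Option.some.inj h]
    exact (abs_add_le _ _).trans (add_le_add (abs_of_nonneg hQ).le (hw _ _ (huv.trans hv) hv))

end ItemValue

/-- The sides of the box at position `X` start with the digits `A` as far as the table reads
them. -/
def InCell {d : ℕ} (b : ℕ) (seq : Fin d → Bool → ℕ → ℕ) (τ : Table d) (A : ℕ → ℕ)
    (X : Fin d → Bool → ℝ) : Prop :=
  ∀ i, StartsWith b (X i (τ.side i)) (fun j => A (seq i (τ.side i) j)) (τ.pre i)

open Classical in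
/-- The contribution of an item at the box position `X`: the sum runs over the codes `c` of all
digit assignments, at most one of which has `X` in its cell. -/
noncomputable def itemTotal {d : ℕ} (seq : Fin d → Bool → ℕ → ℕ) (D b n : ℕ) (w : ℕ → ℕ → ℝ)
    (Q : ℝ) (X : Fin d → Bool → ℝ) (x : Item d) : ℝ :=
  ((List.range (b ^ (x.1.digits seq).length)).map fun c =>
    if InCell b seq x.1 (assignDigits b (x.1.digits seq) c) X then
      (itemValue D b n w Q (assignDigits b (x.1.digits seq) c) x.2).getD 0 else 0).sum

section ItemTotal

variable {d k D U b n c : ℕ} {seq : Fin d → Bool → ℕ → ℕ} {w : ℕ → ℕ → ℝ} {Q S : ℝ}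
  {X : Fin d → Bool → ℝ} {τ : Table d} {x : Item d} {o : Option (ℕ × ℕ)} {A : ℕ → ℕ}

theorem InCell.matches (hb : 0 < b) (hA : ∀ δ, A δ < b) (h : InCell b seq τ A X) :
    τ.Matches seq (fun i s => fracDigit b (X i s)) A :=
  fun i => ((startsWith_iff hb fun _ _ => hA _).1 (h i)).2.2

theorem InCell.congr {A' : ℕ → ℕ} (hb : 0 < b) (hA : ∀ δ, A δ < b) (hA' : ∀ δ, A' δ < b)
    (hAA' : ∀ δ ∈ τ.reads seq, A δ = A' δ) (h : InCell b seq τ A X) : InCell b seq τ A' X := by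
  intro i
  have hi := h i
  rw [startsWith_iff hb fun _ _ => hA _] at hi
  rw [startsWith_iff hb fun _ _ => hA' _]
  refine ⟨hi.1, hi.2.1, fun j hj => ?_⟩
  rw [← hAA' _ (Table.mem_reads.2 ⟨i, j, hj, rfl⟩), hi.2.2 j hj]

theorem itemTotal_of_inCell_code (hb : 0 < b) (hc : c < b ^ (x.1.digits seq).length)
    (h : InCell b seq x.1 (assignDigits b (x.1.digits seq) c) X) :
    itemTotal seq D b n w Q X x =
      (itemValue D b n w Q (assignDigits b (x.1.digits seq) c) x.2).getD 0 := by
  classical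
  unfold itemTotal
  rw [← List.sum_toFinset _ List.nodup_range, Finset.sum_eq_single c]
  · rw [if_pos h]
  · refine fun c' hc' hne => if_neg fun h' => hne ?_
    rw [List.mem_toFinset, List.mem_range] at hc'
    exact assignDigits_injOn (Finset.nodup_toList _) hc' hc fun δ hδ =>
      (h'.matches hb (assignDigits_lt hb _ _)).eq_of_mem_reads
        (h.matches hb (assignDigits_lt hb _ _)) (Finset.mem_toList.1 hδ)
  · exact fun hc' => absurd (by simpa using hc) hc'

theorem exists_itemTotal_eq_of_inCell (hb : 0 < b) (hA : ∀ δ, A δ < b) (h : InCell b seq x.1 A X) :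
    ∃ A' : ℕ → ℕ, (∀ δ ∈ x.1.reads seq, A' δ = A δ) ∧
      itemTotal seq D b n w Q X x = (itemValue D b n w Q A' x.2).getD 0 := by
  obtain ⟨c, hc, hcA⟩ := exists_assignDigits_eq (l := x.1.digits seq) (Finset.nodup_toList _) hA
  have hcA' : ∀ δ ∈ x.1.reads seq, assignDigits b (x.1.digits seq) c δ = A δ :=
    fun δ hδ => hcA δ (Finset.mem_toList.2 hδ)
  exact ⟨_, hcA', itemTotal_of_inCell_code hb hc
    (h.congr hb hA (assignDigits_lt hb _ _) fun δ hδ => (hcA' δ hδ).symm)⟩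

theorem itemTotal_eq_zero_or (hb : 0 < b) (X : Fin d → Bool → ℝ) (τ : Table d) :
    (∀ o, itemTotal seq D b n w Q X (τ, o) = 0) ∨
      ∃ A : ℕ → ℕ, τ.Matches seq (fun i s => fracDigit b (X i s)) A ∧
        ∀ o, itemTotal seq D b n w Q X (τ, o) = (itemValue D b n w Q A o).getD 0 := by
  by_cases h : ∃ c < b ^ (τ.digits seq).length, InCell b seq τ (assignDigits b (τ.digits seq) c) X
  · obtain ⟨c, hc, h⟩ := h
    exact .inr ⟨_, h.matches hb (assignDigits_lt hb _ _),
      fun o => itemTotal_of_inCell_code (x := (τ, o)) hb hc h⟩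
  · refine .inl fun o => List.sum_eq_zero fun y hy => ?_
    simp only [List.mem_map, List.mem_range] at hy
    obtain ⟨c, hc, rfl⟩ := hy
    exact if_neg fun hcell => h ⟨c, hc, hcell⟩

theorem itemTotal_le (hb : 0 < b) (hS : 0 ≤ S) (hw : ∀ x y, x < n → y < n → |w x y| ≤ S)
    (hQ : 0 ≤ Q) : itemTotal seq D b n w Q X x ≤ Q + S := by
  obtain ⟨τ, o⟩ := x
  obtain h | ⟨A, -, h⟩ :=
      itemTotal_eq_zero_or (D := D) (n := n) (seq := seq) (w := w) (Q := Q) hb X τ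
  · rw [h]
    exact add_nonneg hQ hS
  · rw [h]
    cases hy : itemValue D b n w Q A o with
    | none => exact add_nonneg hQ hS
    | some y => exact (le_abs_self y).trans (abs_itemValue_le hS hw hQ hy)

end ItemTotal

theorem sum_map_le_of_exists_eq_zero {α : Type*} {F : α → ℝ} {c : ℝ} {l : List α}
    (hF : ∀ x ∈ l, F x ≤ c) (h : ∃ x ∈ l, F x = 0) : (l.map F).sum ≤ (l.length - 1) * c := by
  classical
  obtain ⟨x, hx, hx0⟩ := h
  have hrest : ((l.erase x).map F).sum ≤ ((l.erase x).map F).length • c :=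
    List.sum_le_card_nsmul _ _ (by
      simpa only [List.forall_mem_map] using fun y hy => hF y (List.mem_of_mem_erase hy))
  rw [List.length_map, List.length_erase_of_mem hx, nsmul_eq_mul,
    Nat.cast_sub (List.length_pos_of_mem hx), Nat.cast_one] at hrest
  rwa [((List.perm_cons_erase hx).map F).sum_eq, List.map_cons, List.sum_cons, hx0, zero_add]

section Total

variable {d k D U b n : ℕ} {w : ℕ → ℕ → ℝ} {Q S : ℝ} {X : Fin d → Bool → ℝ}

/-- The contribution of all items of a design at the box position `X`. -/
noncomputable def Design.total (Δ : Design d k D U) (b n : ℕ) (w : ℕ → ℕ → ℝ) (Q : ℝ)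
    (X : Fin d → Bool → ℝ) : ℝ :=
  (Δ.items.map (itemTotal Δ.seq D b n w Q X)).sum

theorem Design.total_le_of_exists_eq_zero (Δ : Design d k D U) (hb : 0 < b) (hS : 0 ≤ S)
    (hw : ∀ x y, x < n → y < n → |w x y| ≤ S) (hQ : 0 ≤ Q)
    (h : ∃ x ∈ Δ.items, itemTotal Δ.seq D b n w Q X x = 0) :
    Δ.total b n w Q X ≤ (Δ.items.length - 1) * (Q + S) :=
  sum_map_le_of_exists_eq_zero (fun _ _ => itemTotal_le hb hS hw hQ) h

/-- If every table contributes, then all tables read the same vertices. -/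
theorem Design.exists_itemTotal_eq (Δ : Design d k D U) (hb : 0 < b)
    (h : ∀ x ∈ Δ.items, itemTotal Δ.seq D b n w Q X x ≠ 0) :
    ∃ A : ℕ → ℕ, ∀ x ∈ Δ.items,
      itemTotal Δ.seq D b n w Q X x = (itemValue D b n w Q A x.2).getD 0 := by
  have hread : ∀ τ : Table d, ∃ A : ℕ → ℕ, (∃ o, itemTotal Δ.seq D b n w Q X (τ, o) ≠ 0) →
      τ.Matches Δ.seq (fun i s => fracDigit b (X i s)) A ∧
      ∀ o, itemTotal Δ.seq D b n w Q X (τ, o) = (itemValue D b n w Q A o).getD 0 := by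
    intro τ
    obtain h0 | ⟨A, hA⟩ := itemTotal_eq_zero_or (D := D) (seq := Δ.seq) (n := n) (w := w) (Q := Q)
      hb X τ
    · exact ⟨0, fun ⟨o, ho⟩ => absurd (h0 o) ho⟩
    · exact ⟨A, fun _ => hA⟩
  choose A hA using hread
  have hcheck := fun τ hτ => hA τ ⟨_, h _ (Design.check_mem_items hτ)⟩
  have hpair := fun u v huv hv => hA _ ⟨_, h _ (Design.pair_mem_items (u := u) (v := v) huv hv)⟩
  obtain ⟨A₀, hA₀⟩ := Δ.sound _ A (fun τ hτ => (hcheck τ hτ).1)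
    fun u v huv hv => (hpair u v huv hv).1
  refine ⟨A₀, ?_⟩
  rintro ⟨τ, o⟩ hx
  obtain ⟨hτ, rfl : o = none⟩ | ⟨u, v, huv, hv, hx⟩ := Design.mem_items.1 hx
  · exact (hcheck τ hτ).2 none
  · obtain ⟨rfl, rfl⟩ := Prod.ext_iff.1 hx
    rw [(hpair u v huv hv).2, itemValue_congr
      (fun i hi => (hA₀ u v huv hv i hi).1) (fun i hi => (hA₀ u v huv hv i hi).2)]

theorem Design.total_le_or_exists_vertices (Δ : Design d k D U) (hb : 0 < b) (hS : 0 ≤ S)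
    (hw : ∀ x y, x < n → y < n → |w x y| ≤ S) (hQ : 0 ≤ Q) (X : Fin d → Bool → ℝ) :
    Δ.total b n w Q X ≤ (Δ.items.length - 1) * (Q + S) ∨
      ∃ f : ℕ → ℕ, (∀ u v, u < v → v < k → f u < f v ∧ f v < n) ∧
        Δ.total b n w Q X = Δ.items.length * Q + ∑ q ∈ pairs k, w (f q.1) (f q.2) := by
  by_cases h : ∃ x ∈ Δ.items, itemTotal Δ.seq D b n w Q X x = 0
  · exact .inl (Δ.total_le_of_exists_eq_zero hb hS hw hQ h)
  push Not at h
  obtain ⟨A, hA⟩ := Δ.exists_itemTotal_eq hb h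
  have hf : ∀ u v, u < v → v < k → digitsValue b A D (u * D) < digitsValue b A D (v * D) ∧
      digitsValue b A D (v * D) < n := by
    intro u v huv hv
    have hne := h _ (Design.pair_mem_items huv hv)
    rw [hA _ (Design.pair_mem_items huv hv)] at hne
    simp only [itemValue] at hne
    split_ifs at hne with h_lt h_n
    · exact ⟨h_lt, h_n⟩
    all_goals exact absurd rfl hne
  refine .inr ⟨fun u => digitsValue b A D (u * D), hf, Design.sum_items ?_ ?_⟩
  · exact fun τ hτ => hA _ (Design.check_mem_items hτ)
  · intro q hq
    obtain ⟨huv, hv⟩ := mem_pairs.1 hq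
    rw [hA _ (Design.pair_mem_items huv hv)]
    simp only [itemValue, if_pos (hf _ _ huv hv).1, if_pos (hf _ _ huv hv).2, Option.getD_some]

theorem Design.exists_forall_pre_le (Δ : Design d k D U) :
    ∃ P, ∀ x ∈ Δ.items, ∀ i, x.1.pre i ≤ P := by
  refine ⟨(Δ.items.map fun x => ∑ i, x.1.pre i).sum, fun x hx i => ?_⟩
  calc x.1.pre i ≤ ∑ i, x.1.pre i :=
        Finset.single_le_sum (f := x.1.pre) (fun _ _ => Nat.zero_le _) (Finset.mem_univ i)
    _ ≤ _ := List.single_le_sum (fun _ _ => Nat.zero_le _) _ (List.mem_map.2 ⟨x, hx, rfl⟩)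

theorem Design.exists_total_eq (Δ : Design d k D U) (hb : 0 < b) (hn : n ≤ b ^ D)
    (w : ℕ → ℕ → ℝ) (Q : ℝ) {f : ℕ → ℕ} (hf : ∀ u v, u < v → v < k → f u < f v ∧ f v < n) :
    ∃ X : Fin d → Bool → ℝ, (∀ i s, 0 ≤ X i s) ∧
      Δ.total b n w Q X = Δ.items.length * Q + ∑ q ∈ pairs k, w (f q.1) (f q.2) := by
  have hA : ∀ δ, vertexDigits b D f δ < b := fun δ => Nat.mod_lt _ hb
  obtain ⟨P, hP⟩ := Δ.exists_forall_pre_le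
  let X : Fin d → Bool → ℝ := fun i s => fraction b (fun j => vertexDigits b D f (Δ.seq i s j)) P 0
  have hvalue : ∀ x ∈ Δ.items, ∃ A : ℕ → ℕ,
      (∀ δ ∈ x.1.reads Δ.seq, A δ = vertexDigits b D f δ) ∧
      itemTotal Δ.seq D b n w Q X x = (itemValue D b n w Q A x.2).getD 0 := fun x hx =>
    exists_itemTotal_eq_of_inCell hb hA fun i => startsWith_fraction hb (fun _ => hA _) (hP x hx i)
  refine ⟨X, fun i s => fraction_nonneg _ _ _ le_rfl, Design.sum_items ?_ ?_⟩
  · intro τ hτ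
    obtain ⟨A, -, h⟩ := hvalue _ (Design.check_mem_items hτ)
    exact h
  · rintro ⟨u, v⟩ hq
    obtain ⟨huv, hv⟩ := mem_pairs.1 hq
    obtain ⟨A, hA, h⟩ := hvalue _ (Design.pair_mem_items huv hv)
    obtain ⟨hfuv, hfv⟩ := hf u v huv hv
    rw [h, itemValue_congr (A' := vertexDigits b D f)
      (fun i hi => hA _ (Δ.covers_left u v huv hv i hi))
      (fun i hi => hA _ (Δ.covers_right u v huv hv i hi))]
    simp only [itemValue, digitsValue_vertexDigits ((hfuv.trans hfv).trans_le hn),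
      digitsValue_vertexDigits (hfv.trans_le hn), if_pos hfuv, if_pos hfv, Option.getD_some]

end Total

end CliqueToRectangle

namespace CliqueToRectangle

/-! ### Weighted points that realize a design -/

/-- A point together with its weight. -/
abbrev Point (d : ℕ) := (Fin d → ℝ) × ℝ

/-- The corner `E` of the cell in which the sides of the box start with the digits that the table
reads from `A`. A lower side at `-(x + 1)` and an upper side at `x + 1` both encode `x`, so that the
origin lies in every box that encodes something. -/
noncomputable def cornerCoord {d : ℕ} (seq : Fin d → Bool → ℕ → ℕ) (b : ℕ) (τ : Table d)
    (A : ℕ → ℕ) (E : Fin d → Bool) (i : Fin d) : ℝ :=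
  if τ.side i then
    fraction b (fun j => A (seq i (τ.side i) j)) (τ.pre i) (if E i then 1 else 0) + 1
  else -(fraction b (fun j => A (seq i (τ.side i) j)) (τ.pre i) (if E i then 1 else 0) + 1)

/-- The weight of the corner `E` of a cell: with these signs the corners inside a box have total
weight `y` if the box position is in the cell, and `0` otherwise. -/
noncomputable def cornerWeight {d : ℕ} (y : ℝ) (E : Fin d → Bool) : ℝ :=
  (-1) ^ (Finset.univ.filter fun i => E i).card * y

/-- The weighted corners of a cell. -/
noncomputable def corners {d : ℕ} (seq : Fin d → Bool → ℕ → ℕ) (b : ℕ) (τ : Table d) (A : ℕ → ℕ)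
    (y : ℝ) : List (Point d) :=
  (Finset.univ : Finset (Fin d → Bool)).toList.map fun E =>
    (cornerCoord seq b τ A E, cornerWeight y E)

/-- The points of an item in the cell of the digits `A`. -/
noncomputable def cellPoints {d : ℕ} (seq : Fin d → Bool → ℕ → ℕ) (D b n : ℕ) (w : ℕ → ℕ → ℝ)
    (Q : ℝ) (x : Item d) (A : ℕ → ℕ) : List (Point d) :=
  match itemValue D b n w Q A x.2 with
  | none => []
  | some y => corners seq b x.1 A y

/-- The points of an item. -/
noncomputable def itemPoints {d : ℕ} (seq : Fin d → Bool → ℕ → ℕ) (D b n : ℕ) (w : ℕ → ℕ → ℝ)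
    (Q : ℝ) (x : Item d) : List (Point d) :=
  (List.range (b ^ (x.1.digits seq).length)).flatMap fun c =>
    cellPoints seq D b n w Q x (assignDigits b (x.1.digits seq) c)

/-- The points of all items of a design. -/
noncomputable def Design.points {d k D U : ℕ} (Δ : Design d k D U) (b n : ℕ) (w : ℕ → ℕ → ℝ)
    (Q : ℝ) : List (Point d) :=
  Δ.items.flatMap (itemPoints Δ.seq D b n w Q)

open Classical in
/-- The total weight of the points of a list in the box with corners `lo` and `hi`. -/
noncomputable def boxSum {d : ℕ} (lo hi : Fin d → ℝ) (l : List (Point d)) : ℝ :=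
  (l.map fun p => if p.1 ∈ Set.Icc lo hi then p.2 else 0).sum

section BoxSum

variable {d : ℕ} (lo hi : Fin d → ℝ)

theorem boxSum_append (l l' : List (Point d)) :
    boxSum lo hi (l ++ l') = boxSum lo hi l + boxSum lo hi l' := by
  simp only [boxSum, List.map_append, List.sum_append]

theorem boxSum_flatMap {α : Type*} (l : List α) (f : α → List (Point d)) :
    boxSum lo hi (l.flatMap f) = (l.map fun a => boxSum lo hi (f a)).sum := by
  induction l with
  | nil => rfl
  | cons a l ih => rw [List.flatMap_cons, boxSum_append, ih, List.map_cons, List.sum_cons]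

theorem abs_boxSum_le {l : List (Point d)} {R : ℝ} (hR : 0 ≤ R) (h : ∀ p ∈ l, |p.2| ≤ R) :
    |boxSum lo hi l| ≤ l.length * R := by
  classical
  induction l with
  | nil => simp [boxSum]
  | cons p l ih =>
    have hp : |if p.1 ∈ Set.Icc lo hi then p.2 else 0| ≤ R := by
      split_ifs
      exacts [h p List.mem_cons_self, by rwa [abs_zero]]
    calc |boxSum lo hi (p :: l)|
        ≤ |if p.1 ∈ Set.Icc lo hi then p.2 else 0| + |boxSum lo hi l| := abs_add_le _ _
      _ ≤ R + l.length * R := add_le_add hp (ih fun q hq => h q (List.mem_cons_of_mem p hq))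
      _ = (p :: l).length * R := by rw [List.length_cons]; push_cast; ring

end BoxSum

/-- The real numbers that the sides of the box with corners `lo` and `hi` encode. -/
def boxPosition {d : ℕ} (lo hi : Fin d → ℝ) (i : Fin d) (s : Bool) : ℝ :=
  if s then hi i - 1 else -lo i - 1

theorem cornerCoord_mem_Icc_iff {d b : ℕ} {seq : Fin d → Bool → ℕ → ℕ} {τ : Table d} {A : ℕ → ℕ}
    {E : Fin d → Bool} {lo hi : Fin d → ℝ} (hlo : lo ≤ 0) (hhi : 0 ≤ hi) :
    cornerCoord seq b τ A E ∈ Set.Icc lo hi ↔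
      ∀ i, fraction b (fun j => A (seq i (τ.side i) j)) (τ.pre i) (if E i then 1 else 0) ≤
        boxPosition lo hi i (τ.side i) := by
  rw [Set.mem_Icc, Pi.le_def, Pi.le_def, ← forall_and]
  refine forall_congr' fun i => ?_
  have hfrac := fraction_nonneg b (fun j => A (seq i (τ.side i) j)) (τ.pre i)
    (show (0 : ℝ) ≤ if E i then 1 else 0 by split_ifs <;> simp)
  have hlo_i : lo i ≤ 0 := hlo i
  have hhi_i : 0 ≤ hi i := hhi i
  simp only [cornerCoord, boxPosition]
  cases hs : τ.side i <;> simp only [hs, if_true, if_false, Bool.false_eq_true] at hfrac ⊢ <;>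
    exact ⟨fun h => by linarith [h.1, h.2], fun h => ⟨by linarith, by linarith⟩⟩

/-- Inclusion–exclusion for a product of half-open intervals, as an alternating sum over quadrants
with apex in a corner. -/
theorem sum_neg_one_pow_mul_ite_forall_le {ι : Type*} [Fintype ι] [DecidableEq ι]
    {P : ι → Bool → ℝ} {X : ι → ℝ} [∀ E : ι → Bool, Decidable (∀ i, P i (E i) ≤ X i)]
    [Decidable (∀ i, P i false ≤ X i ∧ X i < P i true)] (hP : ∀ i, P i false ≤ P i true) :
    ∑ E : ι → Bool, (-1 : ℝ) ^ (Finset.univ.filter fun i => E i).card *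
        (if ∀ i, P i (E i) ≤ X i then 1 else 0) =
      if ∀ i, P i false ≤ X i ∧ X i < P i true then 1 else 0 := by
  classical
  have hone : ∀ i, ∑ e : Bool, (if e then (-1 : ℝ) else 1) * (if P i e ≤ X i then 1 else 0) =
      if P i false ≤ X i ∧ X i < P i true then 1 else 0 := by
    intro i
    rw [Fintype.sum_bool]
    by_cases hlow : P i false ≤ X i <;> by_cases hup : P i true ≤ X i
    · simp [hlow, hup]
    · simp [hlow, hup, not_le.1 hup]
    · exact absurd ((hP i).trans hup) hlow
    · simp [hlow, hup]
  calc _ = ∑ E : ι → Bool, ∏ i, (if E i then (-1 : ℝ) else 1) *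
        (if P i (E i) ≤ X i then 1 else 0) := by
        refine Finset.sum_congr rfl fun E _ => ?_
        rw [Finset.prod_mul_distrib, Finset.prod_ite, Finset.prod_const, Finset.prod_const_one,
          mul_one, Finset.prod_ite_zero, Finset.prod_const_one]
        simp only [Finset.mem_univ, true_imp_iff]
    _ = ∏ i, ∑ e : Bool, (if e then (-1 : ℝ) else 1) * (if P i e ≤ X i then 1 else 0) := by
        rw [Finset.prod_univ_sum, Fintype.piFinset_univ]
    _ = _ := by
        simp only [hone, Finset.prod_ite_zero, Finset.mem_univ, true_imp_iff,
          Finset.prod_const_one]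

open Classical in
theorem boxSum_corners {d b : ℕ} (hb : 0 < b) (seq : Fin d → Bool → ℕ → ℕ) (τ : Table d)
    (A : ℕ → ℕ) (y : ℝ) {lo hi : Fin d → ℝ} (hlo : lo ≤ 0) (hhi : 0 ≤ hi) :
    boxSum lo hi (corners seq b τ A y) =
      if InCell b seq τ A (boxPosition lo hi) then y else 0 := by
  have hcells := sum_neg_one_pow_mul_ite_forall_le
    (P := fun i e => fraction b (fun j => A (seq i (τ.side i) j)) (τ.pre i) (if e then 1 else 0))
    (X := fun i => boxPosition lo hi i (τ.side i)) fun i =>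
      by simpa using (fraction_zero_lt_one hb _ _).le
  calc boxSum lo hi (corners seq b τ A y)
      = ∑ E : Fin d → Bool, (-1 : ℝ) ^ (Finset.univ.filter fun i => E i).card *
          (if ∀ i, fraction b (fun j => A (seq i (τ.side i) j)) (τ.pre i) (if E i then 1 else 0) ≤
            boxPosition lo hi i (τ.side i) then 1 else 0) * y := by
        rw [boxSum, corners, List.map_map, Finset.sum_map_toList]
        refine Finset.sum_congr rfl fun E _ => ?_
        simp only [Function.comp_apply, cornerCoord_mem_Icc_iff hlo hhi, cornerWeight, mul_ite,
          mul_one, mul_zero, ite_mul, zero_mul]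
    _ = (if InCell b seq τ A (boxPosition lo hi) then 1 else 0) * y := by
        rw [← Finset.sum_mul, hcells]
        refine congrArg (· * y) (if_congr ?_ rfl rfl)
        simp only [InCell, StartsWith, if_true, Bool.false_eq_true, if_false]
    _ = _ := by rw [ite_mul, one_mul, zero_mul]

section Points

variable {d k D U b n : ℕ} {w : ℕ → ℕ → ℝ} {Q S : ℝ}

theorem boxSum_points (Δ : Design d k D U) (hb : 0 < b) {lo hi : Fin d → ℝ} (hlo : lo ≤ 0)
    (hhi : 0 ≤ hi) :
    boxSum lo hi (Δ.points b n w Q) = Δ.total b n w Q (boxPosition lo hi) := by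
  classical
  rw [Design.points, Design.total, boxSum_flatMap]
  refine congrArg List.sum (List.map_congr_left fun x _ => ?_)
  rw [itemPoints, itemTotal, boxSum_flatMap]
  refine congrArg List.sum (List.map_congr_left fun c _ => ?_)
  rw [cellPoints]
  cases itemValue D b n w Q (assignDigits b (x.1.digits Δ.seq) c) x.2 with
  | none => simp [boxSum]
  | some y => exact boxSum_corners hb _ _ _ _ hlo hhi

theorem length_flatMap_le {α β : Type*} {l : List α} {f : α → List β} {R : ℕ}
    (h : ∀ a ∈ l, (f a).length ≤ R) : (l.flatMap f).length ≤ l.length * R := by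
  rw [List.length_flatMap]
  simpa using List.sum_le_card_nsmul (l.map fun a => (f a).length) R (by simpa using h)

theorem length_cellPoints_le (seq : Fin d → Bool → ℕ → ℕ) (x : Item d) (A : ℕ → ℕ) :
    (cellPoints seq D b n w Q x A).length ≤ 2 ^ d := by
  unfold cellPoints
  split
  · exact Nat.zero_le _
  · simp [corners]

theorem length_points_le (Δ : Design d k D U) (hb : 0 < b) :
    (Δ.points b n w Q).length ≤ Δ.items.length * 2 ^ d * b ^ U := by
  rw [mul_assoc]
  refine length_flatMap_le fun x hx => ?_
  calc (itemPoints Δ.seq D b n w Q x).length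
      ≤ (List.range (b ^ (x.1.digits Δ.seq).length)).length * 2 ^ d :=
        length_flatMap_le fun c _ => length_cellPoints_le _ x _
    _ = 2 ^ d * b ^ (x.1.digits Δ.seq).length := by rw [List.length_range, mul_comm]
    _ ≤ 2 ^ d * b ^ U :=
        Nat.mul_le_mul_left _ (Nat.pow_le_pow_right hb (Design.length_digits_le hx))

theorem abs_weight_points_le (Δ : Design d k D U) (hS : 0 ≤ S)
    (hw : ∀ x y, x < n → y < n → |w x y| ≤ S) (hQ : 0 ≤ Q) {p : Point d}
    (hp : p ∈ Δ.points b n w Q) : |p.2| ≤ Q + S := by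
  simp only [Design.points, itemPoints, List.mem_flatMap] at hp
  obtain ⟨x, -, c, -, hp⟩ := hp
  unfold cellPoints at hp
  split at hp
  case h_1 => exact absurd hp List.not_mem_nil
  case h_2 y hy =>
    obtain ⟨E, -, rfl⟩ := List.mem_map.1 hp
    rw [cornerWeight, abs_mul, abs_pow, abs_neg, abs_one, one_pow, one_mul]
    exact abs_itemValue_le hS hw hQ hy

end Points

/-! ### Cliques -/

/-- The weight matrix of a graph as a function on natural numbers, `0` outside the range. -/
noncomputable def weightOf {k : ℕ} (G : WeightedGraph k) (x y : ℕ) : ℝ :=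
  if h : x < G.n ∧ y < G.n then G.wt ⟨x, h.1⟩ ⟨y, h.2⟩ else 0

section Clique

variable {k : ℕ} {G : WeightedGraph k} {f : ℕ → ℕ} {S : ℝ}

theorem cliqueWeight_map (g : Fin k ↪o Fin G.n) (hf : ∀ i : Fin k, f i = g i) :
    G.cliqueWeight (Finset.univ.map g.toEmbedding) =
      ∑ q ∈ pairs k, weightOf G (f q.1) (f q.2) := by
  unfold WeightedGraph.cliqueWeight pairs
  simp only [Finset.sum_filter, Finset.sum_map, RelEmbedding.coe_toEmbedding,
    OrderEmbedding.lt_iff_lt]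
  rw [Finset.sum_product, Finset.sum_range]
  refine Finset.sum_congr rfl fun i _ => ?_
  rw [Finset.sum_range]
  refine Finset.sum_congr rfl fun j _ => ?_
  simp only [Fin.lt_def, hf, weightOf]
  rw [dif_pos ⟨(g i).2, (g j).2⟩]

theorem exists_increasing_of_card_eq {T : Finset (Fin G.n)} (hT : T.card = k) :
    ∃ f : ℕ → ℕ, (∀ u v, u < v → v < k → f u < f v ∧ f v < G.n) ∧
      G.cliqueWeight T = ∑ q ∈ pairs k, weightOf G (f q.1) (f q.2) := by
  let g := T.orderEmbOfFin hT
  have hg : Finset.univ.map g.toEmbedding = T := by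
    rw [← Finset.coe_inj]
    simp [g]
  let f : ℕ → ℕ := fun u => if h : u < k then g ⟨u, h⟩ else 0
  refine ⟨f, fun u v huv hv => ?_, ?_⟩
  · simp only [f, dif_pos hv, dif_pos (huv.trans hv)]
    exact ⟨g.strictMono (show (⟨u, huv.trans hv⟩ : Fin k) < ⟨v, hv⟩ from huv), (g _).2⟩
  · rw [← hg]
    exact cliqueWeight_map g fun i => dif_pos i.2

theorem exists_card_eq_of_increasing (hk : 2 ≤ k)
    (hf : ∀ u v, u < v → v < k → f u < f v ∧ f v < G.n) :
    ∃ T : Finset (Fin G.n), T.card = k ∧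
      G.cliqueWeight T = ∑ q ∈ pairs k, weightOf G (f q.1) (f q.2) := by
  have hlt : ∀ i < k, f i < G.n := by
    intro i hi
    obtain rfl | hi0 := Nat.eq_zero_or_pos i
    · exact (hf 0 1 one_pos hk).1.trans (hf 0 1 one_pos hk).2
    · exact (hf 0 i hi0 hi).2
  let g : Fin k ↪o Fin G.n := OrderEmbedding.ofStrictMono (fun i => ⟨f i, hlt i i.2⟩)
    fun i j hij => (hf i j hij j.2).1
  exact ⟨Finset.univ.map g.toEmbedding, by simp, cliqueWeight_map g fun _ => rfl⟩

theorem abs_cliqueWeight_le (hS : ∀ x y, x < G.n → y < G.n → |weightOf G x y| ≤ S)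
    {T : Finset (Fin G.n)} (hT : T.card = k) : |G.cliqueWeight T| ≤ (pairs k).card * S := by
  obtain ⟨f, hf, hfT⟩ := exists_increasing_of_card_eq hT
  rw [hfT, ← nsmul_eq_mul]
  refine (Finset.abs_sum_le_sum_abs _ _).trans (Finset.sum_le_card_nsmul _ _ _ fun q hq => ?_)
  obtain ⟨h_lt, hk⟩ := mem_pairs.1 hq
  obtain ⟨h_lt, hn⟩ := hf _ _ h_lt hk
  exact hS _ _ (h_lt.trans hn) hn

end Clique

/-! ### From an optimal box to an optimal clique -/

/-- The points of a design, followed by a point at the origin. -/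
noncomputable def Design.pinnedPoints {d k D U : ℕ} (Δ : Design d k D U) (b n : ℕ)
    (w : ℕ → ℕ → ℝ) (Q W : ℝ) : List (Point d) :=
  Δ.points b n w Q ++ [(0, W)]

section Optimal

variable {d k D U b n : ℕ} {w : ℕ → ℕ → ℝ} {Q S W : ℝ} {lo hi : Fin d → ℝ}

theorem boxSum_pinnedPoints (Δ : Design d k D U) (hb : 0 < b) (hlo : lo ≤ 0) (hhi : 0 ≤ hi) :
    boxSum lo hi (Δ.pinnedPoints b n w Q W) = Δ.total b n w Q (boxPosition lo hi) + W := by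
  rw [Design.pinnedPoints, boxSum_append, boxSum_points Δ hb hlo hhi]
  simp [boxSum, hlo, hhi]

theorem origin_mem_of_lt_boxSum (Δ : Design d k D U) (hS : 0 ≤ S)
    (hw : ∀ x y, x < n → y < n → |w x y| ≤ S) (hQ : 0 ≤ Q)
    (h : (Δ.points b n w Q).length * (Q + S) < boxSum lo hi (Δ.pinnedPoints b n w Q W)) :
    (0 : Fin d → ℝ) ∈ Set.Icc lo hi := by
  by_contra h0
  have hW : boxSum lo hi [((0 : Fin d → ℝ), W)] = 0 := by
    rw [boxSum, List.map_singleton, List.sum_singleton, if_neg h0]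
  rw [Design.pinnedPoints, boxSum_append, hW, add_zero] at h
  exact h.not_ge ((le_abs_self _).trans (abs_boxSum_le lo hi (add_nonneg hQ hS)
    fun _ => abs_weight_points_le Δ hS hw hQ))

theorem add_cliqueWeight_le_boxSum (Δ : Design d k D U) {G : WeightedGraph k} (hb : 0 < b)
    (hn : G.n ≤ b ^ D)
    (hmax : ∀ lo' hi' : Fin d → ℝ, lo' ≤ hi' →
      boxSum lo' hi' (Δ.pinnedPoints b G.n (weightOf G) Q W) ≤
        boxSum lo hi (Δ.pinnedPoints b G.n (weightOf G) Q W))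
    {T : Finset (Fin G.n)} (hT : T.card = k) :
    Δ.items.length * Q + G.cliqueWeight T + W ≤
      boxSum lo hi (Δ.pinnedPoints b G.n (weightOf G) Q W) := by
  obtain ⟨f, hf, hfT⟩ := exists_increasing_of_card_eq hT
  obtain ⟨X, hX, hXtotal⟩ := Δ.exists_total_eq hb hn (weightOf G) Q hf
  have hlo : (fun i => -(X i false) - 1) ≤ (0 : Fin d → ℝ) := fun i =>
    show -(X i false) - 1 ≤ 0 by linarith [hX i false]
  have hhi : (0 : Fin d → ℝ) ≤ fun i => X i true + 1 := fun i =>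
    show 0 ≤ X i true + 1 by linarith [hX i true]
  have hpos : boxPosition (fun i => -(X i false) - 1) (fun i => X i true + 1) = X := by
    funext i s
    cases s <;> simp [boxPosition]
  have h := hmax _ _ (hlo.trans hhi)
  rwa [boxSum_pinnedPoints Δ hb hlo hhi, hpos, hXtotal, ← hfT] at h

theorem Design.card_pairs_le_length_items (Δ : Design d k D U) :
    (pairs k).card ≤ Δ.items.length := by
  simp [Design.items]

/-- The weight `W` forces an optimal box to contain the origin, and the bonus `Q` for each table
that contributes forces it to encode a clique. -/
theorem isGreatest_of_optimal_box (Δ : Design d k D U) (hk : 2 ≤ k) (G : WeightedGraph k)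
    (hb : 0 < b) (hn : G.n ≤ b ^ D) (hS : 0 ≤ S)
    (hw : ∀ x y, x < G.n → y < G.n → |weightOf G x y| ≤ S)
    (hQ : Q = 1 + 2 * (Δ.items.length * S))
    (hW : W = ((Δ.points b G.n (weightOf G) Q).length + 1 : ℕ) * (Q + S))
    (hmax : ∀ lo' hi' : Fin d → ℝ, lo' ≤ hi' →
      boxSum lo' hi' (Δ.pinnedPoints b G.n (weightOf G) Q W) ≤
        boxSum lo hi (Δ.pinnedPoints b G.n (weightOf G) Q W)) :
    IsGreatest {x : ℝ | ∃ T : Finset (Fin G.n), T.card = k ∧ G.cliqueWeight T = x}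
      (boxSum lo hi (Δ.pinnedPoints b G.n (weightOf G) Q W) - W - Δ.items.length * Q) := by
  set m : ℝ := (Δ.items.length : ℝ) with hm
  have hmS : 0 ≤ m * S := mul_nonneg (Nat.cast_nonneg _) hS
  have hQ0 : 0 ≤ Q := by linarith
  have hpairs : ((pairs k).card : ℝ) ≤ m := Nat.cast_le.2 Δ.card_pairs_le_length_items
  have hm1 : 1 ≤ m := le_trans (by
    exact_mod_cast Finset.card_pos.2 ⟨(0, 1), mem_pairs.2 ⟨one_pos, hk⟩⟩) hpairs
  have hge := fun T hT => add_cliqueWeight_le_boxSum (T := T) Δ hb hn hmax hT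
  rw [← hm] at hge
  obtain ⟨T₀, -, hT₀⟩ := Finset.exists_subset_card_eq (s := (Finset.univ : Finset (Fin G.n)))
    (n := k) (by simpa using G.le)
  have hT₀_ge : -(m * S) ≤ G.cliqueWeight T₀ :=
    (abs_le.1 ((abs_cliqueWeight_le hw hT₀).trans (by gcongr))).1
  have hlarge : (m - 1) * (Q + S) + W < boxSum lo hi (Δ.pinnedPoints b G.n (weightOf G) Q W) := by
    linarith [hge T₀ hT₀]
  have hmem : (0 : Fin d → ℝ) ∈ Set.Icc lo hi := by
    refine origin_mem_of_lt_boxSum Δ hS hw hQ0 (lt_of_le_of_lt ?_ hlarge)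
    rw [hW]
    push_cast
    linarith [mul_nonneg (sub_nonneg.2 hm1) (add_nonneg hQ0 hS)]
  rw [boxSum_pinnedPoints Δ hb hmem.1 hmem.2] at hge hlarge ⊢
  obtain hsmall | ⟨f, hf, hfX⟩ := Δ.total_le_or_exists_vertices hb hS hw hQ0 (boxPosition lo hi)
  · linarith
  · obtain ⟨T, hT, hTf⟩ := exists_card_eq_of_increasing hk hf
    rw [hfX, ← hTf] at hge ⊢
    refine ⟨⟨T, hT, by ring⟩, ?_⟩
    rintro _ ⟨T', hT', rfl⟩
    linarith [hge T' hT']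

end Optimal

/-- A nonempty list of points as an instance of Max-Weight Rectangle. -/
noncomputable def toInstance {d : ℕ} (l : List (Point d)) (hl : 0 < l.length) :
    WeightedPoints d where
  N := l.length
  pos := hl
  pt p := (l.get p).1
  wt p := (l.get p).2

theorem boxWeight_toInstance {d : ℕ} (l : List (Point d)) (hl : 0 < l.length)
    (lo hi : Fin d → ℝ) : (toInstance l hl).boxWeight lo hi = boxSum lo hi l := by
  classical
  calc (toInstance l hl).boxWeight lo hi
      = ∑ p : Fin l.length, if (l.get p).1 ∈ Set.Icc lo hi then (l.get p).2 else 0 :=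
        Finset.sum_filter _ _
    _ = (List.ofFn ((fun p : Point d => if p.1 ∈ Set.Icc lo hi then p.2 else 0) ∘ l.get)).sum := by
        rw [List.sum_ofFn]
        rfl
    _ = boxSum lo hi l := by rw [← List.map_ofFn, List.ofFn_get, boxSum]

end CliqueToRectangle

namespace RealRAM

/-! ### Running programs with a time bound and a postcondition -/

/-- `p` started in `s` halts after at most `T` steps in a state that satisfies `Q`. -/
def Runs (M : ℕ) (p : Prog) (T : ℕ) (s : State) (Q : State → Prop) : Prop :=
  ∃ t s', Exec M p s t s' ∧ t ≤ T ∧ Q s'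

infixr:60 " ;; " => Prog.seq

instance : Coe Op Prog := ⟨Prog.op⟩

/-- The number of steps that a program without loops takes at most. -/
def Prog.cost : Prog → ℕ
  | .op _ => 1
  | .seq p q => p.cost + q.cost
  | .branch _ p q => p.cost + q.cost + 1
  | .loop _ _ => 0

/-- Run the programs `f x`, where `x` ranges over a list that is fixed in advance. -/
def Prog.forEach {α : Type*} (f : α → Prog) : List α → Prog
  | [] => Op.skip
  | x :: l => f x ;; forEach f l

theorem Prog.cost_forEach {α : Type*} (f : α → Prog) (l : List α) :
    (Prog.forEach f l).cost = (l.map fun x => (f x).cost).sum + 1 := by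
  induction l with
  | nil => rfl
  | cons x l ih => rw [forEach, cost, ih, List.map_cons, List.sum_cons, add_assoc]

/-- The state `s` with word register `x` overwritten by `v`, as by `State.setW` without the check
for overflow. -/
def State.updW (s : State) (x v : ℕ) : State :=
  { s with w := Function.update s.w x v }

/-- The state `s` with entry `i` of real array `a` overwritten by `v`. -/
noncomputable def State.updA (s : State) (a i : ℕ) (v : ℝ) : State :=
  { s with ra := Function.update s.ra a (Function.update (s.ra a) i v) }

section StateUpdate

variable (s : State) (x v : ℕ) (y : ℝ)

@[simp] theorem State.updW_w : (s.updW x v).w = Function.update s.w x v := rfl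

@[simp] theorem State.updW_r : (s.updW x v).r = s.r := rfl

@[simp] theorem State.updW_wa : (s.updW x v).wa = s.wa := rfl

@[simp] theorem State.updW_ra : (s.updW x v).ra = s.ra := rfl

@[simp] theorem State.setR_w : (s.setR x y).w = s.w := rfl

@[simp] theorem State.setR_r : (s.setR x y).r = Function.update s.r x y := rfl

end StateUpdate

section Runs

variable {M T T' : ℕ} {p q : Prog} {s : State} {P Q : State → Prop} {b : Test}

theorem Runs.le (h : Runs M p T s Q) (hT : T ≤ T') : Runs M p T' s Q :=
  let ⟨t, s', he, ht, hQ⟩ := h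
  ⟨t, s', he, ht.trans hT, hQ⟩

theorem Runs.imp (h : Runs M p T s P) (hPQ : ∀ s', P s' → Q s') : Runs M p T s Q :=
  let ⟨t, s', he, ht, hP⟩ := h
  ⟨t, s', he, ht, hPQ s' hP⟩

theorem Runs.seq (h : Runs M p T s fun s' => Runs M q T' s' Q) : Runs M (p ;; q) (T + T') s Q :=
  let ⟨_, _, hp, ht, _, s'', hq, ht', hQ⟩ := h
  ⟨_, s'', .seq hp hq, add_le_add ht ht', hQ⟩

theorem Runs.andThen (hp : Runs M p T s P) (hq : ∀ s', P s' → Runs M q T' s' Q) :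
    Runs M (p ;; q) (T + T') s Q :=
  .seq (hp.imp hq)

theorem Runs.branch (hp : b.Holds s → Runs M p T s Q) (hq : ¬ b.Holds s → Runs M q T' s Q) :
    Runs M (.branch b p q) (T + T' + 1) s Q := by
  by_cases hb : b.Holds s
  · obtain ⟨t, s', he, ht, hQ⟩ := hp hb
    exact ⟨_, s', .branchTrue hb he, by omega, hQ⟩
  · obtain ⟨t, s', he, ht, hQ⟩ := hq hb
    exact ⟨_, s', .branchFalse hb he, by omega, hQ⟩

theorem Runs.loop (I : ℕ → State → Prop) (m : ℕ) (h0 : I 0 s)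
    (h_true : ∀ i < m, ∀ s, I i s → b.Holds s) (h_false : ∀ s, I m s → ¬ b.Holds s)
    (h_step : ∀ i < m, ∀ s, I i s → Runs M p T s (I (i + 1))) :
    Runs M (.loop b p) (m * (T + 1) + 1) s (I m) := by
  suffices h : ∀ j i s, i + j = m → I i s → Runs M (.loop b p) (j * (T + 1) + 1) s (I m) from
    h m 0 s (zero_add m) h0
  intro j
  induction j with
  | zero =>
    rintro i s rfl hI
    exact ⟨1, s, .loopFalse (h_false s hI), by omega, hI⟩
  | succ j ih =>
    intro i s hij hI
    obtain ⟨t, s', he, ht, hI'⟩ := h_step i (by omega) s hI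
    obtain ⟨t', s'', he', ht', hI''⟩ := ih (i + 1) s' (by omega) hI'
    refine ⟨_, s'', .loopTrue (h_true i (by omega) s hI) he he', ?_, hI''⟩
    rw [add_mul]
    omega

theorem Runs.op {o : Op} {s' : State} (h : o.run M s = some s') (hQ : Q s') : Runs M o 1 s Q :=
  ⟨1, s', .op h, le_rfl, hQ⟩

theorem Runs.skip (h : Q s) : Runs M Op.skip 1 s Q :=
  .op rfl h

theorem Runs.setW {o : Op} {x v : ℕ} (ho : o.run M s = s.setW M x v) (hv : v < M)
    (h : Q (s.updW x v)) : Runs M o 1 s Q :=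
  .op (ho.trans (if_pos hv)) h

theorem Runs.forEach {α : Type*} {f : α → Prog} {T : α → ℕ} (I : List α → State → Prop)
    {l : List α} (h0 : I [] s)
    (h_step : ∀ l₁ x l₂, l = l₁ ++ x :: l₂ → ∀ s, I l₁ s → Runs M (f x) (T x) s (I (l₁ ++ [x]))) :
    Runs M (Prog.forEach f l) ((l.map T).sum + 1) s (I l) := by
  induction l generalizing I s with
  | nil => exact .skip h0
  | cons x l ih =>
    rw [List.map_cons, List.sum_cons, add_assoc]
    exact (h_step [] x l rfl s h0).andThen fun s' hs' => ih (fun l₁ => I (x :: l₁)) hs'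
      fun l₁ y l₂ hl => h_step (x :: l₁) y l₂ (congrArg _ hl)

variable {x y z a c : ℕ}

theorem Runs.wconst (hv : c < M) (h : Q (s.updW x c)) : Runs M (Op.wconst x c) 1 s Q :=
  .setW rfl hv h

theorem Runs.wmov (hv : s.w y < M) (h : Q (s.updW x (s.w y))) : Runs M (Op.wmov x y) 1 s Q :=
  .setW rfl hv h

theorem Runs.wadd (hv : s.w y + s.w z < M) (h : Q (s.updW x (s.w y + s.w z))) :
    Runs M (Op.wadd x y z) 1 s Q :=
  .setW rfl hv h

theorem Runs.wsub (hv : s.w y - s.w z < M) (h : Q (s.updW x (s.w y - s.w z))) :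
    Runs M (Op.wsub x y z) 1 s Q :=
  .setW rfl hv h

theorem Runs.wmul (hv : s.w y * s.w z < M) (h : Q (s.updW x (s.w y * s.w z))) :
    Runs M (Op.wmul x y z) 1 s Q :=
  .setW rfl hv h

theorem Runs.wdiv (hz : s.w z ≠ 0) (hv : s.w y / s.w z < M) (h : Q (s.updW x (s.w y / s.w z))) :
    Runs M (Op.wdiv x y z) 1 s Q :=
  .setW (if_neg hz) hv h

theorem Runs.rcast (h : Q (s.setR x (s.w y))) : Runs M (Op.rcast x y) 1 s Q :=
  .op rfl h

theorem Runs.rmov (h : Q (s.setR x (s.r y))) : Runs M (Op.rmov x y) 1 s Q :=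
  .op rfl h

theorem Runs.radd (h : Q (s.setR x (s.r y + s.r z))) : Runs M (Op.radd x y z) 1 s Q :=
  .op rfl h

theorem Runs.rsub (h : Q (s.setR x (s.r y - s.r z))) : Runs M (Op.rsub x y z) 1 s Q :=
  .op rfl h

theorem Runs.rmul (h : Q (s.setR x (s.r y * s.r z))) : Runs M (Op.rmul x y z) 1 s Q :=
  .op rfl h

theorem Runs.rdiv (hz : s.r z ≠ 0) (h : Q (s.setR x (s.r y / s.r z))) :
    Runs M (Op.rdiv x y z) 1 s Q :=
  .op (if_neg hz) h

theorem Runs.rload (h : Q (s.setR x (s.ra a (s.w y)))) : Runs M (Op.rload x a y) 1 s Q :=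
  .op rfl h

theorem Runs.rstore (h : Q (s.updA a (s.w y) (s.r x))) : Runs M (Op.rstore a y x) 1 s Q :=
  .op rfl h

end Runs

end RealRAM

namespace CliqueToRectangle

open RealRAM

/-! ### The memory of the reduction

Word registers: `0` holds `n`, `1` holds `b`, `2` and `3` the bound and the counter of the current
loop, `5` the number of points, `9` the constant `1`, `11 + δ` the digit `δ`; the others below `11`
are temporary. Real registers: `0` is for the result, `1` holds `b`, `2` the bonus `Q`, `3` the
weight being processed, `6` the bound `S`, `7` the constant `1`, `8` the weight of the origin, `9`
the constant `0`. Real array `0` is the input, and the arrays `1, …, d + 1` hold the coordinates and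
the weights of the points. The memory from `B` on belongs to the algorithm for rectangles. -/

section Arrays

variable {d B j : ℕ} {inp : ℕ → ℝ} {l : List (Point d)} {q : Point d}

/-- Component `i` of a point: its coordinates, then its weight. -/
noncomputable def component (q : Point d) (i : ℕ) : ℝ :=
  if h : i < d then q.1 ⟨i, h⟩ else if i = d then q.2 else 0

/-- The array of the `i`-th components of a list of points. -/
noncomputable def pointArray (l : List (Point d)) (i p : ℕ) : ℝ :=
  if h : p < l.length then component l[p] i else 0

/-- The real arrays if `P i` is the array of the `i`-th components. It is stored twice: the
algorithm for rectangles may overwrite its copy. -/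
noncomputable def arrays (d B : ℕ) (inp : ℕ → ℝ) (P : ℕ → ℕ → ℝ) (a : ℕ) : ℕ → ℝ :=
  if a = 0 then inp else if a ≤ d + 1 then P (a - 1) else if B ≤ a then P (a - B) else fun _ => 0

/-- The arrays of components once the first `j` components of `q` are stored behind `l`. -/
noncomputable def stored (l : List (Point d)) (q : Point d) (j i : ℕ) : ℕ → ℝ :=
  if i < j then pointArray (l ++ [q]) i else pointArray l i

theorem component_last (q : Point d) : component q d = q.2 := by
  rw [component, dif_neg (lt_irrefl d), if_pos rfl]

theorem pointArray_eq_zero (l : List (Point d)) {i : ℕ} (h : d < i) :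
    pointArray l i = fun _ => 0 := by
  funext p
  unfold pointArray component
  split_ifs <;> first | rfl | omega

theorem pointArray_append (l : List (Point d)) (q : Point d) (i : ℕ) :
    pointArray (l ++ [q]) i = Function.update (pointArray l i) l.length (component q i) := by
  funext p
  simp only [pointArray, Function.update_apply, List.length_append, List.length_singleton]
  rcases lt_trichotomy p l.length with h | rfl | h
  · rw [dif_pos (by omega), if_neg (by omega), dif_pos h, List.getElem_append_left h]
  · simp
  · rw [dif_neg (by omega), if_neg (by omega), dif_neg (by omega)]

theorem arrays_zero (P : ℕ → ℕ → ℝ) : arrays d B inp P 0 = inp :=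
  if_pos rfl

theorem arrays_one_add (P : ℕ → ℕ → ℝ) (hj : j ≤ d) : arrays d B inp P (1 + j) = P j := by
  rw [arrays, if_neg (by omega), if_pos (by omega), Nat.add_sub_cancel_left]

theorem arrays_add (P : ℕ → ℕ → ℝ) (hB : d + 2 ≤ B) : arrays d B inp P (B + j) = P j := by
  rw [arrays, if_neg (by omega), if_neg (by omega), if_pos (by omega), Nat.add_sub_cancel_left]

theorem update_arrays (P : ℕ → ℕ → ℝ) (hj : j ≤ d) (hB : d + 2 ≤ B) (f : ℕ → ℝ) :
    Function.update (Function.update (arrays d B inp P) (1 + j) f) (B + j) f =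
      arrays d B inp (Function.update P j f) := by
  funext a
  simp only [Function.update_apply, arrays]
  split_ifs <;> first | rfl | omega

theorem stored_zero : stored l q 0 = pointArray l :=
  funext fun i => if_neg (Nat.not_lt_zero i)

theorem update_stored :
    Function.update (stored l q j) j
      (Function.update (stored l q j j) l.length (component q j)) = stored l q (j + 1) := by
  funext i
  rw [stored, if_neg (lt_irrefl j), ← pointArray_append, Function.update_apply]
  unfold stored
  split_ifs with hij <;> first | omega | rw [hij] | rfl

theorem stored_all : stored l q (d + 1) = pointArray (l ++ [q]) := by
  funext i
  unfold stored
  split_ifs with h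
  · rfl
  · rw [pointArray_eq_zero _ (by omega), pointArray_eq_zero _ (by omega)]

theorem stored_origin (l : List (Point d)) (W : ℝ) : stored l (0, W) d = pointArray l := by
  funext i
  rw [stored, ite_eq_right_iff]
  intro hi
  have h0 : component ((0 : Fin d → ℝ), W) i = pointArray l i l.length := by
    rw [component, dif_pos hi, pointArray, dif_neg (lt_irrefl _)]
    rfl
  rw [pointArray_append, h0, Function.update_eq_self]

end Arrays

/-- The memory when the points `l` have been written, except for the registers that hold the
parameters of the reduction. -/
structure Memory {d : ℕ} (B n : ℕ) (inp : ℕ → ℝ) (l : List (Point d)) (s : State) : Prop where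
  w0 : s.w 0 = n
  w5 : s.w 5 = l.length
  w9 : s.w 9 = 1
  r7 : s.r 7 = 1
  r9 : s.r 9 = 0
  wa : s.wa = fun _ _ => 0
  ra : s.ra = arrays d B inp (pointArray l)
  hw : ∀ x, s.w (x + B) = 0
  hr : ∀ x, s.r (x + B) = 0

/-- The memory when the points `l` have been written. -/
structure Written {d : ℕ} (B n b : ℕ) (Q S : ℝ) (inp : ℕ → ℝ) (l : List (Point d)) (s : State) :
    Prop extends Memory B n inp l s where
  w1 : s.w 1 = b
  r1 : s.r 1 = b
  r2 : s.r 2 = Q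
  r6 : s.r 6 = S

/-- `s'` has the words of `s` and the real registers of `s` except `4` and `5`. -/
structure Frame (s s' : State) : Prop where
  w : s'.w = s.w
  wa : s'.wa = s.wa
  r : ∀ x, x ≠ 4 → x ≠ 5 → s'.r x = s.r x

section Memory

variable {d B n b x : ℕ} {Q S : ℝ} {inp : ℕ → ℝ} {l : List (Point d)} {s s' : State}

theorem Memory.updW (h : Memory B n inp l s) (v : ℕ) (hx : x < B ∧ x ≠ 0 ∧ x ≠ 5 ∧ x ≠ 9) :
    Memory B n inp l (s.updW x v) where
  w0 := by simp [hx.2.1.symm, h.w0]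
  w5 := by simp [hx.2.2.1.symm, h.w5]
  w9 := by simp [hx.2.2.2.symm, h.w9]
  r7 := h.r7
  r9 := h.r9
  wa := h.wa
  ra := h.ra
  hw y := by rw [State.updW_w, Function.update_of_ne (by omega), h.hw]
  hr := h.hr

theorem Memory.setR (h : Memory B n inp l s) (v : ℝ) (hx : x < B ∧ x ≠ 7 ∧ x ≠ 9) :
    Memory B n inp l (s.setR x v) where
  w0 := h.w0
  w5 := h.w5
  w9 := h.w9
  r7 := by simp [hx.2.1.symm, h.r7]
  r9 := by simp [hx.2.2.symm, h.r9]
  wa := h.wa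
  ra := h.ra
  hw := h.hw
  hr y := by rw [State.setR_r, Function.update_of_ne (by omega), h.hr]

theorem Written.updW (h : Written B n b Q S inp l s) (v : ℕ)
    (hx : x < B ∧ x ≠ 0 ∧ x ≠ 1 ∧ x ≠ 5 ∧ x ≠ 9) : Written B n b Q S inp l (s.updW x v) where
  toMemory := h.toMemory.updW v (by omega)
  w1 := by simp [hx.2.2.1.symm, h.w1]
  r1 := h.r1
  r2 := h.r2
  r6 := h.r6

theorem Written.setR (h : Written B n b Q S inp l s) (v : ℝ)
    (hx : x < B ∧ x ≠ 1 ∧ x ≠ 2 ∧ x ≠ 6 ∧ x ≠ 7 ∧ x ≠ 9) :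
    Written B n b Q S inp l (s.setR x v) where
  toMemory := h.toMemory.setR v (by omega)
  w1 := h.w1
  r1 := by simp [hx.2.1.symm, h.r1]
  r2 := by simp [hx.2.2.1.symm, h.r2]
  r6 := by simp [hx.2.2.2.1.symm, h.r6]

theorem Frame.refl (s : State) : Frame s s :=
  ⟨rfl, rfl, fun _ _ _ => rfl⟩

theorem Frame.trans {s'' : State} (h : Frame s s') (h' : Frame s' s'') : Frame s s'' :=
  ⟨h'.w.trans h.w, h'.wa.trans h.wa, fun x h4 h5 => (h'.r x h4 h5).trans (h.r x h4 h5)⟩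

theorem Frame.setR (h : Frame s s') (v : ℝ) (hx : x = 4 ∨ x = 5) : Frame s (s'.setR x v) where
  w := h.w
  wa := h.wa
  r y h4 h5 := by rw [State.setR_r, Function.update_of_ne (by omega), h.r y h4 h5]

end Memory

/-! ### Writing points -/

/-- Store real register `4` as component `j` of the next point. -/
def storeProg (B j : ℕ) : Prog :=
  Op.rstore (1 + j) 5 4 ;; Op.rstore (B + j) 5 4

/-- Store real register `4` as the weight of the next point, then count that point. -/
def appendProg (d B : ℕ) : Prog :=
  storeProg B d ;; Op.wadd 5 5 9

/-- Put the fraction in base `b` with the digits named `dig 0, …, dig (p - 1)` into real register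
`4`; real register `init` contains the number of units to add in the last place. -/
def fractionProg (init : ℕ) : (ℕ → ℕ) → ℕ → Prog
  | _, 0 => Op.rmov 4 init
  | dig, p + 1 => fractionProg init (fun j => dig (j + 1)) p ;;
      Op.rcast 5 (11 + dig 0) ;; Op.radd 4 5 4 ;; Op.rdiv 4 4 1

/-- Put coordinate `i` of the corner `E` into real register `4`. -/
def coordProg {d : ℕ} (seq : Fin d → Bool → ℕ → ℕ) (τ : Table d) (E : Fin d → Bool) (i : Fin d) :
    Prog :=
  fractionProg (if E i then 7 else 9) (seq i (τ.side i)) (τ.pre i) ;; Op.radd 4 4 7 ;;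
    (if τ.side i then Op.skip else Op.rsub 4 9 4 : Op)

/-- Store the coordinates of the corner `E`. -/
def coordsProg {d : ℕ} (seq : Fin d → Bool → ℕ → ℕ) (B : ℕ) (τ : Table d) (E : Fin d → Bool) :
    Prog :=
  .forEach (fun i => coordProg seq τ E i ;; storeProg B i) (List.finRange d)

/-- Put the weight of the corner `E` into real register `4`; real register `3` contains the weight
of the item. -/
def signProg {d : ℕ} (E : Fin d → Bool) : Op :=
  if Even (Finset.univ.filter fun i => E i).card then .rmov 4 3 else .rsub 4 9 3

/-- Write the corner `E` of a cell; real register `3` contains the weight of the item. -/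
def cornerProg {d : ℕ} (seq : Fin d → Bool → ℕ → ℕ) (B : ℕ) (τ : Table d) (E : Fin d → Bool) :
    Prog :=
  coordsProg seq B τ E ;; signProg E ;; appendProg d B

/-- Write the corners of a cell; real register `3` contains the weight of the item. -/
noncomputable def cornersProg {d : ℕ} (seq : Fin d → Bool → ℕ → ℕ) (B : ℕ) (τ : Table d) : Prog :=
  .forEach (cornerProg seq B τ) (Finset.univ : Finset (Fin d → Bool)).toList

section Corners

variable {d B M n b : ℕ} {Q S : ℝ} {inp : ℕ → ℝ} {l : List (Point d)} {s s₀ : State}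
  {seq : Fin d → Bool → ℕ → ℕ} {τ : Table d} {A : ℕ → ℕ} {E : Fin d → Bool} {q : Point d}

theorem runs_storeProg {j : ℕ} (hj : j ≤ d) (hB : d + 2 ≤ B)
    (hra : s.ra = arrays d B inp (stored l q j)) (h5 : s.w 5 = l.length)
    (h4 : s.r 4 = component q j) :
    Runs M (storeProg B j) (storeProg B j).cost s fun s' =>
      s' = { s with ra := arrays d B inp (stored l q (j + 1)) } := by
  refine .seq (.rstore (.rstore ?_))
  simp only [State.updA, hra, h5, h4, arrays_one_add _ hj, Function.update_of_ne
    (show B + j ≠ 1 + j by omega), arrays_add _ hB, update_arrays _ hj hB, update_stored]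

/-- The program `appendProg` started in `s`, when since the state `s₀` the coordinates of `q` have
been stored and its weight has been computed. -/
theorem runs_appendProg (hB : d + 11 ≤ B) (hs₀ : Written B n b Q S inp l s₀) (hf : Frame s₀ s)
    (hra : s.ra = arrays d B inp (stored l q d)) (h4 : s.r 4 = q.2) (hM : l.length + 1 < M) :
    Runs M (appendProg d B) (appendProg d B).cost s fun s' => Written B n b Q S inp (l ++ [q]) s' ∧
      (∀ x, x ≠ 5 → s'.w x = s₀.w x) ∧ ∀ x, x ≠ 4 → x ≠ 5 → s'.r x = s₀.r x := by
  have h5 : s.w 5 = l.length := by rw [hf.w, hs₀.w5]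
  refine .andThen (runs_storeProg le_rfl (by omega) hra h5 (h4.trans (component_last q).symm)) ?_
  rintro _ rfl
  have h9 : s.w 9 = 1 := by rw [hf.w, hs₀.w9]
  refine .wadd (by simpa only [h5, h9] using hM) ⟨?_, fun x hx => ?_, hf.r⟩
  · exact
    { w0 := by simp [hf.w, hs₀.w0]
      w5 := by simp [h5, h9]
      w9 := by simp [h9]
      r7 := by simp [hf.r, hs₀.r7]
      r9 := by simp [hf.r, hs₀.r9]
      wa := by simp [hf.wa, hs₀.wa]
      ra := by simp [stored_all]
      hw := fun x => by
        simp [Function.update_of_ne (show x + B ≠ 5 by omega), hf.w, hs₀.hw]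
      hr := fun x => by simp [hf.r (x + B) (by omega) (by omega), hs₀.hr]
      w1 := by simp [hf.w, hs₀.w1]
      r1 := by simp [hf.r, hs₀.r1]
      r2 := by simp [hf.r, hs₀.r2]
      r6 := by simp [hf.r, hs₀.r6] }
  · simp [hx, hf.w]

theorem runs_fractionProg {init p : ℕ} {dig : ℕ → ℕ} (hb : 0 < b) (h1 : s.r 1 = b)
    (hA : ∀ j < p, s.w (11 + dig j) = A j) :
    Runs M (fractionProg init dig p) (fractionProg init dig p).cost s fun s' =>
      Frame s s' ∧ s'.ra = s.ra ∧ s'.r 4 = fraction b A p (s.r init) := by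
  induction p generalizing dig A with
  | zero => exact .rmov ⟨(Frame.refl s).setR _ (by omega), rfl, by simp [fraction]⟩
  | succ p ih =>
    refine .andThen (ih (A := fun j => A (j + 1)) fun j hj => hA (j + 1) (by omega)) ?_
    rintro s₁ ⟨hf, hra, h4⟩
    have h1' : s₁.r 1 = b := by rw [hf.r 1 (by omega) (by omega), h1]
    refine .seq (.rcast (.seq (.radd (.rdiv ?_ ⟨((hf.setR _ ?_).setR _ ?_).setR _ ?_, hra, ?_⟩))))
    · simp only [State.setR_r, ne_eq, OfNat.one_ne_ofNat, not_false_eq_true, Function.update_of_ne,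
        h1', Nat.cast_eq_zero]
      omega
    · omega
    · omega
    · omega
    · simp [h1', h4, hf.w, hA 0 (by omega), fraction]

theorem runs_coordProg (hb : 0 < b) (h1 : s.r 1 = b) (h7 : s.r 7 = 1) (h9 : s.r 9 = 0)
    (hA : ∀ δ ∈ τ.reads seq, s.w (11 + δ) = A δ) (i : Fin d) :
    Runs M (coordProg seq τ E i) (coordProg seq τ E i).cost s fun s' =>
      Frame s s' ∧ s'.ra = s.ra ∧ s'.r 4 = cornerCoord seq b τ A E i := by
  refine .andThen (runs_fractionProg (A := fun j => A (seq i (τ.side i) j)) hb h1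
    fun j hj => hA _ (Table.mem_reads.2 ⟨i, j, hj, rfl⟩)) ?_
  rintro s₁ ⟨hf, hra, h4⟩
  have h_init : s.r (if E i then 7 else 9) = if E i then 1 else 0 := by split_ifs <;> assumption
  rw [h_init] at h4
  have h7' : s₁.r 7 = 1 := by rw [hf.r 7 (by omega) (by omega), h7]
  have h9' : s₁.r 9 = 0 := by rw [hf.r 9 (by omega) (by omega), h9]
  have hf' := hf.setR (s₁.r 4 + s₁.r 7) (x := 4) (by omega)
  refine .seq (.radd ?_)
  unfold cornerCoord
  by_cases hs : τ.side i
  · rw [if_pos hs, if_pos hs]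
    exact .skip ⟨hf', hra, by simp [h4, h7']⟩
  · rw [if_neg hs, if_neg hs]
    exact .rsub ⟨hf'.setR _ (by omega), hra, by simp [h4, h7', h9']⟩

theorem runs_coordsProg (hb : 0 < b) (hB : d + 11 ≤ B) (hs : Written B n b Q S inp l s)
    (hA : ∀ δ ∈ τ.reads seq, s.w (11 + δ) = A δ) (hq : q.1 = cornerCoord seq b τ A E) :
    Runs M (coordsProg seq B τ E) (coordsProg seq B τ E).cost s fun s' =>
      Frame s s' ∧ s'.ra = arrays d B inp (stored l q d) := by
  rw [coordsProg, Prog.cost_forEach]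
  refine .imp (.forEach (fun (l₁ : List (Fin d)) s' => Frame s s' ∧
    s'.ra = arrays d B inp (stored l q l₁.length)) ⟨.refl s, ?_⟩ ?_) fun s' hs' => ?_
  · rw [List.length_nil, stored_zero, hs.ra]
  · rintro l₁ i l₂ hl s₁ ⟨hf, hra⟩
    have hi : (i : ℕ) = l₁.length := by
      have h : l₁.length < (List.finRange d).length := by simp [hl]
      have h_get : (List.finRange d)[l₁.length] = i := by simp [hl]
      rw [← h_get, List.getElem_finRange, Fin.val_cast]
    refine .andThen (runs_coordProg (τ := τ) (A := A) hb
      (by rw [hf.r 1 (by omega) (by omega), hs.r1]) (by rw [hf.r 7 (by omega) (by omega), hs.r7])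
      (by rw [hf.r 9 (by omega) (by omega), hs.r9])
      (by rwa [hf.w]) i) ?_
    rintro s₂ ⟨hf₂, hra₂, h4⟩
    refine (runs_storeProg (q := q) (l := l) i.isLt.le (by omega) (by rw [hra₂, hra, hi])
      (by rw [hf₂.w, hf.w, hs.w5]) ?_).imp ?_
    · rw [h4, component, dif_pos i.isLt, hq]
    · rintro _ rfl
      exact ⟨⟨(hf.trans hf₂).w, (hf.trans hf₂).wa, (hf.trans hf₂).r⟩, by simp [hi]⟩
  · rwa [List.length_finRange] at hs'

theorem runs_signProg (h9 : s₀.r 9 = 0) (hf : Frame s₀ s) :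
    Runs M (signProg E) 1 s fun s' =>
      Frame s₀ s' ∧ s'.ra = s.ra ∧ s'.r 4 = cornerWeight (s₀.r 3) E := by
  have h3' : s.r 3 = s₀.r 3 := hf.r 3 (by omega) (by omega)
  have h9' : s.r 9 = 0 := by rw [hf.r 9 (by omega) (by omega), h9]
  unfold signProg cornerWeight
  split_ifs with h_even
  · exact .rmov ⟨hf.setR _ (by omega), rfl, by simp [h3', h_even.neg_one_pow]⟩
  · exact .rsub ⟨hf.setR _ (by omega), rfl, by
      simp [h3', h9', (Nat.not_even_iff_odd.1 h_even).neg_one_pow]⟩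

theorem runs_cornerProg (hb : 0 < b) (hB : d + 11 ≤ B) (hs : Written B n b Q S inp l s)
    (hA : ∀ δ ∈ τ.reads seq, s.w (11 + δ) = A δ) (hM : l.length + 1 < M) :
    Runs M (cornerProg seq B τ E) (cornerProg seq B τ E).cost s fun s' =>
      Written B n b Q S inp (l ++ [(cornerCoord seq b τ A E, cornerWeight (s.r 3) E)]) s' ∧
        (∀ x, x ≠ 5 → s'.w x = s.w x) ∧ s'.r 3 = s.r 3 := by
  refine .andThen (runs_coordsProg (q := (cornerCoord seq b τ A E, cornerWeight (s.r 3) E)) hb hB hs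
    hA rfl) fun s₁ ⟨hf₁, hra₁⟩ => ?_
  refine .andThen (runs_signProg hs.r9 hf₁) fun s₂ ⟨hf₂, hra₂, h4⟩ => ?_
  exact (runs_appendProg hB hs hf₂ (hra₂.trans hra₁) h4 hM).imp fun s' ⟨hs', hw, hr⟩ =>
    ⟨hs', hw, hr 3 (by omega) (by omega)⟩

theorem runs_cornersProg (hb : 0 < b) (hB : d + 11 ≤ B) (hs : Written B n b Q S inp l s)
    (hA : ∀ δ ∈ τ.reads seq, s.w (11 + δ) = A δ)
    (hM : (l ++ corners seq b τ A (s.r 3)).length < M) :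
    Runs M (cornersProg seq B τ) (cornersProg seq B τ).cost s fun s' =>
      Written B n b Q S inp (l ++ corners seq b τ A (s.r 3)) s' ∧ ∀ x, x ≠ 5 → s'.w x = s.w x := by
  rw [cornersProg, Prog.cost_forEach]
  let point (E : Fin d → Bool) : Point d := (cornerCoord seq b τ A E, cornerWeight (s.r 3) E)
  refine .imp (.forEach (fun l₁ s' => Written B n b Q S inp (l ++ l₁.map point) s' ∧
    (∀ x, x ≠ 5 → s'.w x = s.w x) ∧ s'.r 3 = s.r 3) ⟨by simpa using hs, fun _ _ => rfl, rfl⟩ ?_)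
    fun s' hs' => ⟨hs'.1, hs'.2.1⟩
  rintro l₁ E l₂ hl s₁ ⟨hs₁, hw, h3⟩
  refine (runs_cornerProg (A := A) hb hB hs₁ (fun δ hδ => ?_) ?_).imp ?_
  · rw [hw _ (by omega), hA δ hδ]
  · have h_len := congrArg List.length hl
    simp [corners] at hM h_len ⊢
    omega
  · rintro s' ⟨hs', hw', h3'⟩
    rw [h3] at hs' h3'
    refine ⟨?_, fun x hx => (hw' x hx).trans (hw x hx), h3'⟩
    simpa [point] using hs'

end Corners

end CliqueToRectangle

namespace CliqueToRectangle

open RealRAM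

/-! ### Reading digits -/

/-- Put the last digit of word register `4` into the register of the digit `δ` and drop it from
register `4`. -/
def digitProg (δ : ℕ) : Prog :=
  Op.wdiv 6 4 1 ;; Op.wmul 10 6 1 ;; Op.wsub (11 + δ) 4 10 ;; Op.wmov 4 6

/-- Put the digits of word register `4` into the registers of the digits of a list. -/
def decodeProg : List ℕ → Prog
  | [] => Op.skip
  | δ :: l => digitProg δ ;; decodeProg l

/-- Put the number with the digits named `off, …, off + D - 1` into word register `x`. -/
def vertexProg (x : ℕ) : ℕ → ℕ → Prog
  | 0, _ => Op.wconst x 0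
  | D + 1, off => vertexProg x D (off + 1) ;; Op.wmul x x 1 ;; Op.wadd x x (11 + off)

/-- Put `b ^ j` into word register `x`. -/
def powProg (x : ℕ) : ℕ → Prog
  | 0 => Op.wconst x 1
  | j + 1 => powProg x j ;; Op.wmul x x 1

section Digits

variable {d B M n b c x δ : ℕ} {Q S : ℝ} {inp : ℕ → ℝ} {pts : List (Point d)} {s : State}

theorem updW_updW (s : State) (x v v' : ℕ) : (s.updW x v).updW x v' = s.updW x v' := by
  simp [State.updW]

theorem runs_digitProg (hB : d + 11 ≤ B) (hb : 0 < b) (hδ : 11 + δ < B)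
    (hs : Written B n b Q S inp pts s) (h4 : s.w 4 = c) (hc : c < M) :
    Runs M (digitProg δ) (digitProg δ).cost s fun s' =>
      Written B n b Q S inp pts s' ∧ s'.w 4 = c / b ∧ s'.w (11 + δ) = c % b ∧
        ∀ x, x ≠ 4 → x ≠ 6 → x ≠ 10 → x ≠ 11 + δ → s'.w x = s.w x := by
  have h_div : c / b ≤ c := Nat.div_le_self _ _
  have h_mul : c / b * b ≤ c := Nat.div_mul_le_self c b
  have h_mod : c - c / b * b = c % b := by
    rw [Nat.mod_eq_sub_div_mul]
  have h6 : 6 ≠ 11 + δ := by omega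
  have h4' : 11 + δ ≠ 4 := by omega
  refine .seq (.wdiv (by rw [hs.w1]; omega) (by rw [h4, hs.w1]; omega) (.seq (.wmul ?_
    (.seq (.wsub ?_ (.wmov ?_ ⟨?_, ?_, ?_, fun x hx4 hx6 hx10 hxδ => ?_⟩))))))
  · simp only [State.updW_w, h4, hs.w1, Function.update_self, Function.update_of_ne, ne_eq,
      OfNat.one_ne_ofNat, not_false_eq_true]
    omega
  · simp [h4, hs.w1]
    omega
  · simp [h4, hs.w1, h6]
    omega
  · exact (((hs.updW _ (by omega)).updW _ (by omega)).updW _ (by omega)).updW _ (by omega)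
  · simp [h4, hs.w1, h6]
  · simp [h4, hs.w1, h4', h_mod]
  · simp [hx4, hx6, hx10, hxδ]

theorem runs_decodeProg {l : List ℕ} (hB : d + 11 ≤ B) (hb : 0 < b) (hl : l.Nodup)
    (hlB : ∀ δ ∈ l, 11 + δ < B) (hs : Written B n b Q S inp pts s) (h4 : s.w 4 = c) (hc : c < M) :
    Runs M (decodeProg l) (decodeProg l).cost s fun s' =>
      Written B n b Q S inp pts s' ∧ (∀ δ ∈ l, s'.w (11 + δ) = assignDigits b l c δ) ∧
        ∀ x, x ≠ 4 → x ≠ 6 → x ≠ 10 → (∀ δ ∈ l, x ≠ 11 + δ) → s'.w x = s.w x := by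
  induction l generalizing s c with
  | nil => exact .skip ⟨hs, by simp, fun _ _ _ _ _ => rfl⟩
  | cons δ l ih =>
    obtain ⟨hδ, hl⟩ := List.nodup_cons.1 hl
    obtain ⟨hδB, hlB⟩ := List.forall_mem_cons.1 hlB
    refine .andThen (runs_digitProg hB hb hδB hs h4 hc) fun s₁ ⟨hs₁, h4₁, hδ₁, hw₁⟩ => ?_
    refine (ih hl hlB hs₁ h4₁ ((Nat.div_le_self _ _).trans_lt hc)).imp
      fun s₂ ⟨hs₂, hl₂, hw₂⟩ => ⟨hs₂, fun γ hγ => ?_, fun x h4 h6 h10 hx => ?_⟩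
    · rcases List.mem_cons.1 hγ with rfl | hγ
      · rw [hw₂ _ (by omega) (by omega) (by omega) fun δ' hδ' h => hδ (by
          rwa [Nat.add_left_cancel h]), hδ₁, assignDigits, Function.update_self]
      · rw [hl₂ γ hγ, assignDigits, Function.update_of_ne (ne_of_mem_of_not_mem hγ hδ)]
    · obtain ⟨hxδ, hx⟩ := List.forall_mem_cons.1 hx
      rw [hw₂ x h4 h6 h10 hx, hw₁ x h4 h6 h10 hxδ]

theorem runs_vertexProg {A : ℕ → ℕ} {D off : ℕ} (hx : x < 11) (hx1 : x ≠ 1) (hb : 0 < b)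
    (hM : b ^ D < M) (h1 : s.w 1 = b) (hA : ∀ i < D, s.w (11 + (off + i)) = A (off + i))
    (hAb : ∀ i < D, A (off + i) < b) :
    Runs M (vertexProg x D off) (vertexProg x D off).cost s fun s' =>
      s' = s.updW x (digitsValue b A D off) := by
  induction D generalizing off with
  | zero => exact .wconst (pos_of_gt hM) rfl
  | succ D ih =>
    have h_pow : b ^ D ≤ b ^ (D + 1) := Nat.pow_le_pow_right hb D.le_succ
    have h_lt := digitsValue_lt (D + 1) off hAb
    rw [forall_lt_succ_add (P := fun δ => s.w (11 + δ) = A δ)] at hA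
    rw [forall_lt_succ_add (P := fun δ => A δ < b)] at hAb
    rw [digitsValue] at h_lt ⊢
    refine .andThen (ih (h_pow.trans_lt hM) hA.2 hAb.2) ?_
    rintro _ rfl
    refine .seq (.wmul ?_ (.wadd ?_ ?_))
    · simp [hx1.symm, h1]
      omega
    · simp [hx1.symm, h1, hA.1, show 11 + off ≠ x by omega]
      omega
    · rw [updW_updW, updW_updW]
      simp [hx1.symm, h1, hA.1, show 11 + off ≠ x by omega]

theorem runs_powProg {j : ℕ} (hx1 : x ≠ 1) (hb : 0 < b) (hM : b ^ j < M) (h1 : s.w 1 = b) :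
    Runs M (powProg x j) (powProg x j).cost s fun s' => s' = s.updW x (b ^ j) := by
  induction j with
  | zero => exact .wconst (by rwa [pow_zero] at hM) (by rw [pow_zero])
  | succ j ih =>
    refine .andThen (ih ((Nat.pow_le_pow_right hb j.le_succ).trans_lt hM)) ?_
    rintro _ rfl
    have h_mul : (s.updW x (b ^ j)).w x * (s.updW x (b ^ j)).w 1 = b ^ (j + 1) := by
      simp [hx1.symm, h1, pow_succ]
    exact .wmul (by rwa [h_mul]) (by rw [h_mul, updW_updW])

end Digits

/-! ### Writing the points of an item -/

/-- Put the sum of the bonus and the weight of the edge between the vertices in the word registers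
`7` and `8` into real register `3`. -/
def edgeProg : Prog :=
  Op.wmul 6 7 0 ;; Op.wadd 6 6 8 ;; Op.rload 3 0 6 ;; Op.radd 3 2 3

/-- Write the corners of a cell if the word registers `7` and `8` contain vertices `a < c`. -/
noncomputable def pairProg {d : ℕ} (seq : Fin d → Bool → ℕ → ℕ) (B : ℕ) (τ : Table d) : Prog :=
  .branch (.wlt 7 8) (.branch (.wlt 8 0) (edgeProg ;; cornersProg seq B τ) Op.skip) Op.skip

/-- Write the points of an item in the cell of the digits in memory. -/
noncomputable def cellProg {d : ℕ} (seq : Fin d → Bool → ℕ → ℕ) (D B : ℕ) (x : Item d) : Prog :=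
  match x.2 with
  | none => Op.rmov 3 2 ;; cornersProg seq B x.1
  | some (u, v) => vertexProg 7 D (u * D) ;; vertexProg 8 D (v * D) ;; pairProg seq B x.1

/-- Write the points of an item in the cell whose number is in word register `3`, then increment
that register. -/
noncomputable def nextCellProg {d : ℕ} (seq : Fin d → Bool → ℕ → ℕ) (D B : ℕ) (x : Item d) : Prog :=
  Op.wmov 4 3 ;; decodeProg (x.1.digits seq) ;; cellProg seq D B x ;; Op.wadd 3 3 9

/-- Write the points of an item. -/
noncomputable def itemProg {d : ℕ} (seq : Fin d → Bool → ℕ → ℕ) (D B : ℕ) (x : Item d) : Prog :=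
  powProg 2 (x.1.digits seq).length ;; Op.wconst 3 0 ;;
    .loop (.wlt 3 2) (nextCellProg seq D B x)

/-- The time that `itemProg` takes for each cell. -/
noncomputable def itemTime {d : ℕ} (seq : Fin d → Bool → ℕ → ℕ) (D B : ℕ) (x : Item d) : ℕ :=
  (powProg 2 (x.1.digits seq).length).cost + (nextCellProg seq D B x).cost + 3

theorem mul_add_lt_mul {i j m n : ℕ} (hi : i < m) (hj : j < n) : i * n + j < m * n :=
  calc i * n + j < i * n + n := Nat.add_lt_add_left hj _
    _ = (i + 1) * n := (Nat.succ_mul i n).symm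
    _ ≤ m * n := Nat.mul_le_mul_right n hi

section Items

variable {d k D U B M n b : ℕ} {Q S : ℝ} {inp : ℕ → ℝ} {w : ℕ → ℕ → ℝ} {l : List (Point d)}
  {s : State} {seq : Fin d → Bool → ℕ → ℕ} {τ : Table d} {A : ℕ → ℕ} {Δ : Design d k D U}
  {x : Item d}

theorem runs_edgeProg {i j : ℕ} (hB : d + 11 ≤ B) (hM : n * n < M)
    (hs : Written B n b Q S inp l s) (h7 : s.w 7 = i) (h8 : s.w 8 = j) (hi : i < n) (hj : j < n) :
    Runs M edgeProg edgeProg.cost s fun s' => Written B n b Q S inp l s' ∧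
      s'.r 3 = Q + inp (i * n + j) ∧ ∀ x, x ≠ 6 → s'.w x = s.w x := by
  have h_index := mul_add_lt_mul hi hj
  refine .seq (.wmul ?_ (.seq (.wadd ?_ (.seq (.rload (.radd ⟨?_, ?_, fun x hx => ?_⟩))))))
  · rw [h7, hs.w0]
    omega
  · simp [h7, h8, hs.w0]
    omega
  · exact (((hs.updW _ (by omega)).updW _ (by omega)).setR _ (by omega)).setR _ (by omega)
  · simp [h7, h8, hs.w0, hs.r2, hs.ra, arrays_zero]
  · simp [hx]

theorem runs_pairProg {u v : ℕ} (hb : 0 < b) (hB : d + 11 ≤ B) (hnM : n * n < M)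
    (hinp : ∀ i j, i < n → j < n → inp (i * n + j) = w i j) (hs : Written B n b Q S inp l s)
    (h7 : s.w 7 = digitsValue b A D (u * D)) (h8 : s.w 8 = digitsValue b A D (v * D))
    (hA : ∀ δ ∈ τ.reads seq, s.w (11 + δ) = A δ)
    (hM : (l ++ cellPoints seq D b n w Q (τ, some (u, v)) A).length < M) :
    Runs M (pairProg seq B τ) (pairProg seq B τ).cost s fun s' =>
      Written B n b Q S inp (l ++ cellPoints seq D b n w Q (τ, some (u, v)) A) s' ∧
        ∀ x, x ≠ 5 → x ≠ 6 → s'.w x = s.w x := by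
  simp only [cellPoints, itemValue, ← h7, ← h8] at hM ⊢
  refine .branch (fun h78 => .branch (fun h80 => ?_) fun h80 => ?_) fun h78 => ?_
  all_goals rw [Test.Holds] at h78
  all_goals try rw [Test.Holds, hs.w0] at h80
  · have h7n : s.w 7 < n := h78.trans h80
    simp only [if_pos h78, if_pos h80] at hM ⊢
    refine .andThen (runs_edgeProg hB hnM hs rfl rfl h7n h80) fun s₁ ⟨hs₁, h3, hw₁⟩ => ?_
    rw [hinp _ _ h7n h80] at h3
    rw [← h3] at hM ⊢
    refine (runs_cornersProg hb hB hs₁ (fun δ hδ => ?_) hM).imp fun s₂ ⟨hs₂, hw₂⟩ =>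
      ⟨hs₂, fun x h5 h6 => by rw [hw₂ x h5, hw₁ x h6]⟩
    rw [hw₁ _ (by omega), hA δ hδ]
  · rw [if_pos h78, if_neg h80, List.append_nil]
    exact .skip ⟨hs, fun _ _ _ => rfl⟩
  · rw [if_neg h78, List.append_nil]
    exact .skip ⟨hs, fun _ _ _ => rfl⟩

theorem runs_cellProg (hb : 0 < b) (hB : d + 11 ≤ B) (hx : x ∈ Δ.items) (hDM : b ^ D < M)
    (hnM : n * n < M) (hinp : ∀ i j, i < n → j < n → inp (i * n + j) = w i j)
    (hs : Written B n b Q S inp l s) (hAb : ∀ δ, A δ < b)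
    (hA : ∀ δ ∈ x.1.reads Δ.seq, s.w (11 + δ) = A δ)
    (hM : (l ++ cellPoints Δ.seq D b n w Q x A).length < M) :
    Runs M (cellProg Δ.seq D B x) (cellProg Δ.seq D B x).cost s fun s' =>
      Written B n b Q S inp (l ++ cellPoints Δ.seq D b n w Q x A) s' ∧
        s'.w 2 = s.w 2 ∧ s'.w 3 = s.w 3 := by
  obtain ⟨τ, o⟩ := x
  obtain ⟨-, rfl⟩ | ⟨u, v, huv, hvk, h⟩ := Design.mem_items.1 hx
  · have hs₁ : Written B n b Q S inp l (s.setR 3 (s.r 2)) := hs.setR _ (by omega)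
    have h3 : (s.setR 3 (s.r 2)).r 3 = Q := by simp [hs.r2]
    have h_cell : cellPoints Δ.seq D b n w Q (τ, none) A =
        corners Δ.seq b τ A ((s.setR 3 (s.r 2)).r 3) := by rw [h3, cellPoints, itemValue]
    rw [h_cell] at hM ⊢
    exact .seq (.rmov ((runs_cornersProg hb hB hs₁ hA hM).imp fun s' ⟨hs', hw⟩ =>
      ⟨hs', hw 2 (by omega), hw 3 (by omega)⟩))
  · obtain ⟨rfl, rfl⟩ := Prod.mk.inj h
    refine .andThen (runs_vertexProg (by omega) (by omega) hb hDM hs.w1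
      (fun i hi => hA _ (Δ.covers_left u v huv hvk i hi)) fun i _ => hAb _) ?_
    rintro _ rfl
    have hs₁ := hs.updW (x := 7) (digitsValue b A D (u * D)) (by omega)
    refine .andThen (runs_vertexProg (A := A) (by omega) (by omega) hb hDM hs₁.w1
      (fun i hi => ?_) fun i _ => hAb _) ?_
    · rw [State.updW_w, Function.update_of_ne (by omega)]
      exact hA _ (Δ.covers_right u v huv hvk i hi)
    rintro _ rfl
    refine (runs_pairProg (A := A) hb hB hnM hinp (hs₁.updW _ (by omega)) (by simp) (by simp)
      (fun δ hδ => ?_) hM).imp fun s' ⟨hs', hw⟩ => ⟨hs', ?_, ?_⟩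
    · simp [hA δ hδ, show 11 + δ ≠ 7 by omega, show 11 + δ ≠ 8 by omega]
    · simp [hw 2]
    · simp [hw 3]

theorem runs_nextCellProg {c : ℕ} (hb : 0 < b) (hB : d + 11 ≤ B) (hx : x ∈ Δ.items)
    (hxB : ∀ δ ∈ x.1.reads Δ.seq, 11 + δ < B) (hDM : b ^ D < M) (hnM : n * n < M)
    (hinp : ∀ i j, i < n → j < n → inp (i * n + j) = w i j) (hs : Written B n b Q S inp l s)
    (h3 : s.w 3 = c) (hc : c + 1 < M)
    (hM : (l ++ cellPoints Δ.seq D b n w Q x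
      (assignDigits b (x.1.digits Δ.seq) c)).length < M) :
    Runs M (nextCellProg Δ.seq D B x) (nextCellProg Δ.seq D B x).cost s fun s' =>
      Written B n b Q S inp (l ++ cellPoints Δ.seq D b n w Q x
        (assignDigits b (x.1.digits Δ.seq) c)) s' ∧ s'.w 2 = s.w 2 ∧ s'.w 3 = c + 1 := by
  refine .seq (.wmov (by omega) ?_)
  refine .andThen (runs_decodeProg hB hb (Finset.nodup_toList _)
    (fun δ hδ => hxB δ (Finset.mem_toList.1 hδ)) (hs.updW _ (by omega)) (c := c) (by simp [h3])
    (by omega)) fun s₁ ⟨hs₁, hd₁, hw₁⟩ => ?_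
  refine .andThen (runs_cellProg hb hB hx hDM hnM hinp hs₁ (assignDigits_lt hb _ _)
    (fun δ hδ => hd₁ δ (Finset.mem_toList.2 hδ)) hM) fun s₂ ⟨hs₂, h2₂, h3₂⟩ => ?_
  have h2 : s₂.w 2 = s.w 2 := by
    rw [h2₂, hw₁ 2 (by omega) (by omega) (by omega) (by omega)]
    simp
  have h3 : s₂.w 3 = c := by
    rw [h3₂, hw₁ 3 (by omega) (by omega) (by omega) (by omega)]
    simp [h3]
  refine .wadd (by rwa [h3, hs₂.w9]) ⟨hs₂.updW _ (by omega), by simp [h2], by simp [h3, hs₂.w9]⟩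

theorem runs_itemProg (hb : 0 < b) (hB : d + 11 ≤ B) (hx : x ∈ Δ.items)
    (hxB : ∀ δ ∈ x.1.reads Δ.seq, 11 + δ < B) (hDM : b ^ D < M) (hUM : b ^ U < M)
    (hnM : n * n < M) (hinp : ∀ i j, i < n → j < n → inp (i * n + j) = w i j)
    (hs : Written B n b Q S inp l s) (hM : (l ++ itemPoints Δ.seq D b n w Q x).length < M) :
    Runs M (itemProg Δ.seq D B x) (itemTime Δ.seq D B x * b ^ U) s
      (Written B n b Q S inp (l ++ itemPoints Δ.seq D b n w Q x)) := by
  let L := (x.1.digits Δ.seq).length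
  have hLU : b ^ L ≤ b ^ U := Nat.pow_le_pow_right hb (Design.length_digits_le hx)
  let g c := cellPoints Δ.seq D b n w Q x (assignDigits b (x.1.digits Δ.seq) c)
  have h_range (i : ℕ) : (List.range (i + 1)).flatMap g = (List.range i).flatMap g ++ g i := by
    simp [List.range_succ]
  have h_len {i : ℕ} (hi : i ≤ b ^ L) : (l ++ (List.range i).flatMap g).length < M := by
    refine lt_of_le_of_lt ?_ hM
    have h_sub : (List.range i).Sublist (List.range (b ^ L)) := List.range_sublist.2 hi
    exact ((List.Sublist.refl l).append (h_sub.flatMap g)).length_le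
  refine .le (.andThen (runs_powProg (by omega) hb (hLU.trans_lt hUM) hs.w1) ?_) (T := _ + (1 +
    (b ^ L * ((nextCellProg Δ.seq D B x).cost + 1) + 1))) ?_
  · rintro _ rfl
    refine .seq (.wconst (pos_of_gt hDM) ?_)
    have hs₁ := (hs.updW (x := 2) (b ^ L) (by omega)).updW (x := 3) 0 (by omega)
    refine .imp (.loop (fun i s' => Written B n b Q S inp (l ++ (List.range i).flatMap g) s' ∧
      s'.w 2 = b ^ L ∧ s'.w 3 = i) (b ^ L) ⟨by simpa using hs₁, by simp [L], by simp⟩ ?_ ?_ ?_)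
      fun s' hs' => hs'.1
    · rintro i hi s' ⟨-, h2, h3⟩
      rwa [Test.Holds, h2, h3]
    · rintro s' ⟨-, h2, h3⟩
      rw [Test.Holds, h2, h3]
      exact lt_irrefl _
    · rintro i hi s' ⟨hs', h2, h3⟩
      have hM' := h_len (i := i + 1) hi
      rw [h_range, ← List.append_assoc] at hM' ⊢
      exact (runs_nextCellProg hb hB hx hxB hDM hnM hinp hs' h3 (by omega) hM').imp
        fun s'' ⟨hs'', h2', h3'⟩ => ⟨hs'', h2'.trans h2, h3'⟩
  · have h_one : 1 ≤ b ^ U := Nat.one_le_pow _ _ hb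
    rw [itemTime]
    nlinarith [Nat.mul_le_mul_right ((nextCellProg Δ.seq D B x).cost + 1) hLU]

theorem runs_items (hb : 0 < b) (hB : d + 11 ≤ B)
    (hxB : ∀ x ∈ Δ.items, ∀ δ ∈ x.1.reads Δ.seq, 11 + δ < B) (hDM : b ^ D < M) (hUM : b ^ U < M)
    (hnM : n * n < M) (hinp : ∀ i j, i < n → j < n → inp (i * n + j) = w i j)
    (hs : Written B n b Q S inp l s) (hM : (l ++ Δ.points b n w Q).length < M) :
    Runs M (.forEach (itemProg Δ.seq D B) Δ.items)
      (((Δ.items.map (itemTime Δ.seq D B)).sum + 1) * b ^ U) s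
      (Written B n b Q S inp (l ++ Δ.points b n w Q)) := by
  refine .le (.forEach (T := fun x => itemTime Δ.seq D B x * b ^ U)
    (fun xs => Written B n b Q S inp (l ++ xs.flatMap (itemPoints Δ.seq D b n w Q)))
    (by simpa using hs) fun xs x ys h s₁ hs₁ => ?_) ?_
  · have hx : x ∈ Δ.items := by simp [h]
    rw [Design.points, h] at hM
    rw [List.flatMap_append, List.flatMap_singleton, ← List.append_assoc]
    refine runs_itemProg hb hB hx (hxB x hx) hDM hUM hnM hinp hs₁ ?_
    simp only [List.flatMap_append, List.flatMap_cons, List.length_append] at hM ⊢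
    omega
  · rw [List.sum_map_mul_right, add_mul, one_mul]
    exact Nat.add_le_add_left (Nat.one_le_pow _ _ hb) _

end Items

end CliqueToRectangle

namespace CliqueToRectangle

open RealRAM

/-! ### Initialization -/

/-- The weight matrix of a graph, row by row, as it is given to the machine. -/
noncomputable def weightArray {k : ℕ} (G : WeightedGraph k) : ℕ → ℝ :=
  ((maxWeightClique k).input G).ra 0

/-- The bound `S` of the reduction: no edge weight exceeds it in absolute value. -/
noncomputable def absSum {k : ℕ} (G : WeightedGraph k) : ℝ :=
  ∑ i ∈ Finset.range (G.n * G.n), |weightArray G i|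

/-- Put the least `b` with `n ≤ b ^ D` into word register `1`. -/
def baseProg (D : ℕ) : Prog :=
  Op.wconst 9 1 ;; Op.rcast 7 9 ;; Op.wconst 1 1 ;; Op.wconst 2 1 ;;
    .loop (.wlt 2 0) (Op.wadd 1 1 9 ;; powProg 2 D)

/-- Add the absolute value of the entry of the input whose index is in word register `3` to real
register `6`, then increment that word register. -/
def addAbsProg : Prog :=
  Op.rload 3 0 3 ;; .branch (.rlt 3 9) (Op.rsub 6 6 3) (Op.radd 6 6 3) ;; Op.wadd 3 3 9

/-- Put the sum of the absolute values of the input into real register `6`. -/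
def absSumProg : Prog :=
  Op.wmul 2 0 0 ;; Op.wconst 3 0 ;; .loop (.wlt 3 2) addAbsProg

/-- Put `b` into real register `1` and `1 + 2 * m * S` into real register `2`. -/
def bonusProg (m : ℕ) : Prog :=
  Op.rcast 1 1 ;; Op.wconst 6 (2 * m) ;; Op.rcast 4 6 ;; Op.rmul 4 4 6 ;; Op.radd 2 7 4

/-- Compute the parameters of the reduction; `m` is the number of items. -/
def initProg (D m : ℕ) : Prog :=
  baseProg D ;; absSumProg ;; bonusProg m

section Initialization

variable {d k D B M n b m : ℕ} {Q S : ℝ} {inp : ℕ → ℝ} {l : List (Point d)} {s : State}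
  {G : WeightedGraph k}

theorem weightArray_eq {i j : ℕ} (hi : i < G.n) (hj : j < G.n) :
    weightArray G (i * G.n + j) = weightOf G i j := by
  have hij := mul_add_lt_mul hi hj
  have h_index : (⟨i * G.n + j, hij⟩ : Fin (G.n * G.n)) = finProdFinEquiv (⟨i, hi⟩, ⟨j, hj⟩) :=
    Fin.ext (by simp only [finProdFinEquiv_apply_val, mul_comm, add_comm])
  simp only [weightArray, maxWeightClique, if_true, dif_pos hij, h_index, Equiv.symm_apply_apply,
    weightOf, dif_pos (And.intro hi hj)]

theorem absSum_nonneg (G : WeightedGraph k) : 0 ≤ absSum G :=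
  Finset.sum_nonneg fun _ _ => abs_nonneg _

theorem abs_weightOf_le {i j : ℕ} (hi : i < G.n) (hj : j < G.n) :
    |weightOf G i j| ≤ absSum G := by
  rw [← weightArray_eq hi hj]
  exact Finset.single_le_sum (f := fun i => |weightArray G i|) (fun _ _ => abs_nonneg _)
    (Finset.mem_range.2 (mul_add_lt_mul hi hj))

theorem memory_input (d : ℕ) (hB : 11 ≤ B) (G : WeightedGraph k) :
    Memory B G.n (weightArray G) ([] : List (Point d))
      ((((maxWeightClique k).input G).updW 9 1).setR 7 1) where
  w0 := by simp [maxWeightClique]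
  w5 := by simp [maxWeightClique]
  w9 := by simp
  r7 := by simp
  r9 := by simp [maxWeightClique]
  wa := rfl
  ra := by
    funext a i
    by_cases ha : a = 0
    · rw [ha, arrays_zero, weightArray]
      rfl
    · simp only [arrays, ha, if_false]
      split_ifs <;> exact if_neg ha
  hw x := by
    rw [State.setR_w, State.updW_w, Function.update_of_ne (by omega)]
    exact if_neg (by omega)
  hr x := by simp [maxWeightClique, Function.update_of_ne (show x + B ≠ 7 by omega)]

theorem runs_baseProg (d : ℕ) (hB : 11 ≤ B) (hb : 0 < b) (hn : G.n ≤ b ^ D)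
    (h_least : ∀ b' < b, b' ^ D < G.n) (hbM : b < M) (hM : b ^ D < M) :
    Runs M (baseProg D) (((powProg 2 D).cost + 5) * b) ((maxWeightClique k).input G) fun s =>
      Memory B G.n (weightArray G) ([] : List (Point d)) s ∧ s.w 1 = b ∧ s.r 6 = 0 := by
  have h_one : 1 < M := by omega
  refine .le (.seq (.wconst h_one (.seq (.rcast (.seq (.wconst h_one (.seq (.wconst h_one
    (.imp (.loop (fun i s => Memory B G.n (weightArray G) ([] : List (Point d)) s ∧
      s.w 1 = i + 1 ∧ s.w 2 = (i + 1) ^ D ∧ s.r 6 = 0) (b - 1) ?_ ?_ ?_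
      (T := 1 + (powProg 2 D).cost) ?_) ?_))))))))) ?_
  · refine ⟨?_, by simp, by simp, by simp [maxWeightClique]⟩
    have hs := memory_input d hB G
    simpa using (hs.updW (x := 1) 1 (by omega)).updW (x := 2) 1 (by omega)
  · rintro i hi s ⟨hs, -, h2, -⟩
    rw [Test.Holds, hs.w0, h2]
    exact h_least _ (by omega)
  · rintro s ⟨hs, -, h2, -⟩
    rwa [Test.Holds, hs.w0, h2, not_lt, Nat.sub_add_cancel hb]
  · rintro i hi s ⟨hs, h1, -, h6⟩
    have h_pow : (i + 1 + 1) ^ D ≤ b ^ D := Nat.pow_le_pow_left (by omega) D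
    have hs₁ := hs.updW (x := 1) (i + 1 + 1) (by omega)
    refine .seq (.wadd (by rw [h1, hs.w9]; omega) ?_)
    rw [h1, hs.w9]
    refine (runs_powProg (b := i + 1 + 1) (by omega) (by omega) (by omega) (by simp)).imp ?_
    rintro _ rfl
    exact ⟨hs₁.updW _ (by omega), by simp, by simp, h6⟩
  · rintro s ⟨hs, h1, -, h6⟩
    exact ⟨hs, by omega, h6⟩
  · obtain ⟨c, rfl⟩ := Nat.exists_eq_add_of_lt hb
    simp only [zero_add, Nat.add_sub_cancel]
    nlinarith

theorem runs_addAbsProg {i : ℕ} (hB : 11 ≤ B) (hM : i + 1 < M) (hs : Memory B n inp l s)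
    (h3 : s.w 3 = i) :
    Runs M addAbsProg addAbsProg.cost s fun s' => Memory B n inp l s' ∧ s'.w 1 = s.w 1 ∧
      s'.w 2 = s.w 2 ∧ s'.w 3 = i + 1 ∧ s'.r 6 = s.r 6 + |inp i| := by
  have h_entry : s.ra 0 (s.w 3) = inp i := by rw [hs.ra, arrays_zero, h3]
  have hs₁ := hs.setR (x := 3) (inp i) (by omega)
  refine .seq (.rload ?_)
  rw [h_entry]
  refine .andThen (P := fun s' => s' = (s.setR 3 (inp i)).setR 6 (s.r 6 + |inp i|))
    (.branch (fun h => .rsub ?_) fun h => .radd ?_) ?_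
  · have h_neg : inp i < 0 := by simpa [Test.Holds, hs.r9] using h
    simp [abs_of_neg h_neg, sub_eq_add_neg]
  · have h_nonneg : 0 ≤ inp i := by simpa [Test.Holds, hs.r9] using h
    simp [abs_of_nonneg h_nonneg]
  · rintro _ rfl
    exact .wadd (by simpa [h3, hs.w9] using hM) ⟨(hs₁.setR _ (by omega)).updW _ (by omega),
      by simp, by simp, by simp [h3, hs.w9], by simp⟩

theorem runs_absSumProg (hB : 11 ≤ B) (hM : n * n < M) (hs : Memory B n inp l s)
    (h6 : s.r 6 = 0) :
    Runs M absSumProg ((addAbsProg.cost + 1) * (n * n) + 3) s fun s' => Memory B n inp l s' ∧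
      s'.w 1 = s.w 1 ∧ s'.r 6 = ∑ i ∈ Finset.range (n * n), |inp i| := by
  refine .le (.seq (.wmul (by rwa [hs.w0]) (.seq (.wconst (by omega) (.imp (.loop
    (fun i s' => Memory B n inp l s' ∧ s'.w 1 = s.w 1 ∧ s'.w 2 = n * n ∧ s'.w 3 = i ∧
      s'.r 6 = ∑ i ∈ Finset.range i, |inp i|) (n * n) ?_ ?_ ?_
      (T := addAbsProg.cost) ?_) ?_))))) (T' := _) (by rw [mul_comm]; omega)
  · exact ⟨(hs.updW _ (by omega)).updW _ (by omega), by simp, by simp [hs.w0], by simp,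
      by simp [h6]⟩
  · rintro i hi s' ⟨-, -, h2, h3, -⟩
    rwa [Test.Holds, h2, h3]
  · rintro s' ⟨-, -, h2, h3, -⟩
    rw [Test.Holds, h2, h3]
    exact lt_irrefl _
  · rintro i hi s' ⟨hs', h1, h2, h3, h6⟩
    refine (runs_addAbsProg hB (by omega) hs' h3).imp fun s'' ⟨hs'', h1', h2', h3', h6'⟩ =>
      ⟨hs'', h1'.trans h1, h2'.trans h2, h3', ?_⟩
    rw [h6', h6, Finset.sum_range_succ]
  · exact fun s' ⟨hs', h1, _, _, h6⟩ => ⟨hs', h1, h6⟩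

theorem runs_bonusProg (hB : 11 ≤ B) (hm : 2 * m < M) (hs : Memory B n inp l s)
    (h1 : s.w 1 = b) (h6 : s.r 6 = S) :
    Runs M (bonusProg m) (bonusProg m).cost s
      (Written B n b (1 + 2 * (m * S)) S inp l) := by
  refine .seq (.rcast (.seq (.wconst hm (.seq (.rcast (.seq (.rmul (.radd ?_))))))))
  exact
  { toMemory := ((((hs.setR _ (by omega)).updW _ (by omega)).setR _ (by omega)).setR _
      (by omega)).setR _ (by omega)
    w1 := by simp [h1]
    r1 := by simp [h1]
    r2 := by simp [h6, hs.r7, mul_assoc]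
    r6 := by simp [h6] }

theorem runs_initProg (d : ℕ) (hB : 11 ≤ B) (hb : 0 < b) (hn : G.n ≤ b ^ D)
    (h_least : ∀ b' < b, b' ^ D < G.n) (hbM : b < M) (hM : b ^ D < M) (hnM : G.n * G.n < M)
    (hm : 2 * m < M) :
    Runs M (initProg D m) (((powProg 2 D).cost + 5) * b +
        ((addAbsProg.cost + 1) * (G.n * G.n) + 3 + (bonusProg m).cost))
      ((maxWeightClique k).input G)
      (Written B G.n b (1 + 2 * (m * absSum G)) (absSum G) (weightArray G)
        ([] : List (Point d))) :=
  .andThen (runs_baseProg d hB hb hn h_least hbM hM) fun _ ⟨hs₁, h1, h6⟩ =>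
    .andThen (runs_absSumProg hB hnM hs₁ h6) fun _ ⟨hs₂, h1', h6'⟩ =>
      runs_bonusProg hB hm hs₂ (h1'.trans h1) h6'

end Initialization

/-! ### The heavy point at the origin -/

/-- Write the origin with the weight `(N + 1) * (Q + S)`, where `N` is the number of points written
before. -/
def originProg (d B : ℕ) : Prog :=
  Op.wadd 6 5 9 ;; Op.rcast 4 6 ;; Op.radd 5 2 6 ;; Op.rmul 4 4 5 ;; Op.rmov 8 4 ;;
    appendProg d B

theorem runs_originProg {d B M n b : ℕ} {Q S : ℝ} {inp : ℕ → ℝ} {l : List (Point d)} {s : State}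
    (hB : d + 11 ≤ B) (hs : Written B n b Q S inp l s) (hM : l.length + 1 < M) :
    Runs M (originProg d B) (originProg d B).cost s fun s' =>
      Written B n b Q S inp (l ++ [(0, (l.length + 1 : ℕ) * (Q + S))]) s' ∧
        s'.r 8 = (l.length + 1 : ℕ) * (Q + S) := by
  refine .seq (.wadd (by rwa [hs.w5, hs.w9]) (.seq (.rcast (.seq (.radd (.seq (.rmul (.seq
    (.rmov ?_)))))))))
  refine (runs_appendProg hB (((((hs.updW _ (by omega)).setR _ (by omega)).setR _
    (by omega)).setR _ (by omega)).setR _ (by omega)) (.refl _) ?_ ?_ hM).imp fun s' ⟨hs', _, hr⟩ =>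
      ⟨hs', (hr 8 (by omega) (by omega)).trans ?_⟩
  · rw [stored_origin]
    exact hs.ra
  · simp [hs.w5, hs.w9, hs.r2, hs.r6]
  · simp [hs.w5, hs.w9, hs.r2, hs.r6]

end CliqueToRectangle

namespace CliqueToRectangle

open RealRAM

/-! ### Evaluating the box -/

/-- Add real register `3` to real register `0` if the coordinates `0, …, j - 1` of the current point
lie in the range given by the box. -/
def checkProg (d B : ℕ) : ℕ → Prog
  | 0 => Op.radd 0 0 3
  | j + 1 => Op.rload 4 (1 + j) 3 ;; .branch (.rlt 4 (j + B)) Op.skip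
      (.branch (.rlt (d + j + B) 4) Op.skip (checkProg d B j))

/-- Add the weight of the point whose index is in word register `3` to real register `0` if the box
contains it, then increment that word register. -/
def nextPointProg (d B : ℕ) : Prog :=
  Op.rload 3 (1 + d) 3 ;; checkProg d B d ;; Op.wadd 3 3 9

/-- Correct real register `0` by the weight of the origin and the bonus for `m` items. -/
def correctProg (m : ℕ) : Prog :=
  Op.rsub 0 0 8 ;; Op.wconst 6 m ;; Op.rcast 4 6 ;; Op.rmul 4 4 2 ;; Op.rsub 0 0 4

/-- Put the weight of the box, corrected by the weight of the origin and the bonus for `m` items,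
into real register `0`. -/
def evalProg (d B m : ℕ) : Prog :=
  Op.rmov 0 9 ;; Op.wconst 3 0 ;; .loop (.wlt 3 5) (nextPointProg d B) ;; correctProg m

/-- The memory while the box from `lo` to `hi` is evaluated. -/
structure Eval {d : ℕ} (B : ℕ) (l : List (Point d)) (lo hi : Fin d → ℝ) (Q W : ℝ) (s : State) :
    Prop where
  w5 : s.w 5 = l.length
  w9 : s.w 9 = 1
  r2 : s.r 2 = Q
  r8 : s.r 8 = W
  rlo : ∀ i : Fin d, s.r (i + B) = lo i
  rhi : ∀ i : Fin d, s.r (d + i + B) = hi i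
  ra : ∀ i ≤ d, s.ra (1 + i) = pointArray l i

section Evaluation

variable {d B M m p x : ℕ} {l : List (Point d)} {lo hi : Fin d → ℝ} {Q W : ℝ} {s : State}

theorem Eval.setR (h : Eval B l lo hi Q W s) (v : ℝ) (hx : x < B ∧ x ≠ 2 ∧ x ≠ 8) :
    Eval B l lo hi Q W (s.setR x v) where
  w5 := h.w5
  w9 := h.w9
  r2 := by simp [hx.2.1.symm, h.r2]
  r8 := by simp [hx.2.2.symm, h.r8]
  rlo i := by rw [State.setR_r, Function.update_of_ne (by omega), h.rlo]
  rhi i := by rw [State.setR_r, Function.update_of_ne (by omega), h.rhi]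
  ra := h.ra

theorem Eval.updW (h : Eval B l lo hi Q W s) (v : ℕ) (hx : x ≠ 5 ∧ x ≠ 9) :
    Eval B l lo hi Q W (s.updW x v) where
  w5 := by simp [hx.1.symm, h.w5]
  w9 := by simp [hx.2.symm, h.w9]
  r2 := h.r2
  r8 := h.r8
  rlo := h.rlo
  rhi := h.rhi
  ra := h.ra

theorem forall_fin_lt_succ {P : Fin d → Prop} {j : ℕ} (hj : j < d) :
    (∀ i : Fin d, i.val < j + 1 → P i) ↔ P ⟨j, hj⟩ ∧ ∀ i : Fin d, i.val < j → P i := by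
  refine ⟨fun h => ⟨h _ j.lt_succ_self, fun i hi => h i (by omega)⟩, fun h i hi => ?_⟩
  obtain hi | rfl := Nat.lt_succ_iff_lt_or_eq.1 hi
  exacts [h.2 i hi, h.1]

open Classical in
theorem runs_checkProg (hB : 11 ≤ B) (hp : p < l.length) {j : ℕ} (hj : j ≤ d)
    (hs : Eval B l lo hi Q W s) (h3 : s.w 3 = p) :
    Runs M (checkProg d B j) (checkProg d B j).cost s fun s' =>
      Eval B l lo hi Q W s' ∧ s'.w 3 = p ∧ s'.r 0 = s.r 0 +
        if ∀ i : Fin d, i.val < j → lo i ≤ l[p].1 i ∧ l[p].1 i ≤ hi i then s.r 3 else 0 := by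
  induction j generalizing s with
  | zero => exact .radd ⟨hs.setR _ (by omega), h3, by simp⟩
  | succ j ih =>
    have h_load : s.ra (1 + j) (s.w 3) = l[p].1 ⟨j, hj⟩ := by
      rw [hs.ra j (by omega), h3, pointArray, dif_pos hp, component, dif_pos]
    have hs₁ := hs.setR (x := 4) (l[p].1 ⟨j, hj⟩) (by omega)
    have h_lo : (s.setR 4 (l[p].1 ⟨j, hj⟩)).r (j + B) = lo ⟨j, hj⟩ := hs₁.rlo ⟨j, hj⟩
    have h_hi : (s.setR 4 (l[p].1 ⟨j, hj⟩)).r (d + j + B) = hi ⟨j, hj⟩ := hs₁.rhi ⟨j, hj⟩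
    have h4 : (s.setR 4 (l[p].1 ⟨j, hj⟩)).r 4 = l[p].1 ⟨j, hj⟩ := by simp
    simp only [forall_fin_lt_succ hj]
    refine .seq (.rload ?_)
    rw [h_load]
    refine .le (.branch (fun h => .skip ⟨hs₁, h3, ?_⟩) fun h => .branch (fun h' => .skip
      ⟨hs₁, h3, ?_⟩) fun h' => ?_) le_rfl
    all_goals rw [Test.Holds, h_lo, h4] at h
    all_goals try rw [Test.Holds, h_hi, h4] at h'
    · rw [if_neg fun h_all => h_all.1.1.not_gt h]
      simp
    · rw [if_neg fun h_all => h_all.1.2.not_gt h']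
      simp
    · refine (ih (by omega) hs₁ h3).imp fun s' ⟨hs', h3', h0⟩ => ⟨hs', h3', h0.trans ?_⟩
      simp [not_lt.1 h, not_lt.1 h']

theorem runs_nextPointProg (hB : 11 ≤ B) (hp : p < l.length) (hM : l.length < M)
    (hs : Eval B l lo hi Q W s) (h3 : s.w 3 = p) (h0 : s.r 0 = boxSum lo hi (l.take p)) :
    Runs M (nextPointProg d B) (nextPointProg d B).cost s fun s' =>
      Eval B l lo hi Q W s' ∧ s'.w 3 = p + 1 ∧ s'.r 0 = boxSum lo hi (l.take (p + 1)) := by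
  classical
  have h_load : s.ra (1 + d) (s.w 3) = l[p].2 := by
    rw [hs.ra d le_rfl, h3, pointArray, dif_pos hp, component_last]
  refine .seq (.rload ?_)
  rw [h_load]
  refine .andThen (runs_checkProg hB hp le_rfl (hs.setR _ (by omega)) h3)
    fun s' ⟨hs', h3', h0'⟩ => .wadd (by rw [h3', hs'.w9]; omega)
      ⟨hs'.updW _ (by omega), by simp [h3', hs'.w9], ?_⟩
  have h_mem : (∀ i : Fin d, i.val < d → lo i ≤ l[p].1 i ∧ l[p].1 i ≤ hi i) ↔
      l[p].1 ∈ Set.Icc lo hi :=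
    ⟨fun h => ⟨fun i => (h i i.2).1, fun i => (h i i.2).2⟩, fun h i _ => ⟨h.1 i, h.2 i⟩⟩
  rw [State.updW_r, h0', List.take_add_one, List.getElem?_eq_getElem hp, Option.toList_some,
    boxSum_append, ← h0]
  simp only [h_mem]
  simp [boxSum]

theorem runs_correctProg (hm : m < M) (h2 : s.r 2 = Q) (h8 : s.r 8 = W) :
    Runs M (correctProg m) (correctProg m).cost s fun s' => s'.r 0 = s.r 0 - W - m * Q := by
  refine .seq (.rsub (.seq (.wconst hm (.seq (.rcast (.seq (.rmul (.rsub ?_))))))))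
  simp [h2, h8]

theorem runs_evalProg (hB : 11 ≤ B) (hm : m < M) (hM : l.length < M)
    (hs : Eval B l lo hi Q W s) (h9 : s.r 9 = 0) :
    Runs M (evalProg d B m)
      (((nextPointProg d B).cost + 1) * l.length + ((correctProg m).cost + 3)) s fun s' =>
      s'.r 0 = boxSum lo hi l - W - m * Q := by
  refine .le (.seq (.rmov (.seq (.wconst (by omega) (.andThen (.loop (fun i s =>
    Eval B l lo hi Q W s ∧ s.w 3 = i ∧ s.r 0 = boxSum lo hi (l.take i)) l.length ?_ ?_ ?_
    (T := (nextPointProg d B).cost) ?_) (T' := (correctProg m).cost) ?_)))))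
    (by rw [mul_comm]; omega)
  · exact ⟨(hs.setR _ (by omega)).updW _ (by omega), by simp, by simp [h9, boxSum]⟩
  · rintro i hi s ⟨hs, h3, -⟩
    rwa [Test.Holds, hs.w5, h3]
  · rintro s ⟨hs, h3, -⟩
    rw [Test.Holds, hs.w5, h3]
    exact lt_irrefl _
  · rintro i hi s ⟨hs, h3, h0⟩
    exact runs_nextPointProg hB hi hM hs h3 h0
  · rintro s ⟨hs, -, h0⟩
    rw [List.take_length] at h0
    rw [← h0]
    exact runs_correctProg hm hs.r2 hs.r8

end Evaluation

/-! ### The whole program -/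

/-- The weight that an item gets in addition to the weight of its edge. -/
noncomputable def Design.bonus {d k D U : ℕ} (Δ : Design d k D U) (G : WeightedGraph k) : ℝ :=
  1 + 2 * (Δ.items.length * absSum G)

/-- The weight of the origin. -/
noncomputable def Design.originWeight {d k D U : ℕ} (Δ : Design d k D U) (b : ℕ)
    (G : WeightedGraph k) : ℝ :=
  ((Δ.points b G.n (weightOf G) (Δ.bonus G)).length + 1 : ℕ) * (Δ.bonus G + absSum G)

/-- The points of the instance of Max-Weight Rectangle that belongs to the graph `G`. -/
noncomputable def Design.graphPoints {d k D U : ℕ} (Δ : Design d k D U) (b : ℕ)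
    (G : WeightedGraph k) : List (Point d) :=
  Δ.pinnedPoints b G.n (weightOf G) (Δ.bonus G) (Δ.originWeight b G)

/-- The reduction to the program `p` for Max-Weight Rectangle, which runs in the memory from `B`
on. -/
noncomputable def Design.prog {d k D U : ℕ} (Δ : Design d k D U) (B : ℕ) (p : Prog) : Prog :=
  initProg D Δ.items.length ;; .forEach (itemProg Δ.seq D B) Δ.items ;; originProg d B ;;
    Op.wmov B 5 ;; p.shift B ;; evalProg d B Δ.items.length

section WholeProgram

variable {d k D U B M n b t : ℕ} {Q S : ℝ} {inp : ℕ → ℝ} {l : List (Point d)} {p : Prog}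
  {s s' : State} {Δ : Design d k D U} {G : WeightedGraph k}

theorem length_graphPoints_pos (Δ : Design d k D U) (b : ℕ) (G : WeightedGraph k) :
    0 < (Δ.graphPoints b G).length := by
  simp [Design.graphPoints, Design.pinnedPoints]

theorem length_graphPoints_le (Δ : Design d k D U) (hb : 0 < b) :
    (Δ.graphPoints b G).length ≤ (Δ.items.length * 2 ^ d + 1) * b ^ U := by
  rw [Design.graphPoints, Design.pinnedPoints, List.length_append, add_mul, one_mul]
  exact add_le_add (length_points_le Δ hb) (Nat.one_le_pow _ _ hb)

theorem splice_input (hB : d + 2 ≤ B) (hl : 0 < l.length) (hs : Written B n b Q S inp l s) :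
    (s.updW B l.length).splice B ((maxWeightRectangle d).input (toInstance l hl)) =
      s.updW B l.length := by
  refine State.splice_eq_self (fun x => ?_) (fun x => hs.hr x) (fun x => congrFun hs.wa _)
    fun x => ?_
  · obtain rfl | hx := eq_or_ne x 0
    · simp [maxWeightRectangle, toInstance]
    · rw [State.updW_w, Function.update_of_ne (by omega), hs.hw]
      exact (if_neg hx).symm
  · rw [State.updW_ra, hs.ra, add_comm, arrays_add _ hB]
    rfl

theorem Written.eval_splice (hB : d + 11 ≤ B) (hs : Written B n b Q S inp l s) {W : ℝ}
    (h8 : s.r 8 = W) (v : ℕ) (s' : State) :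
    Eval B l (fun i => s'.r i) (fun i => s'.r (d + i)) Q W ((s.updW B v).splice B s') where
  w5 := by simp [State.splice, splice_of_lt _ _ (show 5 < B by omega), hs.w5,
    (show 5 ≠ B by omega)]
  w9 := by simp [State.splice, splice_of_lt _ _ (show 9 < B by omega), hs.w9,
    (show 9 ≠ B by omega)]
  r2 := (splice_of_lt _ _ (by omega)).trans hs.r2
  r8 := (splice_of_lt _ _ (by omega)).trans h8
  rlo i := splice_add ..
  rhi i := splice_add ..
  ra i hi := by
    refine (splice_of_lt _ _ (by omega)).trans ?_
    rw [State.updW_ra, hs.ra, arrays_one_add _ hi]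

/-- The number of steps that `Design.prog` takes at most, where `t` steps are spent by the program
for Max-Weight Rectangle. -/
noncomputable def Design.progTime {d k D U : ℕ} (Δ : Design d k D U) (B b : ℕ) (G : WeightedGraph k)
    (t : ℕ) : ℕ :=
  (((powProg 2 D).cost + 5) * b + ((addAbsProg.cost + 1) * (G.n * G.n) + 3 +
    (bonusProg Δ.items.length).cost)) + (((Δ.items.map (itemTime Δ.seq D B)).sum + 1) * b ^ U +
    ((originProg d B).cost + (1 + (t + (((nextPointProg d B).cost + 1) *
      (Δ.graphPoints b G).length + ((correctProg Δ.items.length).cost + 3))))))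

theorem Design.runs_prog (Δ : Design d k D U) (hk : 2 ≤ k) (hB : d + 11 ≤ B)
    (hxB : ∀ x ∈ Δ.items, ∀ δ ∈ x.1.reads Δ.seq, 11 + δ < B) (hb : 0 < b) (hn : G.n ≤ b ^ D)
    (h_least : ∀ b' < b, b' ^ D < G.n) (hbM : b < M) (hDM : b ^ D < M) (hUM : b ^ U < M)
    (hnM : G.n * G.n < M) (hm : 2 * Δ.items.length < M) (hlM : (Δ.graphPoints b G).length < M)
    (h_exec : Exec M p ((maxWeightRectangle d).input
      (toInstance (Δ.graphPoints b G) (length_graphPoints_pos Δ b G))) t s)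
    (h_correct : (maxWeightRectangle d).Correct
      (toInstance (Δ.graphPoints b G) (length_graphPoints_pos Δ b G)) s) :
    Runs M (Δ.prog B p) (Δ.progTime B b G t) ((maxWeightClique k).input G)
      ((maxWeightClique k).Correct G) := by
  have h_len : (Δ.graphPoints b G).length =
      (Δ.points b G.n (weightOf G) (Δ.bonus G)).length + 1 := by
    simp [graphPoints, pinnedPoints]
  refine .andThen (runs_initProg d (by omega) hb hn h_least hbM hDM hnM hm)
    fun s₁ (hs₁ : Written B G.n b (Δ.bonus G) (absSum G) (weightArray G) [] s₁) =>
    .andThen (runs_items (w := weightOf G) hb hB hxB hDM hUM hnM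
      (fun i j hi hj => weightArray_eq hi hj) hs₁ (by rw [List.nil_append]; omega)) fun s₂ hs₂ =>
    .andThen (runs_originProg hB hs₂ (by rw [List.nil_append]; omega)) fun s₃ h₃ => ?_
  obtain ⟨hs₃, h8⟩ : Written B G.n b (Δ.bonus G) (absSum G) (weightArray G) (Δ.graphPoints b G) s₃ ∧
    s₃.r 8 = Δ.originWeight b G := h₃
  rw [← hs₃.w5] at hlM
  refine .seq (.wmov hlM (.seq ⟨t, (s₃.updW B (s₃.w 5)).splice B s, ?_, le_rfl,
    (runs_evalProg (by omega) (by omega) (hs₃.w5 ▸ hlM) (hs₃.eval_splice hB h8 _ s) ?_).imp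
      fun s' h0 => ?_⟩))
  · have h_shift := h_exec.shift B (s₃.updW B (s₃.w 5))
    rw [hs₃.w5] at h_shift ⊢
    rwa [splice_input (by omega) (length_graphPoints_pos Δ b G) hs₃] at h_shift
  · exact (splice_of_lt _ _ (by omega)).trans hs₃.r9
  · change IsGreatest _ (s'.r 0)
    rw [h0]
    refine isGreatest_of_optimal_box Δ hk G hb hn (absSum_nonneg G)
      (fun x y hx hy => abs_weightOf_le hx hy) rfl rfl fun lo' hi' hle => ?_
    have h_le := h_correct.2 lo' hi' hle
    rwa [boxWeight_toInstance, boxWeight_toInstance] at h_le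

theorem Design.exists_memory_bound (Δ : Design d k D U) :
    ∃ B, d + 11 ≤ B ∧ ∀ x ∈ Δ.items, ∀ δ ∈ x.1.reads Δ.seq, 11 + δ < B := by
  let δs := Δ.items.flatMap fun x => (x.1.reads Δ.seq).toList
  refine ⟨12 + d + δs.sum, by omega, fun x hx δ hδ => ?_⟩
  have h_le : δ ≤ δs.sum := List.single_le_sum (fun _ _ => Nat.zero_le _) _
    (List.mem_flatMap.2 ⟨x, hx, Finset.mem_toList.2 hδ⟩)
  omega

theorem Design.exists_progTime_le (Δ : Design d k D U) (B : ℕ) :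
    ∃ K : ℕ, ∀ (G : WeightedGraph k) (b t : ℕ), 0 < b →
      Δ.progTime B b G t ≤ K * (b + G.n * G.n + b ^ U) + t := by
  let cb := (powProg 2 D).cost + 5
  let cn := addAbsProg.cost + 1
  let cl := (nextPointProg d B).cost + 1
  let cU := (Δ.items.map (itemTime Δ.seq D B)).sum + 1
  let c₁ := 3 + (bonusProg Δ.items.length).cost + (originProg d B).cost + 1 +
    ((correctProg Δ.items.length).cost + 3)
  let cU' := cU + cl * (Δ.items.length * 2 ^ d + 1) + c₁
  refine ⟨cb + cn + cU', fun G b t hb => ?_⟩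
  have h_one : c₁ * 1 ≤ c₁ * b ^ U := Nat.mul_le_mul_left _ (Nat.one_le_pow _ _ hb)
  have h_len : cl * (Δ.graphPoints b G).length ≤ cl * ((Δ.items.length * 2 ^ d + 1) * b ^ U) :=
    Nat.mul_le_mul_left _ (length_graphPoints_le Δ hb)
  calc Δ.progTime B b G t
      = cb * b + cn * (G.n * G.n) + cU * b ^ U + cl * (Δ.graphPoints b G).length + c₁ + t := by
        simp only [progTime, cb, cn, cl, cU, c₁]
        ring
    _ ≤ cb * b + cn * (G.n * G.n) + cU' * b ^ U + t := by
        simp only [cU', add_mul, mul_assoc] at h_len h_one ⊢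
        omega
    _ ≤ (cb + cn + cU') * b + (cb + cn + cU') * (G.n * G.n) + (cb + cn + cU') * b ^ U + t := by
        gcongr <;> omega
    _ = (cb + cn + cU') * (b + G.n * G.n + b ^ U) + t := by ring

theorem Design.exists_reduction (Δ : Design d k D U) (hk : 2 ≤ k) (p : Prog) :
    ∃ (q : Prog) (K : ℕ), ∀ (G : WeightedGraph k) (b : ℕ), 0 < b → G.n ≤ b ^ D →
      (∀ b' < b, b' ^ D < G.n) → ∃ I : WeightedPoints d, I.N ≤ K * b ^ U ∧
        ∀ M, b < M → b ^ D < M → G.n * G.n < M → K * b ^ U < M → ∀ t s,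
          Exec M p ((maxWeightRectangle d).input I) t s → (maxWeightRectangle d).Correct I s →
          Runs M q (K * (b + G.n * G.n + b ^ U) + t) ((maxWeightClique k).input G)
            ((maxWeightClique k).Correct G) := by
  obtain ⟨B, hB, hxB⟩ := Δ.exists_memory_bound
  obtain ⟨K, hK⟩ := Δ.exists_progTime_le B
  set K₀ := Δ.items.length * 2 ^ d + 1
  refine ⟨Δ.prog B p, K + 2 * Δ.items.length + K₀, fun G b hb hn h_least =>
    ⟨toInstance _ (length_graphPoints_pos Δ b G), ?_, fun M hbM hDM hnM hKM t s h_exec h_correct =>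
    .le (Δ.runs_prog hk hB hxB hb hn h_least hbM hDM ?_ hnM ?_ ?_ h_exec h_correct)
      ((hK G b t hb).trans (by gcongr; omega))⟩⟩
  all_goals
    have h_len : (Δ.graphPoints b G).length ≤ K₀ * b ^ U := length_graphPoints_le Δ hb
    have h_one : 1 ≤ b ^ U := Nat.one_le_pow _ _ hb
  · exact h_len.trans (Nat.mul_le_mul_right _ (by omega))
  all_goals refine lt_of_le_of_lt ?_ hKM
  · exact Nat.le_mul_of_pos_left _ (Nat.succ_pos _)
  · exact (by omega : 2 * Δ.items.length ≤ _).trans (Nat.le_mul_of_pos_right _ h_one)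
  · exact h_len.trans (Nat.mul_le_mul_right _ (by omega))

end WholeProgram

end CliqueToRectangle

namespace CliqueToRectangle

/-! ### Tables that read two sides -/

/-- The check that compares the sides that a table reads finds no contradiction: a digit that the
table reads more than once always has the same value. -/
def Table.Consistent {d : ℕ} (seq : Fin d → Bool → ℕ → ℕ) (τ : Table d)
    (x : Fin d → Bool → ℕ → ℕ) : Prop :=
  ∀ i, ∀ j < τ.pre i, ∀ i', ∀ j' < τ.pre i',
    seq i (τ.side i) j = seq i' (τ.side i') j' → x i (τ.side i) j = x i' (τ.side i') j'

section TwoSides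

variable {d k D U : ℕ} {seq x : Fin d → Bool → ℕ → ℕ} {i i' p p' : ℕ} {s s' : Bool}

theorem Table.Matches.consistent {τ : Table d} {A : ℕ → ℕ} (h : τ.Matches seq x A) :
    τ.Consistent seq x := fun i j hj i' j' hj' hseq => by
  rw [← h i j hj, ← h i' j' hj', hseq]

theorem Design.nonempty_of_consistent (seq : Fin d → Bool → ℕ → ℕ) (len : Fin d → Bool → ℕ)
    (pairTable : ℕ → ℕ → Table d) (checks : List (Table d))
    (pre_le : ∀ u v, u < v → v < k → ∀ i, (pairTable u v).pre i ≤ len i ((pairTable u v).side i))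
    (card_pair : ∀ u v, u < v → v < k → ((pairTable u v).reads seq).card ≤ U)
    (card_check : ∀ τ ∈ checks, (τ.reads seq).card ≤ U)
    (covers : ∀ u v, u < v → v < k → ∀ i < D, u * D + i ∈ (pairTable u v).reads seq ∧
      v * D + i ∈ (pairTable u v).reads seq)
    (sound : ∀ x, (∀ τ ∈ checks, τ.Consistent seq x) →
      ∃ A₀ : ℕ → ℕ, ∀ i s, ∀ p < len i s, x i s p = A₀ (seq i s p)) :
    Nonempty (Design d k D U) := by
  refine ⟨⟨seq, pairTable, checks, card_pair, card_check,
    fun u v huv hv i hi => (covers u v huv hv i hi).1,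
    fun u v huv hv i hi => (covers u v huv hv i hi).2, fun x A h_checks h_pairs => ?_⟩⟩
  obtain ⟨A₀, hA₀⟩ := sound x fun τ hτ => (h_checks τ hτ).consistent
  have h_eq : ∀ u v, u < v → v < k → ∀ δ ∈ (pairTable u v).reads seq,
      A (pairTable u v) δ = A₀ δ := fun u v huv hv δ =>
    (h_pairs u v huv hv).eq_of_mem_reads
      fun i j hj => (hA₀ i _ j (hj.trans_le (pre_le u v huv hv i))).symm
  exact ⟨A₀, fun u v huv hv i hi => ⟨h_eq u v huv hv _ (covers u v huv hv i hi).1,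
    h_eq u v huv hv _ (covers u v huv hv i hi).2⟩⟩

theorem Table.card_reads_le (seq : Fin d → Bool → ℕ → ℕ) (τ : Table d) :
    (τ.reads seq).card ≤ ∑ i, τ.pre i :=
  Finset.card_biUnion_le.trans <| Finset.sum_le_sum fun i _ =>
    Finset.card_image_le.trans_eq (Finset.card_range (τ.pre i))

/-- The table that reads the first `p` digits on side `s` of dimension `i` and, if `i' ≠ i`, the
first `p'` digits on side `s'` of dimension `i'`. -/
def Table.twoSides (d i : ℕ) (s : Bool) (p i' : ℕ) (s' : Bool) (p' : ℕ) : Table d where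
  side e := if (e : ℕ) = i then s else s'
  pre e := if (e : ℕ) = i then p else if (e : ℕ) = i' then p' else 0

theorem Table.card_reads_twoSides_le :
    ((Table.twoSides d i s p i' s' p').reads seq).card ≤ p + p' := by
  have h_single (m a : ℕ) : ∑ e : Fin d, (if (e : ℕ) = m then a else 0) ≤ a := by
    rw [Fin.sum_univ_eq_sum_range (fun e => if e = m then a else 0), Finset.sum_ite_eq']
    split_ifs <;> omega
  calc ((Table.twoSides d i s p i' s' p').reads seq).card
      ≤ ∑ e, (Table.twoSides d i s p i' s' p').pre e := Table.card_reads_le _ _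
    _ ≤ ∑ e : Fin d, ((if (e : ℕ) = i then p else 0) + if (e : ℕ) = i' then p' else 0) := by
        refine Finset.sum_le_sum fun e _ => ?_
        simp only [Table.twoSides]
        split_ifs <;> omega
    _ ≤ p + p' := by
        rw [Finset.sum_add_distrib]
        exact add_le_add (h_single i p) (h_single i' p')

theorem Table.mem_reads_twoSides {δ : ℕ} :
    δ ∈ (Table.twoSides d i s p i' s' p').reads seq ↔
      (∃ h : i < d, ∃ j < p, seq ⟨i, h⟩ s j = δ) ∨
        i' ≠ i ∧ ∃ h : i' < d, ∃ j < p', seq ⟨i', h⟩ s' j = δ := by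
  rw [Table.mem_reads]
  constructor
  · rintro ⟨e, j, hj, hδ⟩
    simp only [Table.twoSides] at hj hδ
    split_ifs at hj hδ with hi hi'
    · subst hi
      exact .inl ⟨e.2, j, hj, hδ⟩
    · subst hi'
      exact .inr ⟨hi, e.2, j, hj, hδ⟩
    · omega
  · rintro (⟨hi, j, hj, hδ⟩ | ⟨hne, hi', j, hj, hδ⟩)
    · exact ⟨⟨i, hi⟩, j, by simpa [Table.twoSides] using hj, by simpa [Table.twoSides] using hδ⟩
    · exact ⟨⟨i', hi'⟩, j, by simpa [Table.twoSides, hne] using hj,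
        by simpa [Table.twoSides, hne] using hδ⟩

theorem Table.twoSides_pre_le {len : Fin d → Bool → ℕ} {e : Fin d}
    (h : (e : ℕ) = i → p ≤ len e s) (h' : (e : ℕ) = i' → p' ≤ len e s') :
    (Table.twoSides d i s p i' s' p').pre e ≤
      len e ((Table.twoSides d i s p i' s' p').side e) := by
  simp only [Table.twoSides]
  split_ifs with hi hi'
  · exact h hi
  · exact h' hi'
  · exact Nat.zero_le _

theorem Table.Consistent.eq_of_twoSides {i i' : Fin d} {j j' : ℕ}
    (h : (Table.twoSides d i s p i' s' p').Consistent seq x) (hne : i' ≠ i) (hj : j < p)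
    (hj' : j' < p') (hseq : seq i s j = seq i' s' j') : x i s j = x i' s' j' := by
  have hne' : (i' : ℕ) ≠ i := fun hii' => hne (Fin.ext hii')
  simpa [Table.twoSides, hne'] using h i j (by simpa [Table.twoSides]) i' j'
    (by simpa [Table.twoSides, hne']) (by simpa [Table.twoSides, hne'])

end TwoSides

theorem exists_forall_mul_add_eq {d m n : ℕ} {α : Type*} [Inhabited α] (f g : Fin d → ℕ → α) :
    ∃ A : ℕ → α, ∀ i : Fin d, (∀ p < m, A (i * m + p) = f i p) ∧
      ∀ p < n, A (d * m + i * n + p) = g i p := by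
  let merge (m : ℕ) (f : Fin d → ℕ → α) (δ : ℕ) : α :=
    if h : δ / m < d then f ⟨δ / m, h⟩ (δ % m) else default
  have h_merge {m : ℕ} (f : Fin d → ℕ → α) (i : Fin d) (p : ℕ) (hp : p < m) :
      merge m f (i * m + p) = f i p := by
    have h_div : (i * m + p) / m = i := by
      rw [mul_comm, Nat.mul_add_div (Nat.zero_lt_of_lt hp), Nat.div_eq_of_lt hp, add_zero]
    simp [merge, h_div, Nat.mod_eq_of_lt hp]
  refine ⟨fun δ => if δ < d * m then merge m f δ else merge n g (δ - d * m),
    fun i => ⟨fun p hp => ?_, fun p hp => ?_⟩⟩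
  · simp only [if_pos (mul_add_lt_mul i.2 hp), h_merge f i p hp]
  · simp only [add_assoc, if_neg (Nat.not_lt.2 (Nat.le_add_right _ _)), Nat.add_sub_cancel_left,
      h_merge g i p hp]

/-- The cyclic successor on `{0, …, d - 1}`. -/
def cyclicSucc (d i : ℕ) : ℕ := if i + 1 = d then 0 else i + 1

/-- The cyclic predecessor on `{0, …, d - 1}`. -/
def cyclicPred (d i : ℕ) : ℕ := if i = 0 then d - 1 else i - 1

section Cyclic

variable {d i : ℕ}

theorem cyclicSucc_lt (hi : i < d) : cyclicSucc d i < d := by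
  unfold cyclicSucc
  split_ifs <;> omega

theorem cyclicSucc_ne (hd : 2 ≤ d) : cyclicSucc d i ≠ i := by
  unfold cyclicSucc
  split_ifs <;> omega

theorem cyclicPred_lt (hi : i < d) : cyclicPred d i < d := by
  unfold cyclicPred
  split_ifs <;> omega

theorem cyclicSucc_cyclicPred (hi : i < d) : cyclicSucc d (cyclicPred d i) = i := by
  unfold cyclicPred cyclicSucc
  split_ifs <;> omega

theorem cyclicPred_cyclicSucc : cyclicPred d (cyclicSucc d i) = i := by
  by_cases h : i + 1 = d
  · simp only [cyclicSucc, cyclicPred, if_pos h, if_true]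
    omega
  · simp only [cyclicSucc, cyclicPred, if_neg h, Nat.add_one_ne_zero, if_false,
      Nat.add_sub_cancel]

end Cyclic

end CliqueToRectangle

namespace CliqueToRectangle

/-! ### The block design: `k = d q + r` with `q ≥ 2` -/

/-- In the block design the digits of the first `d q` vertices form `d` blocks of `q d` digits, and
the digits of the last `r` vertices form `d` chunks of `r` digits. Side `true` of dimension `i`
encodes block `i` and chunk `i`; side `false` encodes chunk `i`, then the next block in reverse
order, then the next chunk. -/
def blockSeq (d q r i : ℕ) : Bool → ℕ → ℕ
  | true, p => if p < q * d then i * (q * d) + p else d * (q * d) + i * r + (p - q * d)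
  | false, p =>
    if p < r then d * (q * d) + i * r + p
    else if p < r + q * d then cyclicSucc d i * (q * d) + (q * d - 1 - (p - r))
    else d * (q * d) + cyclicSucc d i * r + (p - (r + q * d))

/-- The number of digits that a side encodes in the block design. -/
def blockLength (d q r : ℕ) (s : Bool) : ℕ := if s then q * d + r else r + q * d + r

/-- The checks of the block design: side `false` of each dimension is compared with side `true` of
the next dimension and with the first chunk on its side `false`. -/
def blockChecks (d q r : ℕ) : List (Table d) :=
  (List.range d).map (fun i =>
      Table.twoSides d i false (r + q * d + r) (cyclicSucc d i) true (q * d + r)) ++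
    (List.range d).map fun i =>
      Table.twoSides d i false (r + q * d + r) (cyclicSucc d i) false r

/-- The digits `l d, …, l d + d - 1` lie in the prefixes of this length of the chunks of length `r`:
chunks before the one of digit `l d` are skipped, those after it are read as far as needed. -/
def chunkCut (d r l i : ℕ) : ℕ := if l * d / r ≤ i then min r ((l + 1) * d - i * r) else 0

/-- The table that reads block `a`, and the `l`-th of the last `r` vertices from the chunks. -/
def blockChunkTable (d q r a l : ℕ) : Table d where
  side i := decide ((i : ℕ) = a)
  pre i := (if (i : ℕ) = a then q * d else 0) + chunkCut d r l i

/-- The table that reads the `l`-th and the `l'`-th of the last `r` vertices from the chunks. -/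
def chunkChunkTable (d r l l' : ℕ) : Table d where
  side _ := false
  pre i := max (chunkCut d r l i) (chunkCut d r l' i)

/-- The table of a pair of vertices in the block design. Two vertices in different blocks are read
either from the starts of their blocks or, if the prefixes would be too long together, from the
ends, with which the reversed blocks on the sides `false` begin. -/
def blockPair (d q r u v : ℕ) : Table d :=
  if v < d * q then
    if u / q = v / q then Table.twoSides d (u / q) true (q * d) (u / q) true 0
    else if u % q + v % q + 2 ≤ q + 1 then
      Table.twoSides d (u / q) true ((u % q + 1) * d) (v / q) true ((v % q + 1) * d)
    else
      Table.twoSides d (cyclicPred d (u / q)) false (r + (q - u % q) * d)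
        (cyclicPred d (v / q)) false (r + (q - v % q) * d)
  else if u < d * q then blockChunkTable d q r (u / q) (v - d * q)
  else chunkChunkTable d r (u - d * q) (v - d * q)

section BlockDesign

variable {d q r i l l' p u v x : ℕ}

theorem blockSeq_true_of_lt (hp : p < q * d) : blockSeq d q r i true p = i * (q * d) + p :=
  if_pos hp

theorem blockSeq_true_add : blockSeq d q r i true (q * d + p) = d * (q * d) + i * r + p := by
  rw [blockSeq, if_neg (by omega), Nat.add_sub_cancel_left]

theorem blockSeq_false_of_lt (hp : p < r) :
    blockSeq d q r i false p = d * (q * d) + i * r + p :=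
  if_pos hp

theorem blockSeq_false_reverse (hp : p < q * d) :
    blockSeq d q r i false (r + (q * d - 1 - p)) = cyclicSucc d i * (q * d) + p := by
  rw [blockSeq, if_neg (by omega), if_pos (by omega)]
  omega

theorem blockSeq_false_add :
    blockSeq d q r i false (r + q * d + p) = d * (q * d) + cyclicSucc d i * r + p := by
  rw [blockSeq, if_neg (by omega), if_neg (by omega), Nat.add_sub_cancel_left]

theorem blockSeq_consistent (hd : 2 ≤ d) {x : Fin d → Bool → ℕ → ℕ}
    (h : ∀ τ ∈ blockChecks d q r, τ.Consistent (fun i => blockSeq d q r i) x) (i : Fin d) :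
    (∀ p < q * d, x i false (r + (q * d - 1 - p)) = x ⟨_, cyclicSucc_lt i.2⟩ true p) ∧
    (∀ p < r, x i false (r + q * d + p) = x ⟨_, cyclicSucc_lt i.2⟩ true (q * d + p)) ∧
    (∀ p < r, x i false (r + q * d + p) = x ⟨_, cyclicSucc_lt i.2⟩ false p) := by
  have hi : (i : ℕ) ∈ List.range d := List.mem_range.2 i.2
  have h_ne : (⟨_, cyclicSucc_lt i.2⟩ : Fin d) ≠ i := fun h => cyclicSucc_ne hd (congrArg Fin.val h)
  have h_true := h _ (List.mem_append_left _ (List.mem_map_of_mem hi))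
  have h_false := h _ (List.mem_append_right _ (List.mem_map_of_mem hi))
  refine ⟨fun p hp => ?_, fun p hp => ?_, fun p hp => ?_⟩
  · refine h_true.eq_of_twoSides (i' := ⟨_, cyclicSucc_lt i.2⟩) h_ne (by omega) (by omega) ?_
    rw [blockSeq_false_reverse hp, blockSeq_true_of_lt hp]
  · refine h_true.eq_of_twoSides (i' := ⟨_, cyclicSucc_lt i.2⟩) h_ne (by omega) (by omega) ?_
    rw [blockSeq_false_add, blockSeq_true_add]
  · refine h_false.eq_of_twoSides (i' := ⟨_, cyclicSucc_lt i.2⟩) h_ne (by omega) hp ?_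
    rw [blockSeq_false_add, blockSeq_false_of_lt hp]

theorem blockChecks_sound (hd : 2 ≤ d) (x : Fin d → Bool → ℕ → ℕ)
    (h : ∀ τ ∈ blockChecks d q r, τ.Consistent (fun i => blockSeq d q r i) x) :
    ∃ A : ℕ → ℕ, ∀ (i : Fin d) (s : Bool), ∀ p < blockLength d q r s,
      x i s p = A (blockSeq d q r i s p) := by
  have h_consistent := blockSeq_consistent hd h
  obtain ⟨A, hA⟩ := exists_forall_mul_add_eq (m := q * d) (n := r) (fun i => x i true)
    fun i => x i false
  refine ⟨A, fun i s p hp => ?_⟩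
  obtain ⟨h_reverse, -, h_chunk⟩ := h_consistent i
  obtain ⟨h_block', h_chunk'⟩ := hA ⟨_, cyclicSucc_lt i.2⟩
  cases s with
  | true =>
    simp only [blockLength, if_true] at hp
    obtain hp' | ⟨p, rfl⟩ := (lt_or_ge p (q * d)).imp_right Nat.exists_eq_add_of_le
    · rw [blockSeq_true_of_lt hp', (hA i).1 p hp']
    obtain ⟨-, h_true, h_false⟩ := h_consistent ⟨_, cyclicPred_lt i.2⟩
    simp only [cyclicSucc_cyclicPred i.2, Fin.eta] at h_true h_false
    rw [blockSeq_true_add, (hA i).2 p (by omega), ← h_true p (by omega), h_false p (by omega)]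
  | false =>
    simp only [blockLength, Bool.false_eq_true, if_false] at hp
    obtain hp' | ⟨p, rfl⟩ := (lt_or_ge p r).imp_right Nat.exists_eq_add_of_le
    · rw [blockSeq_false_of_lt hp', (hA i).2 p hp']
    obtain hp' | ⟨p, rfl⟩ := (lt_or_ge p (q * d)).imp_right Nat.exists_eq_add_of_le
    · obtain ⟨j, hj, rfl⟩ : ∃ j < q * d, p = q * d - 1 - j := ⟨q * d - 1 - p, by omega, by omega⟩
      rw [blockSeq_false_reverse hj, h_reverse j hj, h_block' j hj]
    · rw [← add_assoc, blockSeq_false_add, h_chunk p (by omega), h_chunk' p (by omega)]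

theorem block_mul_add_eq (u x : ℕ) : u / q * (q * d) + (u % q * d + x) = u * d + x := by
  conv_rhs => rw [← Nat.div_add_mod' u q]
  ring

theorem blockSeq_true_vertex (hq : 0 < q) (hx : x < d) :
    u % q * d + x < q * d ∧ blockSeq d q r (u / q) true (u % q * d + x) = u * d + x := by
  have h := mul_add_lt_mul (Nat.mod_lt u hq) hx
  exact ⟨h, by rw [blockSeq_true_of_lt h, block_mul_add_eq]⟩

theorem exists_blockSeq_false_vertex (hq : 0 < q) (hx : x < d) (hu : u / q < d) :
    ∃ p < r + (q - u % q) * d, blockSeq d q r (cyclicPred d (u / q)) false p = u * d + x := by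
  have h := mul_add_lt_mul (Nat.mod_lt u hq) hx
  refine ⟨r + (q * d - 1 - (u % q * d + x)), ?_, ?_⟩
  · rw [Nat.sub_mul]
    omega
  · rw [blockSeq_false_reverse h, cyclicSucc_cyclicPred hu, block_mul_add_eq]

theorem chunkCut_le (d r l i : ℕ) : chunkCut d r l i ≤ r := by
  unfold chunkCut
  split_ifs <;> omega

theorem exists_lt_chunkCut (hl : l < r) (hx : x < d) :
    ∃ i < d, ∃ p < chunkCut d r l i, d * (q * d) + i * r + p = (d * q + l) * d + x := by
  have hr : 0 < r := Nat.zero_lt_of_lt hl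
  have h_mod := Nat.mod_lt (l * d + x) hr
  have h_div_mod := Nat.div_add_mod' (l * d + x) r
  refine ⟨(l * d + x) / r, ?_, (l * d + x) % r, ?_, ?_⟩
  · rw [Nat.div_lt_iff_lt_mul hr, mul_comm d]
    exact mul_add_lt_mul hl hx
  · rw [chunkCut, if_pos (Nat.div_le_div_right (Nat.le_add_right _ _)), add_mul]
    omega
  · rw [add_assoc, h_div_mod]
    ring

theorem mem_reads_blockChunkTable_block (hq : 0 < q) (hu : u / q < d) (hx : x < d) :
    u * d + x ∈ (blockChunkTable d q r (u / q) l).reads fun i => blockSeq d q r i := by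
  obtain ⟨hp, h_seq⟩ := blockSeq_true_vertex (r := r) (u := u) hq hx
  refine Table.mem_reads.2 ⟨⟨u / q, hu⟩, u % q * d + x, ?_, ?_⟩
  · simpa only [blockChunkTable, if_true] using Nat.lt_add_right _ hp
  · simpa only [blockChunkTable, decide_true] using h_seq

theorem mem_reads_blockChunkTable_chunk {a : ℕ} (hl : l < r) (hx : x < d) :
    (d * q + l) * d + x ∈ (blockChunkTable d q r a l).reads fun i => blockSeq d q r i := by
  obtain ⟨i, hi, p, hp, h_seq⟩ := exists_lt_chunkCut (q := q) hl hx
  by_cases hia : i = a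
  · refine Table.mem_reads.2 ⟨⟨i, hi⟩, q * d + p, ?_, ?_⟩
    · simpa only [blockChunkTable, if_pos hia] using Nat.add_lt_add_left hp _
    · simpa only [blockChunkTable, hia, decide_true, blockSeq_true_add] using hia ▸ h_seq
  · refine Table.mem_reads.2 ⟨⟨i, hi⟩, p, ?_, ?_⟩
    · simpa only [blockChunkTable, if_neg hia, zero_add] using hp
    · simpa only [blockChunkTable, hia, decide_false,
        blockSeq_false_of_lt (hp.trans_le (chunkCut_le ..))] using h_seq

theorem chunkChunkTable_comm : chunkChunkTable d r l l' = chunkChunkTable d r l' l := by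
  simp only [chunkChunkTable, max_comm]

theorem mem_reads_chunkChunkTable (hl : l < r) (hx : x < d) :
    (d * q + l) * d + x ∈ (chunkChunkTable d r l l').reads fun i => blockSeq d q r i := by
  obtain ⟨i, hi, p, hp, h_seq⟩ := exists_lt_chunkCut (q := q) hl hx
  refine Table.mem_reads.2 ⟨⟨i, hi⟩, p, lt_max_of_lt_left hp, ?_⟩
  simpa only [chunkChunkTable, blockSeq_false_of_lt (hp.trans_le (chunkCut_le ..))] using h_seq

theorem mem_reads_blockPair (hq : 0 < q) (huv : u < v) (hv : v < d * q + r) (hx : x < d) :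
    u * d + x ∈ (blockPair d q r u v).reads (fun i => blockSeq d q r i) ∧
      v * d + x ∈ (blockPair d q r u v).reads (fun i => blockSeq d q r i) := by
  have h_div {w : ℕ} (hw : w < d * q) : w / q < d := (Nat.div_lt_iff_lt_mul hq).2 hw
  have h_true (w : ℕ) := blockSeq_true_vertex (r := r) (u := w) hq hx
  have h_start (w : ℕ) : w % q * d + x < (w % q + 1) * d := mul_add_lt_mul (Nat.lt_succ_self _) hx
  unfold blockPair
  split_ifs with hvq h_block h_near huq
  all_goals try simp only [Table.mem_reads_twoSides]
  · exact ⟨.inl ⟨h_div (huv.trans hvq), _, h_true u⟩,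
      .inl ⟨h_div (huv.trans hvq), _, h_block ▸ h_true v⟩⟩
  · exact ⟨.inl ⟨h_div (huv.trans hvq), _, h_start u, (h_true u).2⟩,
      .inr ⟨Ne.symm h_block, h_div hvq, _, h_start v, (h_true v).2⟩⟩
  · have hu' := h_div (huv.trans hvq)
    refine ⟨.inl ⟨cyclicPred_lt hu', exists_blockSeq_false_vertex hq hx hu'⟩,
      .inr ⟨fun h => h_block ?_, cyclicPred_lt (h_div hvq),
        exists_blockSeq_false_vertex hq hx (h_div hvq)⟩⟩
    rw [← cyclicSucc_cyclicPred hu', ← cyclicSucc_cyclicPred (h_div hvq), h]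
  · obtain ⟨l, rfl⟩ := Nat.exists_eq_add_of_le (not_lt.1 hvq)
    rw [Nat.add_sub_cancel_left]
    exact ⟨mem_reads_blockChunkTable_block hq (h_div huq) hx,
      mem_reads_blockChunkTable_chunk (by omega) hx⟩
  · obtain ⟨l, rfl⟩ := Nat.exists_eq_add_of_le (not_lt.1 huq)
    obtain ⟨l', rfl⟩ := Nat.exists_eq_add_of_le (not_lt.1 hvq)
    simp only [Nat.add_sub_cancel_left]
    refine ⟨mem_reads_chunkChunkTable (by omega) hx, ?_⟩
    rw [chunkChunkTable_comm]
    exact mem_reads_chunkChunkTable (by omega) hx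

theorem blockPair_pre_le (hq : 0 < q) (i : Fin d) :
    (blockPair d q r u v).pre i ≤ blockLength d q r ((blockPair d q r u v).side i) := by
  have h_start (w : ℕ) : (w % q + 1) * d ≤ q * d := Nat.mul_le_mul_right d (Nat.mod_lt w hq)
  have h_end (w : ℕ) : (q - w % q) * d ≤ q * d := Nat.mul_le_mul_right d (Nat.sub_le _ _)
  have h_true : blockLength d q r true = q * d + r := rfl
  have h_false : blockLength d q r false = r + q * d + r := rfl
  have h_cut (l : ℕ) := chunkCut_le d r l i
  unfold blockPair
  split_ifs
  · exact Table.twoSides_pre_le (len := fun _ => blockLength d q r) (fun _ => by omega)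
      fun _ => by omega
  · exact Table.twoSides_pre_le (len := fun _ => blockLength d q r)
      (fun _ => (h_start u).trans (by omega)) fun _ => (h_start v).trans (by omega)
  · have := h_end u
    have := h_end v
    exact Table.twoSides_pre_le (len := fun _ => blockLength d q r) (fun _ => by omega)
      fun _ => by omega
  · have := h_cut (v - d * q)
    by_cases hi : (i : ℕ) = u / q
    · simp only [blockChunkTable, if_pos hi, decide_eq_true hi]
      omega
    · simp only [blockChunkTable, if_neg hi, decide_eq_false hi]
      omega
  · exact (max_le (h_cut _) (h_cut _)).trans (by simp only [chunkChunkTable]; omega)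

theorem Table.card_reads_le_of_subset {seq : Fin d → Bool → ℕ → ℕ} {τ : Table d} {s t : Finset ℕ}
    (h : τ.reads seq ⊆ s ∪ t) : (τ.reads seq).card ≤ s.card + t.card :=
  (Finset.card_le_card h).trans (Finset.card_union_le s t)

theorem card_blockCheck (hr : r < d) {τ : Table d} (hτ : τ ∈ blockChecks d q r) :
    (τ.reads fun i => blockSeq d q r i).card ≤ d * q + r + d := by
  have h_card (i : ℕ) (h : τ.reads (fun i => blockSeq d q r i) ⊆
      Finset.Ico (d * (q * d) + i * r) (d * (q * d) + i * r + r) ∪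
      (Finset.Ico (cyclicSucc d i * (q * d)) (cyclicSucc d i * (q * d) + q * d) ∪
        Finset.Ico (d * (q * d) + cyclicSucc d i * r)
          (d * (q * d) + cyclicSucc d i * r + r))) :
      (τ.reads fun i => blockSeq d q r i).card ≤ d * q + r + d := by
    refine (Table.card_reads_le_of_subset h).trans
      ((Nat.add_le_add_left (Finset.card_union_le _ _) _).trans ?_)
    simp only [Nat.card_Ico, mul_comm d q]
    omega
  simp only [blockChecks, List.mem_append, List.mem_map] at hτ
  obtain ⟨i, -, rfl⟩ | ⟨i, -, rfl⟩ := hτ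
  all_goals
    refine h_card i fun δ hδ => ?_
    simp only [Finset.mem_union, Finset.mem_Ico]
    obtain ⟨-, p, hp, rfl⟩ | ⟨-, -, p, hp, rfl⟩ := Table.mem_reads_twoSides.1 hδ
    all_goals
      simp only [blockSeq]
      split_ifs <;> omega

/-- The digits that are read if the prefixes of the chunks have the lengths `chunkCut d r l`. -/
def chunkCutDigits (d q r l : ℕ) : Finset ℕ :=
  Finset.Ico (d * (q * d) + l * d / r * r) (d * (q * d) + (l + 1) * d)

theorem card_chunkCutDigits_le (hr : 0 < r) : (chunkCutDigits d q r l).card ≤ d + r := by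
  have := Nat.lt_div_mul_add (a := l * d) hr
  rw [chunkCutDigits, Nat.card_Ico, add_mul]
  omega

theorem mem_chunkCutDigits (hp : p < chunkCut d r l i) :
    d * (q * d) + i * r + p ∈ chunkCutDigits d q r l := by
  unfold chunkCut at hp
  split_ifs at hp with hi
  · have := Nat.mul_le_mul_right r hi
    rw [chunkCutDigits, Finset.mem_Ico]
    omega
  · omega

theorem card_reads_blockChunkTable_le {a : ℕ} (hr : 0 < r) :
    ((blockChunkTable d q r a l).reads fun i => blockSeq d q r i).card ≤ d * q + r + d := by
  refine (Table.card_reads_le_of_subset (s := Finset.Ico (a * (q * d)) (a * (q * d) + q * d))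
    (t := chunkCutDigits d q r l) fun δ hδ => ?_).trans ?_
  · obtain ⟨i, p, hp, rfl⟩ := Table.mem_reads.1 hδ
    rw [Finset.mem_union]
    by_cases hi : (i : ℕ) = a
    · simp only [blockChunkTable, hi, if_true, decide_true] at hp ⊢
      obtain hp' | ⟨p, rfl⟩ := (lt_or_ge p (q * d)).imp_right Nat.exists_eq_add_of_le
      · rw [blockSeq_true_of_lt hp', Finset.mem_Ico]
        exact .inl ⟨Nat.le_add_right _ _, Nat.add_lt_add_left hp' _⟩
      · rw [blockSeq_true_add]
        exact .inr (mem_chunkCutDigits (Nat.lt_of_add_lt_add_left hp))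
    · simp only [blockChunkTable, hi, if_false, zero_add, decide_false] at hp ⊢
      rw [blockSeq_false_of_lt (hp.trans_le (chunkCut_le ..))]
      exact .inr (mem_chunkCutDigits hp)
  · have := card_chunkCutDigits_le (d := d) (q := q) (l := l) hr
    rw [Nat.card_Ico, Nat.add_sub_cancel_left, mul_comm d q]
    omega

theorem card_reads_chunkChunkTable_le (hq : 2 ≤ q) (hr : 0 < r) (hrd : r < d) :
    ((chunkChunkTable d r l l').reads fun i => blockSeq d q r i).card ≤ d * q + r + d := by
  refine (Table.card_reads_le_of_subset (s := chunkCutDigits d q r l)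
    (t := chunkCutDigits d q r l') fun δ hδ => ?_).trans ?_
  · obtain ⟨i, p, hp, rfl⟩ := Table.mem_reads.1 hδ
    simp only [chunkChunkTable] at hp ⊢
    rw [blockSeq_false_of_lt (hp.trans_le (max_le (chunkCut_le ..) (chunkCut_le ..))),
      Finset.mem_union]
    exact (lt_max_iff.1 hp).imp mem_chunkCutDigits mem_chunkCutDigits
  · have h := card_chunkCutDigits_le (d := d) (q := q) (l := l) hr
    have h' := card_chunkCutDigits_le (d := d) (q := q) (l := l') hr
    have hdq := Nat.mul_le_mul_left d hq
    omega

theorem card_blockPair (hq : 2 ≤ q) (hr : r < d) (hv : v < d * q + r) :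
    ((blockPair d q r u v).reads fun i => blockSeq d q r i).card ≤ d * q + r + d := by
  unfold blockPair
  split_ifs with hvq h_block h_near huq
  · refine Table.card_reads_twoSides_le.trans ?_
    rw [mul_comm d]
    omega
  · refine Table.card_reads_twoSides_le.trans ?_
    calc (u % q + 1) * d + (v % q + 1) * d = (u % q + v % q + 2) * d := by ring
      _ ≤ (q + 1) * d := Nat.mul_le_mul_right d h_near
      _ ≤ d * q + r + d := by rw [add_mul, mul_comm q]; omega
  · refine Table.card_reads_twoSides_le.trans ?_
    have hu := Nat.mod_lt u (Nat.zero_lt_of_lt hq)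
    have hv := Nat.mod_lt v (Nat.zero_lt_of_lt hq)
    calc r + (q - u % q) * d + (r + (q - v % q) * d)
        = r + ((q - u % q) + (q - v % q)) * d + r := by ring
      _ ≤ r + q * d + r := by gcongr; omega
      _ ≤ d * q + r + d := by rw [mul_comm d]; omega
  · exact card_reads_blockChunkTable_le (by omega)
  · exact card_reads_chunkChunkTable_le hq (by omega) hr

theorem nonempty_blockDesign (hq : 2 ≤ q) (hr : r < d) (hd : 2 ≤ d) :
    Nonempty (Design d (d * q + r) d (d * q + r + d)) :=
  Design.nonempty_of_consistent (fun i => blockSeq d q r i) (fun _ => blockLength d q r)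
    (blockPair d q r) (blockChecks d q r) (fun _ _ _ _ => blockPair_pre_le (by omega))
    (fun _ _ _ => card_blockPair hq hr) (fun _ => card_blockCheck hr)
    (fun _ _ huv hv _ => mem_reads_blockPair (by omega) huv hv) (blockChecks_sound hd)

end BlockDesign

end CliqueToRectangle

namespace CliqueToRectangle

/-! ### The head design: `k = d + r` with `2 ≤ r < d` -/

/-- In the head design the digits of the last `r` vertices form `2 d` chunks of `r` digits, and each
side begins with one of them, its head. This is the number of the head of a side; the shift by one
dimension ensures that a head has no digit in common with a vertex encoded in the same dimension. -/
def headIndex (d i : ℕ) (s : Bool) : ℕ := 2 * cyclicPred d i + s.toNat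

/-- In the head design each vertex has `2 d` digits. After the head, side `true` of dimension `i`
encodes vertex `i` and vertex `d + i`, and side `false` encodes vertex `d + i`. -/
def headSeq (d r i : ℕ) : Bool → ℕ → ℕ
  | true, p =>
    if p < r then d * (2 * d) + headIndex d i true * r + p
    else if p < r + 2 * d then i * (2 * d) + (p - r)
    else d * (2 * d) + i * (2 * d) + (p - (r + 2 * d))
  | false, p =>
    if p < r then d * (2 * d) + headIndex d i false * r + p
    else d * (2 * d) + i * (2 * d) + (p - r)

/-- The number of digits that a side encodes in the head design. -/
def headLength (d r i : ℕ) (s : Bool) : ℕ :=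
  r + (if s then 2 * d else 0) + if i < r then 2 * d else 0

/-- The checks of the head design: the sides that encode one of the last `r` vertices are compared
with all heads. -/
def headChecks (d r : ℕ) : List (Table d) :=
  (List.range r).flatMap fun j => (List.range d).flatMap fun i => [false, true].flatMap fun s =>
    [Table.twoSides d j true (r + 2 * d + 2 * d) i s r, Table.twoSides d j false (r + 2 * d) i s r]

/-- The table of a pair of vertices in the head design. -/
def headPair (d r u v : ℕ) : Table d :=
  if v < d then Table.twoSides d u true (r + 2 * d) v true (r + 2 * d)
  else if u < d then
    if v - d = u then Table.twoSides d u true (r + 2 * d + 2 * d) u true 0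
    else Table.twoSides d u true (r + 2 * d) (v - d) false (r + 2 * d)
  else Table.twoSides d (u - d) false (r + 2 * d) (v - d) false (r + 2 * d)

section HeadDesign

variable {d r i j p u v : ℕ} {s : Bool}

theorem headIndex_lt (hi : i < d) : headIndex d i s < 2 * d := by
  have := cyclicPred_lt hi
  have := Bool.toNat_le s
  unfold headIndex
  omega

theorem exists_headIndex_eq {c : ℕ} (hc : c < 2 * d) : ∃ i < d, ∃ s, headIndex d i s = c := by
  refine ⟨cyclicSucc d (c / 2), cyclicSucc_lt (by omega), decide (c % 2 = 1), ?_⟩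
  rw [headIndex, cyclicPred_cyclicSucc]
  obtain h | h := Nat.mod_two_eq_zero_or_one c <;> simp [h] <;> omega

theorem headSeq_of_lt (hp : p < r) :
    headSeq d r i s p = d * (2 * d) + headIndex d i s * r + p := by
  cases s <;> exact if_pos hp

theorem headSeq_true_add (hp : p < 2 * d) : headSeq d r i true (r + p) = i * (2 * d) + p := by
  rw [headSeq, if_neg (by omega), if_pos (by omega), Nat.add_sub_cancel_left]

theorem headSeq_true_add_add :
    headSeq d r i true (r + 2 * d + p) = d * (2 * d) + i * (2 * d) + p := by
  rw [headSeq, if_neg (by omega), if_neg (by omega), Nat.add_sub_cancel_left]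

theorem headSeq_false_add : headSeq d r i false (r + p) = d * (2 * d) + i * (2 * d) + p := by
  rw [headSeq, if_neg (by omega), Nat.add_sub_cancel_left]

theorem ne_of_headIndex_mul_add_eq (hr : 2 ≤ r) (hrd : r < d) {x : ℕ} (hp : p < r)
    (hx : x < 2 * d) (h : headIndex d i s * r + p = j * (2 * d) + x) : j ≠ i := by
  rintro rfl
  have h_toNat := Bool.toNat_le s
  obtain rfl | hj := Nat.eq_zero_or_pos j
  · have h_mul : (2 * d - 2) * 2 ≤ headIndex d 0 s * r :=
      Nat.mul_le_mul (by simp only [headIndex, cyclicPred, if_true]; omega) hr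
    omega
  · have h_succ : headIndex d j s + 1 ≤ 2 * j := by
      simp only [headIndex, cyclicPred, if_neg hj.ne']
      omega
    have h_mul : headIndex d j s * r + r ≤ j * (2 * d) := calc
      headIndex d j s * r + r = (headIndex d j s + 1) * r := (Nat.succ_mul _ _).symm
      _ ≤ 2 * j * d := Nat.mul_le_mul h_succ hrd.le
      _ = j * (2 * d) := by ring
    omega

theorem exists_vertex_of_head (hr : 2 ≤ r) (hrd : r < d) (hi : i < d) (s : Bool) (hp : p < r) :
    ∃ j < r, j ≠ i ∧ ∃ x < 2 * d, headSeq d r i s p = d * (2 * d) + j * (2 * d) + x := by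
  have hd : 0 < 2 * d := by omega
  have h_lt := mul_add_lt_mul (headIndex_lt (s := s) hi) hp
  have h_eq := (Nat.div_add_mod' (headIndex d i s * r + p) (2 * d)).symm
  have h_mod := Nat.mod_lt (headIndex d i s * r + p) hd
  refine ⟨_, (Nat.div_lt_iff_lt_mul hd).2 (h_lt.trans_eq (mul_comm _ _)),
    ne_of_headIndex_mul_add_eq hr hrd hp h_mod h_eq, _, h_mod, ?_⟩
  rw [headSeq_of_lt hp, add_assoc, add_assoc, ← h_eq]

theorem exists_head_of_vertex (hr : 2 ≤ r) (hrd : r < d) (hj : j < r) {x : ℕ} (hx : x < 2 * d) :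
    ∃ i < d, i ≠ j ∧ ∃ s, ∃ p < r, headSeq d r i s p = d * (2 * d) + j * (2 * d) + x := by
  have hr0 : 0 < r := Nat.zero_lt_of_lt hj
  have h_lt := (mul_add_lt_mul hj hx).trans_eq (mul_comm r (2 * d))
  obtain ⟨i, hi, s, h_index⟩ := exists_headIndex_eq ((Nat.div_lt_iff_lt_mul hr0).2 h_lt)
  have h_eq := Nat.div_add_mod' (j * (2 * d) + x) r
  have h_mod := Nat.mod_lt (j * (2 * d) + x) hr0
  rw [← h_index] at h_eq
  refine ⟨i, hi, (ne_of_headIndex_mul_add_eq hr hrd h_mod hx h_eq).symm, s, _, h_mod, ?_⟩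
  rw [headSeq_of_lt h_mod, add_assoc, h_eq, add_assoc]

theorem mem_headChecks {τ : Table d} : τ ∈ headChecks d r ↔ ∃ j < r, ∃ i < d, ∃ s,
    τ = Table.twoSides d j true (r + 2 * d + 2 * d) i s r ∨
      τ = Table.twoSides d j false (r + 2 * d) i s r := by
  simp only [headChecks, List.mem_flatMap, List.mem_range, List.mem_cons, List.not_mem_nil,
    or_false, exists_eq_or_imp, exists_eq_left, Bool.exists_bool]

theorem headSeq_consistent {x : Fin d → Bool → ℕ → ℕ}
    (h : ∀ τ ∈ headChecks d r, τ.Consistent (fun i => headSeq d r i) x) {i j : Fin d}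
    (hj : (j : ℕ) < r) (hij : i ≠ j) (s : Bool) {p y : ℕ} (hp : p < r) (hy : y < 2 * d)
    (h_eq : headSeq d r i s p = d * (2 * d) + j * (2 * d) + y) :
    x j true (r + 2 * d + y) = x i s p ∧ x j false (r + y) = x i s p :=
  ⟨(h _ (mem_headChecks.2 ⟨j, hj, i, i.2, s, .inl rfl⟩)).eq_of_twoSides hij (by omega) hp
      (headSeq_true_add_add.trans h_eq.symm),
    (h _ (mem_headChecks.2 ⟨j, hj, i, i.2, s, .inr rfl⟩)).eq_of_twoSides hij (by omega) hp
      (headSeq_false_add.trans h_eq.symm)⟩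

theorem headChecks_sound (hr : 2 ≤ r) (hrd : r < d) (x : Fin d → Bool → ℕ → ℕ)
    (h : ∀ τ ∈ headChecks d r, τ.Consistent (fun i => headSeq d r i) x) :
    ∃ A : ℕ → ℕ, ∀ (i : Fin d) (s : Bool), ∀ p < headLength d r i s,
      x i s p = A (headSeq d r i s p) := by
  obtain ⟨A, hA⟩ := exists_forall_mul_add_eq (m := 2 * d) (n := 2 * d)
    (fun i p => x i true (r + p)) fun i p => x i false (r + p)
  have h_head (i : Fin d) (s : Bool) (p : ℕ) (hp : p < r) : x i s p = A (headSeq d r i s p) := by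
    obtain ⟨j, hj, hji, y, hy, h_eq⟩ := exists_vertex_of_head hr hrd i.2 s hp
    have h_ne : i ≠ ⟨j, hj.trans hrd⟩ := fun hij => hji (congrArg Fin.val hij).symm
    rw [h_eq, (hA ⟨j, hj.trans hrd⟩).2 y hy, (headSeq_consistent h hj h_ne s hp hy h_eq).2]
  refine ⟨A, fun i s p hp => ?_⟩
  obtain hp' | ⟨p, rfl⟩ := (lt_or_ge p r).imp_right Nat.exists_eq_add_of_le
  · exact h_head i s p hp'
  cases s with
  | false =>
    have hp' : p < 2 * d := by
      simp only [headLength, Bool.false_eq_true, if_false] at hp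
      split_ifs at hp <;> omega
    rw [headSeq_false_add, (hA i).2 p hp']
  | true =>
    obtain hp' | ⟨y, rfl⟩ := (lt_or_ge p (2 * d)).imp_right Nat.exists_eq_add_of_le
    · rw [headSeq_true_add hp', (hA i).1 p hp']
    obtain ⟨hi, hy⟩ : (i : ℕ) < r ∧ y < 2 * d := by
      simp only [headLength, if_true] at hp
      split_ifs at hp with hi <;> omega
    obtain ⟨e, he, hei, s, p, hp, h_eq⟩ := exists_head_of_vertex hr hrd hi hy
    have h_ne : ⟨e, he⟩ ≠ i := fun h => hei (congrArg Fin.val h)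
    rw [← add_assoc, headSeq_true_add_add, ← h_eq, ← h_head ⟨e, he⟩ s p hp,
      (headSeq_consistent h hi h_ne s hp hy h_eq).1]

theorem mem_reads_headPair (huv : u < v) (hv : v < d + r) (hrd : r < d) (hp : p < 2 * d) :
    u * (2 * d) + p ∈ (headPair d r u v).reads (fun i => headSeq d r i) ∧
      v * (2 * d) + p ∈ (headPair d r u v).reads (fun i => headSeq d r i) := by
  have h_true (w : ℕ) : ∃ j < r + 2 * d, headSeq d r w true j = w * (2 * d) + p :=
    ⟨r + p, by omega, headSeq_true_add hp⟩
  have h_false (w : ℕ) (hw : d ≤ w) :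
      ∃ j < r + 2 * d, headSeq d r (w - d) false j = w * (2 * d) + p :=
    ⟨r + p, by omega, by rw [headSeq_false_add, ← add_mul, Nat.add_sub_cancel' hw]⟩
  unfold headPair
  split_ifs with hvd hud hvu <;> simp only [Table.mem_reads_twoSides]
  · exact ⟨.inl ⟨by omega, h_true u⟩, .inr ⟨by omega, hvd, h_true v⟩⟩
  · refine ⟨.inl ⟨hud, r + p, by omega, headSeq_true_add hp⟩,
      .inl ⟨hud, r + 2 * d + p, by omega, ?_⟩⟩
    rw [headSeq_true_add_add, ← add_mul, ← hvu, Nat.add_sub_cancel' (not_lt.1 hvd)]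
  · exact ⟨.inl ⟨hud, h_true u⟩, .inr ⟨hvu, by omega, h_false v (by omega)⟩⟩
  · exact ⟨.inl ⟨by omega, h_false u (by omega)⟩,
      .inr ⟨by omega, by omega, h_false v (by omega)⟩⟩

theorem card_headPair :
    ((headPair d r u v).reads fun i => headSeq d r i).card ≤ 2 * (d + r + d) := by
  unfold headPair
  split_ifs <;> refine Table.card_reads_twoSides_le.trans ?_ <;> omega

theorem card_headCheck {τ : Table d} (hτ : τ ∈ headChecks d r) :
    (τ.reads fun i => headSeq d r i).card ≤ 2 * (d + r + d) := by
  obtain ⟨j, -, i, -, s, rfl | rfl⟩ := mem_headChecks.1 hτ <;>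
    refine Table.card_reads_twoSides_le.trans ?_ <;> omega

theorem headPair_pre_le (huv : u < v) (hv : v < d + r) (i : Fin d) :
    (headPair d r u v).pre i ≤ headLength d r i ((headPair d r u v).side i) := by
  have h_true : r + 2 * d ≤ headLength d r i true := Nat.le_add_right _ _
  have h_last (hi : (i : ℕ) < r) (s : Bool) : r + 2 * d ≤ headLength d r i s := by
    rw [headLength, if_pos hi]
    omega
  unfold headPair
  split_ifs with hvd hud hvu
  all_goals
    refine Table.twoSides_pre_le (len := fun i => headLength d r i) (fun hi => ?_) fun hi => ?_
  · exact h_true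
  · exact h_true
  · rw [headLength, if_pos (show (i : ℕ) < r by omega)]
    exact le_rfl
  · exact Nat.zero_le _
  · exact h_true
  · exact h_last (by omega) false
  · exact h_last (by omega) false
  · exact h_last (by omega) false

theorem nonempty_headDesign (hr : 2 ≤ r) (hrd : r < d) :
    Nonempty (Design d (d + r) (2 * d) (2 * (d + r + d))) :=
  Design.nonempty_of_consistent (fun i => headSeq d r i) (fun i => headLength d r i)
    (headPair d r) (headChecks d r) (fun _ _ => headPair_pre_le) (fun _ _ _ _ => card_headPair)
    (fun _ => card_headCheck) (fun _ _ huv hv _ => mem_reads_headPair huv hv hrd)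
    (headChecks_sound hr hrd)

end HeadDesign

end CliqueToRectangle

/-! ### Running times -/

namespace CliqueToRectangle

open RealRAM

section Arithmetic

variable {D U K N b c n : ℕ}

theorem exists_base (hn : 2 ≤ n) (hD : 0 < D) :
    ∃ b : ℕ, 0 < b ∧ b ≤ n ∧ n ≤ b ^ D ∧ (∀ b' < b, b' ^ D < n) ∧
      ∃ a : ℕ, a ^ D ≤ n ∧ b ≤ 2 * a := by
  classical
  have h_pow : n ≤ n ^ D := Nat.le_self_pow hD.ne' n
  have h_ex : ∃ b, n ≤ b ^ D := ⟨n, h_pow⟩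
  have h_least : ∀ b' < Nat.find h_ex, b' ^ D < n := fun b' hb' =>
    not_le.1 (Nat.find_min h_ex hb')
  have two_le : 2 ≤ Nat.find h_ex := by
    by_contra! h
    have h_one := Nat.pow_le_pow_left (Nat.le_of_lt_succ h) D
    rw [one_pow] at h_one
    exact absurd (hn.trans ((Nat.find_spec h_ex).trans h_one)) (by decide)
  exact ⟨Nat.find h_ex, by omega, Nat.find_min' h_ex h_pow, Nat.find_spec h_ex, h_least,
    Nat.find h_ex - 1, (h_least _ (by omega)).le, by omega⟩

theorem mul_pow_le_add_two_pow (hb : b ≤ n) : K * b ^ U ≤ (n + 2) ^ (K + U) := by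
  rw [pow_add]
  exact Nat.mul_le_mul (Nat.lt_two_pow_self.le.trans (Nat.pow_le_pow_left (by omega) K))
    (Nat.pow_le_pow_left (by omega) U)

theorem add_two_pow_le {e : ℕ} (hN : N ≤ (n + 2) ^ e) :
    (N + 2) ^ c ≤ (n + 2) ^ ((e + 2) * c) := by
  rw [pow_mul]
  refine Nat.pow_le_pow_left ?_ c
  have one_le : 1 ≤ (n + 2) ^ e := Nat.one_le_pow _ _ (by omega)
  have four_le : 2 * 2 ≤ (n + 2) ^ 2 := by
    rw [sq]
    exact Nat.mul_le_mul (by omega) (by omega)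
  calc N + 2 ≤ (n + 2) ^ e * (2 * 2) := by omega
    _ ≤ (n + 2) ^ (e + 2) := by
      rw [pow_add]
      exact Nat.mul_le_mul_left _ four_le

theorem pow_le_two_pow_mul_rpow {a d k : ℕ} (hd : 0 < d) (hU : U * d = (k + d) * D)
    (ha : a ^ D ≤ n) (hb : b ≤ 2 * a) :
    (b : ℝ) ^ U ≤ 2 ^ U * (n : ℝ) ^ ((k : ℝ) / d + 1) := by
  have U_eq : (U : ℝ) = D * ((k : ℝ) / d + 1) := by
    have : (U : ℝ) * d = (k + d) * D := by exact_mod_cast hU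
    field_simp
    linarith
  have ha' : (a : ℝ) ^ D ≤ n := by exact_mod_cast ha
  have hb' : (b : ℝ) ≤ 2 * a := by exact_mod_cast hb
  calc (b : ℝ) ^ U ≤ (2 * a) ^ U := by gcongr
    _ = 2 ^ U * ((a : ℝ) ^ D) ^ ((k : ℝ) / d + 1) := by
      rw [mul_pow, ← Real.rpow_natCast (a : ℝ) U, U_eq, Real.rpow_mul (by positivity),
        Real.rpow_natCast]
    _ ≤ 2 ^ U * (n : ℝ) ^ ((k : ℝ) / d + 1) := by gcongr

theorem div_add_one_mul_sub_le {d k ε : ℝ} (hd : 0 < d) (hkε : d ^ 2 ≤ k * ε) :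
    (k / d + 1) * (d - ε) ≤ k - ε := by
  have d_le : d ≤ k * ε / d := by rwa [le_div_iff₀ hd, ← sq]
  calc (k / d + 1) * (d - ε) = k - ε + (d - k * ε / d) := by field_simp; ring
    _ ≤ k - ε := by linarith

theorem rpow_le_mul_rpow {A x y α β γ : ℝ} (hA : 0 ≤ A) (hy : 0 ≤ y) (hx : 1 ≤ x)
    (hyx : y ≤ A * x ^ β) (hα : 0 ≤ α) (hγ : β * α ≤ γ) : y ^ α ≤ A ^ α * x ^ γ := by
  have x_nonneg : 0 ≤ x := by linarith
  calc y ^ α ≤ (A * x ^ β) ^ α := Real.rpow_le_rpow hy hyx hα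
    _ = A ^ α * x ^ (β * α) := by
      rw [Real.mul_rpow hA (by positivity), ← Real.rpow_mul x_nonneg]
    _ ≤ A ^ α * x ^ γ := by gcongr

theorem add_sq_add_le_mul_rpow {A x y z γ : ℝ} (hx : 1 ≤ x) (hy : y ≤ x) (hγ : 2 ≤ γ)
    (hz : z ≤ A * x ^ γ) : y + x * x + z ≤ (2 + A) * x ^ γ := by
  have sq_le : x * x ≤ x ^ γ := by
    rw [← sq, ← Real.rpow_natCast]
    exact Real.rpow_le_rpow_of_exponent_le hx (by exact_mod_cast hγ)
  have y_le : y ≤ x ^ γ := hy.trans ((le_mul_of_one_le_left (by linarith) hx).trans sq_le)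
  linarith

end Arithmetic

section Solvable

variable {d k D U : ℕ}

/-- The exponent of the word size in which the reduction runs, if its rectangle instances come from
`exists_reduction` with the constant `K` and are solved with words of size `(N + 2) ^ c`. -/
def wordExponent (D U K c : ℕ) : ℕ :=
  (K + U + 2) * c + (K + U + D + 3)

theorem lt_pow_wordExponent {K c n e x : ℕ} (he : e < K + U + D + 3) (hx : x ≤ (n + 2) ^ e) :
    x < (n + 2) ^ wordExponent D U K c :=
  hx.trans_lt (Nat.pow_lt_pow_right (by omega) (by rw [wordExponent]; omega))

theorem Design.exists_runs (Δ : Design d k D U) (hk : 2 ≤ k) (hD : 0 < D) {p : Prog} {c : ℕ}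
    {T : ℕ → ℝ} (h : ∀ I : WeightedPoints d, ∃ t s, Exec ((I.N + 2) ^ c) p
      ((maxWeightRectangle d).input I) t s ∧ (t : ℝ) ≤ T I.N ∧ (maxWeightRectangle d).Correct I s) :
    ∃ (q : Prog) (K : ℕ), ∀ G : WeightedGraph k, ∃ a b N t t' : ℕ, ∃ s,
      b ≤ G.n ∧ a ^ D ≤ G.n ∧ b ≤ 2 * a ∧ N ≤ K * b ^ U ∧ (t : ℝ) ≤ T N ∧
      t' ≤ K * (b + G.n * G.n + b ^ U) + t ∧
      Exec ((G.n + 2) ^ wordExponent D U K c) q ((maxWeightClique k).input G) t' s ∧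
      (maxWeightClique k).Correct G s := by
  obtain ⟨q, K, hq⟩ := Δ.exists_reduction hk p
  refine ⟨q, K, fun G => ?_⟩
  obtain ⟨b, hb, hbn, hnb, h_least, a, ha, hba⟩ := exists_base (hk.trans G.le) hD
  obtain ⟨I, hI, hq⟩ := hq G b hb hnb h_least
  obtain ⟨t, s, hexec, ht, hs⟩ := h I
  have pow_le (e : ℕ) : b ^ e ≤ (G.n + 2) ^ e := Nat.pow_le_pow_left (by omega) e
  have KU_le := mul_pow_le_add_two_pow (K := K) (U := U) hbn
  have sq_le : G.n * G.n ≤ (G.n + 2) ^ 2 := by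
    rw [sq]
    exact Nat.mul_le_mul (by omega) (by omega)
  have input_words_le : (I.N + 2) ^ c ≤ (G.n + 2) ^ wordExponent D U K c :=
    (add_two_pow_le (hI.trans KU_le)).trans
      (Nat.pow_le_pow_right (by omega) (Nat.le_add_right _ _))
  obtain ⟨t', s', hexec', ht', hs'⟩ := hq ((G.n + 2) ^ wordExponent D U K c)
    (lt_pow_wordExponent (e := 1) (by omega) (by rw [pow_one]; omega))
    (lt_pow_wordExponent (by omega) (pow_le D)) (lt_pow_wordExponent (by omega) sq_le)
    (lt_pow_wordExponent (by omega) KU_le) t s (hexec.mono input_words_le) hs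
  exact ⟨a, b, I.N, t, t', s', hbn, ha, hba, hI, ht, ht', hexec', hs'⟩

theorem solvable_maxWeightClique_of_design (Δ : Design d k D U) (hd : 0 < d) (hk : 2 ≤ k)
    (hD : 0 < D) (hdk : d ≤ k) (hU : U * d = (k + d) * D) {ε : ℝ} (hε : 1 ≤ d - ε)
    (hkε : (d : ℝ) ^ 2 ≤ k * ε)
    (h : SolvableInTime (maxWeightRectangle d) fun N => (N : ℝ) ^ ((d : ℝ) - ε)) :
    SolvableInTime (maxWeightClique k) fun n => (n : ℝ) ^ ((k : ℝ) - ε) := by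
  obtain ⟨p, c, C, h⟩ := h
  obtain ⟨q, K, hq⟩ := Δ.exists_runs (T := fun N => C * (N : ℝ) ^ ((d : ℝ) - ε)) hk hD h
  refine ⟨q, wordExponent D U K c, K * (2 + 2 ^ U) + |C| * ((K : ℝ) * 2 ^ U) ^ ((d : ℝ) - ε),
    fun G => ?_⟩
  obtain ⟨a, b, N, t, t', s, hbn, ha, hba, hN, ht, ht', hexec, hs⟩ := hq G
  refine ⟨t', s, hexec, ?_, hs⟩
  change (t' : ℝ) ≤ _ * (G.n : ℝ) ^ ((k : ℝ) - ε)
  have one_le_n : (1 : ℝ) ≤ G.n := by exact_mod_cast (by have := G.le; omega : 1 ≤ G.n)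
  have hd' : (0 : ℝ) < d := by exact_mod_cast hd
  have two_le_exponent : 2 ≤ (k : ℝ) / d + 1 := by
    have : 1 ≤ (k : ℝ) / d := by rw [one_le_div hd']; exact_mod_cast hdk
    linarith
  have exponent_mul_le := div_add_one_mul_sub_le hd' hkε
  have exponent_le : (k : ℝ) / d + 1 ≤ k - ε :=
    (le_mul_of_one_le_right (by linarith) hε).trans exponent_mul_le
  have bU_le := pow_le_two_pow_mul_rpow hd hU ha hba
  have N_le : (N : ℝ) ≤ K * 2 ^ U * (G.n : ℝ) ^ ((k : ℝ) / d + 1) := by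
    rw [mul_assoc]
    exact (by exact_mod_cast hN : (N : ℝ) ≤ K * (b : ℝ) ^ U).trans (by gcongr)
  have t_le : (t : ℝ) ≤ |C| * (((K : ℝ) * 2 ^ U) ^ ((d : ℝ) - ε) * (G.n : ℝ) ^ ((k : ℝ) - ε)) :=
    ht.trans (mul_le_mul (le_abs_self C) (rpow_le_mul_rpow (by positivity) (by positivity)
      one_le_n N_le (by linarith) exponent_mul_le) (by positivity) (abs_nonneg C))
  have overhead_le : (b : ℝ) + G.n * G.n + (b : ℝ) ^ U ≤
      (2 + 2 ^ U) * (G.n : ℝ) ^ ((k : ℝ) - ε) :=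
    add_sq_add_le_mul_rpow one_le_n (by exact_mod_cast hbn) (two_le_exponent.trans exponent_le)
      (bU_le.trans (by gcongr))
  calc (t' : ℝ) ≤ K * (b + G.n * G.n + (b : ℝ) ^ U) + t := by exact_mod_cast ht'
    _ ≤ K * ((2 + 2 ^ U) * (G.n : ℝ) ^ ((k : ℝ) - ε)) + _ :=
      add_le_add (by gcongr) t_le
    _ = _ := by ring

end Solvable

end CliqueToRectangle

theorem mainTheorem1_general (d : ℕ) (hd : 2 ≤ d) (ε : ℝ) (hε : 0 < ε) (k : ℕ)
    (hkε : (d : ℝ) ^ 2 / ε ≤ k)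
    (h : RealRAM.SolvableInTime (maxWeightRectangle d) (fun N => (N : ℝ) ^ ((d : ℝ) - ε))) :
    RealRAM.SolvableInTime (maxWeightClique k) (fun n => (n : ℝ) ^ ((k : ℝ) - ε)) := by
  have hα : 1 ≤ (d : ℝ) - ε := CliqueToRectangle.one_le_of_solvable_maxWeightRectangle (by omega) h
  rw [div_le_iff₀ hε] at hkε
  have hk : d + 2 ≤ k := by
    by_contra! hlt
    have k_le : (k : ℝ) ≤ d + 1 := by exact_mod_cast Nat.le_of_lt_succ hlt
    have : (2 : ℝ) ≤ d := by exact_mod_cast hd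
    nlinarith
  rcases le_or_gt (2 * d) k with hkd | hkd
  · obtain ⟨Δ⟩ := CliqueToRectangle.nonempty_blockDesign (d := d) (q := k / d) (r := k % d)
      ((Nat.le_div_iff_mul_le (by omega)).2 hkd) (Nat.mod_lt _ (by omega)) hd
    rw [Nat.div_add_mod] at Δ
    exact CliqueToRectangle.solvable_maxWeightClique_of_design Δ (by omega) (by omega) (by omega)
      (by omega) rfl hα hkε h
  · obtain ⟨r, rfl⟩ := Nat.exists_eq_add_of_le (show d ≤ k by omega)
    obtain ⟨Δ⟩ := CliqueToRectangle.nonempty_headDesign (d := d) (r := r) (by omega) (by omega)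
    exact CliqueToRectangle.solvable_maxWeightClique_of_design Δ (by omega) (by omega) (by omega)
      (by omega) (by ring) hα hkε h

theorem mainTheorem1 (d : ℕ) (hd : 2 ≤ d) (ε : ℝ) (hε : 0 < ε)
    (h : RealRAM.SolvableInTime (maxWeightRectangle d) (fun N => (N : ℝ) ^ ((d : ℝ) - ε))) :
    RealRAM.SolvableInTime (maxWeightClique ⌈(d : ℝ) ^ 2 / ε⌉₊)
      (fun n => (n : ℝ) ^ ((⌈(d : ℝ) ^ 2 / ε⌉₊ : ℝ) - ε)) := by
  exact mainTheorem1_general d hd ε hε _ (Nat.le_ceil _) h
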